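/- Let $(a_n)_{n\ge1}$ be a sequence of positive real numbers that is regularly varying with index $\alpha>0$, i.e. $a_{\lfloor cn\rfloor}/a_n\to c^{\alpha}$ as $n\to\infty$ for every $c>0$. For $n\ge 1$ let $\mathsf b_n$ be a closed segment of length $a_n$. Let $T_1=\mathsf b_1$, rooted at one of its two extremities, and recursively, for $n\ge1$, let $T_{n+1}$ be obtained by gluing one extremity of $\mathsf b_{n+1}$ to a random point of $T_n$ which, given $T_n$, is uniform on $T_n$ (i.e. distributed according to the normalized length measure). Let $d$ denote the length metric of these trees. Let $D_n=d(X_n,\mathrm{root})$, where, given $T_n$, the point $X_n$ is uniform on $T_n$, and let $H_n=\max_{v\in T_n}d(v,\mathrm{root})$. For $\lambda\in\mathbb R$ set $$\phi_{(\alpha)}(\lambda)=\frac{\alpha+1}{\alpha}\int_0^1\big(e^{\lambda u}-1\big)\frac{1-u}{u}\,du .$$ There is exactly one probability distribution on $\mathbb R$ such that a random variable $\xi_{(\alpha)}$ with this distribution satisfies $\mathbb E[e^{\lambda\xi_{(\alpha)}}]=e^{\phi_{(\alpha)}(\lambda)}$ for all $\lambda\in\mathbb R$. Moreover: (i) $D_n/a_n$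 converges in distribution to $\xi_{(\alpha)}$ as $n\to\infty$. More precisely, $\mathbb E[\exp(\lambda D_n/a_n)]\to\mathbb E[\exp(\lambda\xi_{(\alpha)})]$ for all $\lambda\in\mathbb R$; in particular all positive moments converge: $\mathbb E[(D_n/a_n)^p]\to\mathbb E[\xi_{(\alpha)}^p]<\infty$ for all real $p>0$. (ii) Almost surely, $$\frac{H_n\,\ln\ln n}{a_n\ln n}\longrightarrow 1\qquad\text{as } n\to\infty .$$ -/

import Mathlib

open MeasureTheory ProbabilityTheory Filter Topology

noncomputable section

namespace LineBreaking

/-- Regular variation of the sequence `(a n)`, `n ≥ 1`, with index `α`. -/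
def IsRegularlyVarying (a : ℕ → ℝ) (α : ℝ) : Prop :=
  ∀ c : ℝ, 0 < c → Tendsto (fun n : ℕ => a ⌊c * n⌋₊ / a n) atTop (𝓝 (c ^ α))

/-- The points of `T n`. The segments are `b 1, b 2, …`, where `b i` has length `a i`, and the pair
`(i, s)` with `0 ≤ s ≤ a i` is the point of `b i` at distance `s` from its base, the extremity by
which `b i` is glued to the earlier segments. The base `(i, 0)`, `i ≥ 2`, is the same point of the
tree as the point to which it is glued: it has distance `0` to it for `treeDist` below. -/
def treePoints (a : ℕ → ℝ) (n : ℕ) : Set (ℕ × ℝ) :=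
  {x | x.1 ∈ Set.Icc 1 n ∧ x.2 ∈ Set.Icc 0 (a x.1)}

/-- The root, an extremity of `b 1`. -/
def root : ℕ × ℝ := (1, 0)

/-- The length metric of `T n` (as a pseudometric on `treePoints a n`), when for each `k ≥ 1` the
segment `b (k + 1)` is glued by its base to the point `g k` of `T k`. Two points of the new segment
are at their distance in the segment; a path between the new segment and the older tree passes
through the gluing point; distances in the older tree do not change. The tree `T 0` is empty, so
that the value at stage `0` plays no role. -/
def treeDist (g : ℕ → ℕ × ℝ) : ℕ → ℕ × ℝ → ℕ × ℝ → ℝ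
  | 0, _, _ => 0
  | n + 1, x, y =>
    if x.1 = n + 1 then
      if y.1 = n + 1 then |x.2 - y.2| else x.2 + treeDist g n (g n) y
    else
      if y.1 = n + 1 then treeDist g n x (g n) + y.2 else treeDist g n x y

/-- The uniform probability measure on `T n`: the length measure (Lebesgue measure on each of the
segments `b 1, …, b n`), divided by the total length. -/
def uniformMeasure (a : ℕ → ℝ) (n : ℕ) : Measure (ℕ × ℝ) :=
  (ENNReal.ofReal (∑ i ∈ Finset.Icc 1 n, a i))⁻¹ •
    ∑ i ∈ Finset.Icc 1 n, (volume.restrict (Set.Icc 0 (a i))).map (Prod.mk i)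

/-- `Z` is a uniform random point of `T n` given `T n`, where `T n` is the tree built with the
random gluing points `Y 1, …, Y (n - 1)`: whatever these are, the conditional law of the coordinates
of `Z` is the normalized length measure. -/
def IsUniformPoint {Ω : Type*} [MeasurableSpace Ω] (P : Measure Ω) (a : ℕ → ℝ)
    (Y : ℕ → Ω → ℕ × ℝ) (n : ℕ) (Z : Ω → ℕ × ℝ) : Prop :=
  Measurable Z ∧ P.map Z = uniformMeasure a n ∧
    IndepFun Z (fun ω (k : Finset.Ico 1 n) => Y k ω) P

/-- `Y` is a sequence of gluing points of the `(a n)`-model: for each `n ≥ 1`, the point `Y n`, to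
which `b (n + 1)` is glued, is uniform on `T n` given `T n`. -/
def IsGluingSequence {Ω : Type*} [MeasurableSpace Ω] (P : Measure Ω) (a : ℕ → ℝ)
    (Y : ℕ → Ω → ℕ × ℝ) : Prop :=
  ∀ n : ℕ, 1 ≤ n → IsUniformPoint P a Y n (Y n)

/-- The height `D n = d(X n, root)` in `T n` of the point `X n`. -/
def pointHeight {Ω : Type*} (Y X : ℕ → Ω → ℕ × ℝ) (n : ℕ) (ω : Ω) : ℝ :=
  treeDist (fun k => Y k ω) n (X n ω) root

/-- The height `H n` of the tree `T n`. -/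
def treeHeight {Ω : Type*} (a : ℕ → ℝ) (Y : ℕ → Ω → ℕ × ℝ) (n : ℕ) (ω : Ω) : ℝ :=
  sSup ((fun v => treeDist (fun k => Y k ω) n v root) '' treePoints a n)

/-- The exponent `φ_(α)`. -/
def phi (α lam : ℝ) : ℝ :=
  (α + 1) / α * ∫ u in (0 : ℝ)..1, (Real.exp (lam * u) - 1) * ((1 - u) / u)

/-- `ν` is the law of `ξ_(α)`: its Laplace transform is `exp φ_(α)` on the whole of `ℝ`. -/
def IsXiLaw (α : ℝ) (ν : Measure ℝ) : Prop :=
  ∀ lam : ℝ, Integrable (fun x => Real.exp (lam * x)) ν ∧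
    ∫ x, Real.exp (lam * x) ∂ν = Real.exp (phi α lam)

end LineBreaking

end

namespace LineBreaking

/-! Write A_n for the total length of T_n. A uniform point of T_n lies on b_j with probability a_j /
A_n. Its height is then a uniform offset on b_j plus the height of the base of b_j. That base is a
uniform point of T_{j-1}, independent of the coordinates of the chosen point. Strong induction on n
gives E exp(θ D_n) = ∏_{i ≤ n} (1 + (a_i / A_i) g(θ a_i)) with g(x) = ∫₀¹ (e^{xu} - 1) du
(`integral_exp_pointHeight`). So D_n has the law of a sum of independent variables, the i-th being
uniform on [0, a_i] with probability a_i / A_i and 0 otherwise.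

At θ = λ / a_n all factors are uniformly close to 1, so the product behaves like the exponential of
the sum. Expanding that sum in powers of λ produces ∑ (a_i / A_i) (a_i / a_n)^k, which tends to (α +
1) / (α k) by Karamata's theorem (`tendsto_sum_weight_mul_pow`). The resulting series is that of φ
(`hasSum_phi`, `tendsto_heightMgf`). Pointwise convergence of Laplace transforms on ℝ gives
tightness, and every cluster point has Laplace transform exp φ. The limit law therefore exists, is
unique and attracts the laws of D_n / a_n (`exists_isXiLaw_tendsto`). Exponential moments also give
the uniform integrability behind the convergence of moments.

For the upper bound on H_n, the product formula is used in a Chernoff bound with λ of order ln ln n,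
followed by Borel–Cantelli for the heights of the gluing points. For the lower bound, the last δn
segments are cut into L + 1 blocks, with L about (1 - η) ln n / ln ln n. The proof looks for a chain
with one segment per block, each glued near the top of the preceding one. The number of chains
shrinks by a factor of order 1 / L per block, and L is chosen so that a power of n of them is left
at the end. The failure probability is at most n^{-2}, so Borel–Cantelli applies again.

The analytic input throughout is `IsRegularlyVarying.potterBounds`: pointwise regular variation of a
sequence, with no monotonicity assumed, already gives Potter's bounds. -/

/-- Regular variation with index `ρ` in the quantitative form of Potter's bounds. -/
def PotterBounds (c : ℕ → ℝ) (ρ : ℝ) : Prop :=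
  ∀ ε : ℝ, 0 < ε → ∃ N : ℕ, 1 ≤ N ∧ ∀ n m : ℕ, N ≤ n → n ≤ m →
    |Real.log (c m) - Real.log (c n) - ρ * Real.log (m / n)| ≤ ε * (1 + Real.log (m / n))

/-! ### Potter's bounds from pointwise regular variation. -/

/-- An Egorov argument: the sets of ratios in [1, 5] that violate the bound at some time after `N`
decrease to the empty set, so their measures tend to 0. The value 1/10 is small enough for the
counting in `exists_common_scale`. -/
lemma exists_small_exceptional_set {a : ℕ → ℝ} {α : ℝ} (ha : ∀ n : ℕ, 1 ≤ n → 0 < a n)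
    (hreg : IsRegularlyVarying a α) {ε : ℝ} (hε : 0 < ε) :
    ∃ N : ℕ, ∃ B : Set ℝ, volume B ≤ ENNReal.ofReal (1 / 10) ∧
      ∀ c ∈ Set.Icc (1 : ℝ) 5, c ∉ B → ∀ n : ℕ, N ≤ n →
        |Real.log (a ⌊c * n⌋₊) - Real.log (a n) - α * Real.log c| ≤ ε := by
  let f : ℕ → ℝ → ℝ := fun n c => |Real.log (a ⌊c * n⌋₊) - Real.log (a n) - α * Real.log c|
  let B : ℕ → Set ℝ := fun N => Set.Icc 1 5 ∩ ⋃ n : ℕ, ⋃ (_ : N ≤ n), {c | ε < f n c}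
  have hfm : ∀ n, Measurable (f n) := by
    intro n
    have h1 : Measurable (fun c : ℝ => Real.log (a ⌊c * n⌋₊)) :=
      (measurable_from_top (f := fun k : ℕ => Real.log (a k))).comp
        (Nat.measurable_floor.comp (measurable_id.mul_const _))
    exact ((h1.sub_const _).sub (Real.measurable_log.const_mul α)).abs
  have hBm : ∀ N, MeasurableSet (B N) := fun N =>
    measurableSet_Icc.inter (MeasurableSet.iUnion fun n => MeasurableSet.iUnion fun _ =>
      measurableSet_lt measurable_const (hfm n))
  have hanti : Antitone B := by
    intro N N' h c hc
    refine ⟨hc.1, ?_⟩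
    have := hc.2
    simp only [Set.mem_iUnion] at this ⊢
    obtain ⟨n, hn, h'⟩ := this
    exact ⟨n, h.trans hn, h'⟩
  have hempty : ⋂ N, B N = ∅ := by
    refine Set.eq_empty_of_forall_notMem fun c hc => ?_
    rw [Set.mem_iInter] at hc
    have hc15 := (hc 0).1
    have hc0 : 0 < c := by linarith [hc15.1]
    have ht : Tendsto (fun n : ℕ => f n c) atTop (𝓝 0) := by
      have h1 := (hreg c hc0).log (Real.rpow_pos_of_pos hc0 α).ne'
      rw [Real.log_rpow hc0] at h1
      have h2 := (h1.sub_const (α * Real.log c)).abs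
      rw [sub_self, abs_zero] at h2
      refine h2.congr' ?_
      filter_upwards [eventually_ge_atTop 1] with n hn
      have hn' : (1 : ℝ) ≤ n := by exact_mod_cast hn
      have h3 : 1 ≤ ⌊c * n⌋₊ := Nat.le_floor (by push_cast; nlinarith [hc15.1])
      rw [Real.log_div (ha _ h3).ne' (ha _ hn).ne']
    obtain ⟨N, hN⟩ := eventually_atTop.1 (ht.eventually (gt_mem_nhds hε))
    have := (hc N).2
    simp only [Set.mem_iUnion] at this
    obtain ⟨n, hn, h'⟩ := this
    exact absurd (hN n hn) (not_lt.2 (le_of_lt h'))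
  have htend := tendsto_measure_iInter_atTop (μ := volume)
    (fun N => (hBm N).nullMeasurableSet) hanti
    ⟨0, (measure_mono Set.inter_subset_left).trans_lt (by simp) |>.ne⟩
  rw [hempty, measure_empty] at htend
  obtain ⟨N, hN⟩ := (htend.eventually (gt_mem_nhds
    (show (0 : ENNReal) < ENNReal.ofReal (1 / 10) by simp))).exists
  refine ⟨N, B N, hN.le, fun c hc hcB n hn => ?_⟩
  by_contra hcon
  refine hcB ⟨hc, ?_⟩
  simp only [Set.mem_iUnion]
  exact ⟨n, hn, not_le.1 hcon⟩

/-- For `k ≤ n ≤ p` the intervals [p/k, (p+1)/k) are pairwise disjoint and each has length at least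
1/n, so a small set cannot contain many of them. -/
lemma card_div_le_volume {B : Set ℝ} {n p : ℕ} (hnp : n ≤ p) (K : Finset ℕ)
    (hK : ∀ k ∈ K, 1 ≤ k ∧ k ≤ n)
    (hB : ∀ k ∈ K, Set.Ico ((p : ℝ) / k) ((p + 1 : ℝ) / k) ⊆ B) :
    ENNReal.ofReal ((K.card : ℝ) / n) ≤ volume B := by
  have hlt : ∀ k ∈ K, ∀ l ∈ K, k < l → ((p + 1 : ℝ) / l) ≤ (p : ℝ) / k := by
    intro k hk l hl hkl
    have h1 : (1 : ℝ) ≤ k := by exact_mod_cast (hK k hk).1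
    have h2 : (k : ℝ) + 1 ≤ l := by exact_mod_cast hkl
    have h3 : (k : ℝ) ≤ p := by exact_mod_cast (hK k hk).2.trans hnp
    rw [div_le_div_iff₀ (by linarith) (by linarith)]
    nlinarith
  have hdisj : (K : Set ℕ).PairwiseDisjoint
      (fun k : ℕ => Set.Ico ((p : ℝ) / k) ((p + 1 : ℝ) / k)) := by
    intro k hk l hl hne
    rcases lt_or_gt_of_ne hne with h | h
    · refine Set.disjoint_left.2 fun x hx hx' => ?_
      linarith [hlt k hk l hl h, hx.1, hx'.2]
    · refine Set.disjoint_left.2 fun x hx hx' => ?_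
      linarith [hlt l hl k hk h, hx'.1, hx.2]
  calc ENNReal.ofReal ((K.card : ℝ) / n)
      ≤ ENNReal.ofReal (∑ k ∈ K, ((p + 1 : ℝ) / k - p / k)) := by
        apply ENNReal.ofReal_le_ofReal
        rw [div_eq_mul_inv, ← nsmul_eq_mul, ← Finset.sum_const]
        refine Finset.sum_le_sum fun k hk => ?_
        have h1 : (0 : ℝ) < k := by exact_mod_cast (hK k hk).1
        have h2 : (k : ℝ) ≤ n := by exact_mod_cast (hK k hk).2
        rw [← sub_div, add_sub_cancel_left, ← one_div]
        gcongr
    _ = ∑ k ∈ K, volume (Set.Ico ((p : ℝ) / k) ((p + 1 : ℝ) / k)) := by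
        rw [ENNReal.ofReal_sum_of_nonneg]
        · simp [Real.volume_Ico]
        · intro k _
          rw [← sub_div, add_sub_cancel_left]
          positivity
    _ = volume (⋃ k ∈ K, Set.Ico ((p : ℝ) / k) ((p + 1 : ℝ) / k)) :=
        (measure_biUnion_finset hdisj fun _ _ => measurableSet_Ico).symm
    _ ≤ volume B := measure_mono (Set.iUnion₂_subset hB)

/-- At least half of the integers up to `n` lie in (n/2, n]. At most a tenth of `n` of them are bad
for `n`, and as many for `m`, so some scale `k` is good for both. Through it `n` and `m` are both of
the form ⌊ck⌋ with an unexceptional ratio. -/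
lemma exists_common_scale {B : Set ℝ} (hB : volume B ≤ ENNReal.ofReal (1 / 10)) {n m : ℕ}
    (hn : 1 ≤ n) (hnm : n ≤ m) :
    ∃ k : ℕ, n < 2 * k ∧ k ≤ n ∧
      (∃ c ∈ Set.Ico ((n : ℝ) / k) ((n + 1 : ℝ) / k), c ∉ B) ∧
      (∃ c ∈ Set.Ico ((m : ℝ) / k) ((m + 1 : ℝ) / k), c ∉ B) := by
  classical
  by_contra! hcon
  let K := Finset.Ioc (n / 2) n
  let K₁ := K.filter fun k : ℕ => Set.Ico ((n : ℝ) / k) ((n + 1 : ℝ) / k) ⊆ B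
  let K₂ := K.filter fun k : ℕ => Set.Ico ((m : ℝ) / k) ((m + 1 : ℝ) / k) ⊆ B
  have hmem : ∀ k ∈ K, 1 ≤ k ∧ k ≤ n := fun k hk => by
    have := Finset.mem_Ioc.1 hk; omega
  have hcover : K ⊆ K₁ ∪ K₂ := by
    intro k hk
    have hk' := Finset.mem_Ioc.1 hk
    by_cases h : Set.Ico ((n : ℝ) / k) ((n + 1 : ℝ) / k) ⊆ B
    · exact Finset.mem_union_left _ (Finset.mem_filter.2 ⟨hk, h⟩)
    · obtain ⟨c, hc, hcB⟩ := Set.not_subset.1 h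
      exact Finset.mem_union_right _ (Finset.mem_filter.2
        ⟨hk, hcon k (by omega) hk'.2 ⟨c, hc, hcB⟩⟩)
  have hn' : (1 : ℝ) ≤ n := by exact_mod_cast hn
  have hbound : ∀ K' : Finset ℕ, ENNReal.ofReal ((K'.card : ℝ) / n) ≤ volume B →
      (10 : ℝ) * K'.card ≤ n := by
    intro K' h
    have h1 := (ENNReal.ofReal_le_ofReal_iff (by norm_num)).1 (h.trans hB)
    rw [div_le_div_iff₀ (by linarith) (by norm_num)] at h1
    linarith
  have h1 := hbound K₁ (card_div_le_volume le_rfl K₁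
    (fun k hk => hmem k (Finset.mem_filter.1 hk).1) fun k hk => (Finset.mem_filter.1 hk).2)
  have h2 := hbound K₂ (card_div_le_volume hnm K₂
    (fun k hk => hmem k (Finset.mem_filter.1 hk).1) fun k hk => (Finset.mem_filter.1 hk).2)
  have h3 := (Finset.card_le_card hcover).trans (Finset.card_union_le _ _)
  have h4 : K.card = n - n / 2 := Nat.card_Ioc _ _
  have h1' : 10 * K₁.card ≤ n := by exact_mod_cast h1
  have h2' : 10 * K₂.card ≤ n := by exact_mod_cast h2
  omega

lemma floor_mul_eq_and_log_le {k p : ℕ} (hk : 1 ≤ k) (hp : 1 ≤ p) {c : ℝ}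
    (hc : c ∈ Set.Ico ((p : ℝ) / k) ((p + 1 : ℝ) / k)) :
    ⌊c * k⌋₊ = p ∧ |Real.log c - Real.log (p / k)| ≤ 1 / p := by
  have hk' : (0 : ℝ) < k := by exact_mod_cast hk
  have hp' : (0 : ℝ) < p := by exact_mod_cast hp
  have h1 := (div_le_iff₀ hk').1 hc.1
  have h2 := (lt_div_iff₀ hk').1 hc.2
  have hc0 : 0 < c := (div_pos hp' hk').trans_le hc.1
  refine ⟨(Nat.floor_eq_iff (by positivity)).2 ⟨h1, h2⟩, ?_⟩
  rw [← Real.log_div hc0.ne' (by positivity), abs_of_nonneg (Real.log_nonneg (by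
    rw [le_div_iff₀ (by positivity)]; linarith [hc.1]))]
  refine (Real.log_le_sub_one_of_pos (by positivity)).trans ?_
  rw [sub_le_iff_le_add, div_le_iff₀ (by positivity)]
  have : (1 / (p : ℝ) + 1) * (p / k) = (p + 1) / k := by field_simp; ring
  rw [this]
  exact hc.2.le

lemma dyadic_bound {a : ℕ → ℝ} {α : ℝ} (ha : ∀ n : ℕ, 1 ≤ n → 0 < a n)
    (hreg : IsRegularlyVarying a α) {ε : ℝ} (hε : 0 < ε) :
    ∃ N : ℕ, 1 ≤ N ∧ ∀ n m : ℕ, N ≤ n → n ≤ m → m ≤ 2 * n →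
      |Real.log (a m) - Real.log (a n) - α * Real.log (m / n)| ≤ ε := by
  obtain ⟨N₀, B, hB, hun⟩ := exists_small_exceptional_set ha hreg (show 0 < ε / 4 by linarith)
  obtain ⟨N₁, hN₁⟩ := exists_nat_gt (4 * |α| / ε)
  -- Since `k > n / 2 ≥ N₀`, the uniform bound applies at scale `k`. `N₁` keeps the cost of
  -- replacing `c` by `p / k`, at most |α| / p, below ε/4. The four errors of size ε/4 add up to ε.
  refine ⟨2 * N₀ + N₁ + 2, by omega, fun n m hn hnm hm => ?_⟩
  obtain ⟨k, hk1, hk2, ⟨c, hc, hcB⟩, ⟨c', hc', hcB'⟩⟩ :=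
    exists_common_scale hB (show 1 ≤ n by omega) hnm
  have hk : (0 : ℝ) < k := by exact_mod_cast (show 0 < k by omega)
  have hn0 : (0 : ℝ) < n := by exact_mod_cast (show 0 < n by omega)
  have hm0 : (0 : ℝ) < m := by exact_mod_cast (show 0 < m by omega)
  have hrange : ∀ (p : ℕ) (x : ℝ), k ≤ p → p + 1 ≤ 5 * k →
      x ∈ Set.Ico ((p : ℝ) / k) ((p + 1 : ℝ) / k) → x ∈ Set.Icc (1 : ℝ) 5 := by
    intro p x hkp hp5 hx
    have h1 : (k : ℝ) ≤ p := by exact_mod_cast hkp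
    have h2 : (p : ℝ) + 1 ≤ 5 * k := by exact_mod_cast hp5
    exact ⟨((one_le_div hk).2 h1).trans hx.1, hx.2.le.trans ((div_le_iff₀ hk).2 h2)⟩
  obtain ⟨hf, hl⟩ := floor_mul_eq_and_log_le (by omega) (by omega) hc
  obtain ⟨hf', hl'⟩ := floor_mul_eq_and_log_le (by omega) (by omega) hc'
  have e1 := hun c (hrange n c (by omega) (by omega) hc) hcB k (by omega)
  have e2 := hun c' (hrange m c' (by omega) (by omega) hc') hcB' k (by omega)
  rw [hf] at e1
  rw [hf'] at e2
  have hsmall : ∀ p : ℕ, n ≤ p → |α| * (1 / (p : ℝ)) ≤ ε / 4 := by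
    intro p hp
    have h1 : (N₁ : ℝ) ≤ p := by exact_mod_cast (show N₁ ≤ p by omega)
    have h2 : (0 : ℝ) < p := by exact_mod_cast (show 0 < p by omega)
    rw [mul_one_div, div_le_iff₀ h2]
    have := (div_lt_iff₀ hε).1 (hN₁.trans_le h1)
    linarith
  have g1 : |α * (Real.log c - Real.log (n / k))| ≤ ε / 4 := by
    rw [abs_mul]
    exact (mul_le_mul_of_nonneg_left hl (abs_nonneg α)).trans (hsmall n le_rfl)
  have g2 : |α * (Real.log c' - Real.log (m / k))| ≤ ε / 4 := by
    rw [abs_mul]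
    exact (mul_le_mul_of_nonneg_left hl' (abs_nonneg α)).trans (hsmall m hnm)
  have hlog : Real.log ((m : ℝ) / n) = Real.log (m / k) - Real.log (n / k) := by
    rw [← Real.log_div (by positivity) (by positivity)]
    congr 1
    field_simp
  rw [hlog]
  rw [abs_le] at *
  constructor <;> linarith [e1.1, e1.2, e2.1, e2.2, g1.1, g1.2, g2.1, g2.2]

/-- Induction by halving `m`: with p = ⌈m/2⌉ the dyadic step costs ε/4, and log (m/p) ≥ 1/4 pays for
it in the allowance ε (1 + log (m/n)). -/
theorem IsRegularlyVarying.potterBounds {a : ℕ → ℝ} {α : ℝ} (ha : ∀ n : ℕ, 1 ≤ n → 0 < a n)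
    (hreg : IsRegularlyVarying a α) : PotterBounds a α := by
  intro ε hε
  obtain ⟨N, hN1, hN⟩ := dyadic_bound ha hreg (show 0 < ε / 4 by linarith)
  refine ⟨N, hN1, fun n m hn => ?_⟩
  have hn0 : (0 : ℝ) < n := by exact_mod_cast (show 0 < n by omega)
  induction m using Nat.strong_induction_on with
  | _ m ih =>
    intro hnm
    have hlog0 : 0 ≤ Real.log ((m : ℝ) / n) :=
      Real.log_nonneg ((one_le_div hn0).2 (by exact_mod_cast hnm))
    rcases le_or_gt m (2 * n) with h | h
    · exact (hN n m hn hnm h).trans (by nlinarith)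
    · obtain ⟨p, hp⟩ : ∃ p, p = (m + 1) / 2 := ⟨_, rfl⟩
      have h1 := ih p (by omega) (by omega)
      have h2 := hN p m (by omega) (by omega) (by omega)
      have hp0 : (0 : ℝ) < p := by exact_mod_cast (show 0 < p by omega)
      have hm0 : (0 : ℝ) < m := by exact_mod_cast (show 0 < m by omega)
      have hlog : Real.log ((m : ℝ) / n) = Real.log (m / p) + Real.log (p / n) := by
        rw [← Real.log_mul (by positivity) (by positivity)]
        congr 1
        field_simp
      have h4 : 1 / 4 ≤ Real.log ((m : ℝ) / p) := by
        have h5 := Real.one_sub_inv_le_log_of_pos (show 0 < (m : ℝ) / p by positivity)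
        have h6 : ((m : ℝ) / p)⁻¹ ≤ 3 / 4 := by
          rw [inv_div, div_le_div_iff₀ hm0 (by norm_num)]
          exact_mod_cast (show p * 4 ≤ 3 * m by omega)
        linarith
      have h7 : |Real.log (a m) - Real.log (a n) - α * Real.log (m / n)| ≤
          ε / 4 + ε * (1 + Real.log (p / n)) := by
        rw [hlog]
        rw [abs_le] at *
        constructor <;> linarith [h1.1, h1.2, h2.1, h2.2]
      refine h7.trans ?_
      rw [hlog]
      nlinarith

/-! ### Karamata's theorem and its consequences for the weights. -/

/-- Stolz–Cesàro comparison with the telescoping increments of i^(s+1), which also covers negative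
exponents. -/
lemma tendsto_sum_rpow_div {s : ℝ} (hs : -1 < s) :
    Tendsto (fun n : ℕ => (∑ i ∈ Finset.Icc 1 n, (i : ℝ) ^ s) / (n : ℝ) ^ (s + 1)) atTop
      (𝓝 (1 / (s + 1))) := by
  have hs1 : 0 < s + 1 := by linarith
  let g : ℕ → ℝ := fun i => ((i : ℝ) + 1) ^ (s + 1) - (i : ℝ) ^ (s + 1)
  let f : ℕ → ℝ := fun i => ((i : ℝ) + 1) ^ s
  have hgsum : ∀ n : ℕ, ∑ i ∈ Finset.range n, g i = (n : ℝ) ^ (s + 1) := by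
    intro n
    have := Finset.sum_range_sub (fun i : ℕ => (i : ℝ) ^ (s + 1)) n
    simpa [g, Real.zero_rpow hs1.ne'] using this
  have hgpos : ∀ i, 0 < g i := fun i =>
    sub_pos.2 (Real.rpow_lt_rpow (by positivity) (by linarith) hs1)
  have hratio : Tendsto (fun i : ℕ => g i / f i) atTop (𝓝 (s + 1)) := by
    -- The ratio `g i / f i` is minus the slope of this function between 0 and 1/(i+1).
    have hd : HasDerivAt (fun x : ℝ => (1 - x) ^ (s + 1)) (-(s + 1)) 0 := by
      have h1 : HasDerivAt (fun x : ℝ => 1 - x) (-1) 0 := by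
        simpa using (hasDerivAt_id (0 : ℝ)).const_sub 1
      simpa using h1.rpow_const (p := s + 1) (Or.inl (by norm_num))
    have hx : Tendsto (fun i : ℕ => 1 / ((i : ℝ) + 1)) atTop (𝓝[≠] 0) :=
      tendsto_nhdsWithin_iff.2 ⟨tendsto_one_div_add_atTop_nhds_zero_nat,
        Eventually.of_forall fun i => (Nat.one_div_pos_of_nat (α := ℝ)).ne'⟩
    have h2 := (hd.tendsto_slope.comp hx).neg
    rw [neg_neg] at h2
    refine h2.congr fun i => ?_
    have hi : (0 : ℝ) < i + 1 := by positivity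
    have h3 : (1 - 1 / ((i : ℝ) + 1)) = i / (i + 1) := by field_simp; ring
    simp only [Function.comp_apply, slope_def_field, g, f, h3, sub_zero, Real.one_rpow]
    rw [Real.div_rpow (by positivity) hi.le, Real.rpow_add hi s 1, Real.rpow_one]
    have : ((i : ℝ) + 1) ^ s ≠ 0 := (Real.rpow_pos_of_pos hi s).ne'
    field_simp
    ring
  have hlit : (fun i => f i - g i / (s + 1)) =o[atTop] g := by
    refine (Asymptotics.isLittleO_iff_tendsto fun i h => absurd h (hgpos i).ne').2 ?_
    have h1 := (hratio.inv₀ hs1.ne').sub_const (1 / (s + 1))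
    rw [one_div, sub_self] at h1
    refine h1.congr fun i => ?_
    have := (hgpos i).ne'
    rw [inv_div, sub_div]
    congr 1
    field_simp
  have htop : Tendsto (fun n => ∑ i ∈ Finset.range n, g i) atTop atTop := by
    simp_rw [hgsum]
    exact (tendsto_rpow_atTop hs1).comp tendsto_natCast_atTop_atTop
  have h1 := (hlit.sum_range (fun i => (hgpos i).le) htop).tendsto_div_nhds_zero
  have h2 := h1.add_const (1 / (s + 1))
  rw [zero_add] at h2
  refine h2.congr' ?_
  filter_upwards [eventually_ge_atTop 1] with n hn
  have hn0 : (0 : ℝ) < n := by exact_mod_cast hn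
  have h4 : ∑ i ∈ Finset.Icc 1 n, (i : ℝ) ^ s = ∑ i ∈ Finset.range n, f i := by
    rw [Finset.range_eq_Ico, Finset.sum_Ico_eq_sum_range, ← Finset.Ico_succ_right_eq_Icc,
      Finset.sum_Ico_eq_sum_range]
    refine Finset.sum_congr (by simp) fun i _ => ?_
    simp [f, add_comm]
  rw [h4, hgsum, Finset.sum_sub_distrib, ← Finset.sum_div, hgsum, sub_div]
  have : (n : ℝ) ^ (s + 1) ≠ 0 := (Real.rpow_pos_of_pos hn0 _).ne'
  field_simp
  ring

lemma rpow_bounds_of_log_bound {x y r ρ ε : ℝ} (hx : 0 < x) (hy : 0 < y) (hr : 0 < r)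
    (h : |Real.log y - Real.log x - ρ * Real.log r⁻¹| ≤ ε * (1 + Real.log r⁻¹)) :
    x ≤ Real.exp ε * y * r ^ (ρ - ε) ∧ Real.exp (-ε) * y * r ^ (ρ + ε) ≤ x := by
  rw [Real.log_inv, abs_le] at h
  have key : ∀ σ e : ℝ, Real.exp e * y * r ^ σ = Real.exp (e + Real.log y + Real.log r * σ) := by
    intro σ e
    rw [Real.exp_add, Real.exp_add, Real.exp_log hy, Real.rpow_def_of_pos hr]
  constructor
  · rw [key, ← Real.log_le_iff_le_exp hx]
    linarith [h.1]
  · rw [key, ← Real.le_log_iff_exp_le hx]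
    linarith [h.2]

lemma PotterBounds.rpow_bounds {c : ℕ → ℝ} {ρ : ℝ} (hc : ∀ n : ℕ, 1 ≤ n → 0 < c n)
    (h : PotterBounds c ρ) {ε : ℝ} (hε : 0 < ε) :
    ∃ N : ℕ, 1 ≤ N ∧ ∀ i n : ℕ, N ≤ i → i ≤ n →
      c i ≤ Real.exp ε * c n * ((i : ℝ) / n) ^ (ρ - ε) ∧
      Real.exp (-ε) * c n * ((i : ℝ) / n) ^ (ρ + ε) ≤ c i := by
  obtain ⟨N, hN1, hN⟩ := h ε hε
  refine ⟨N, hN1, fun i n hi hin => ?_⟩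
  have hi0 : (0 : ℝ) < i := by exact_mod_cast (show 0 < i by omega)
  have hn0 : (0 : ℝ) < n := by exact_mod_cast (show 0 < n by omega)
  refine rpow_bounds_of_log_bound (hc i (by omega)) (hc n (by omega)) (by positivity) ?_
  rw [inv_div]
  exact hN i n hi hin

/-- Potter's bounds lose an exponent ε equal to half of the margin ρ + s, so growth of order n^ε
remains. -/
lemma PotterBounds.tendsto_rpow_mul_atTop {c : ℕ → ℝ} {ρ s : ℝ} (hc : ∀ n : ℕ, 1 ≤ n → 0 < c n)
    (h : PotterBounds c ρ) (hs : 0 < ρ + s) :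
    Tendsto (fun n : ℕ => (n : ℝ) ^ s * c n) atTop atTop := by
  obtain ⟨N, hN1, hN⟩ := h.rpow_bounds hc (show 0 < (ρ + s) / 2 by linarith)
  set ε := (ρ + s) / 2 with hεdef
  have hcN := hc N hN1
  have hN0 : (0 : ℝ) < N := by exact_mod_cast hN1
  have hK : 0 < Real.exp (-ε) * c N * (1 / (N : ℝ)) ^ (ρ - ε) := by positivity
  have h1 : Tendsto (fun n : ℕ => Real.exp (-ε) * c N * (1 / (N : ℝ)) ^ (ρ - ε) * (n : ℝ) ^ ε)
      atTop atTop :=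
    ((tendsto_rpow_atTop (by linarith)).comp tendsto_natCast_atTop_atTop).const_mul_atTop hK
  refine tendsto_atTop_mono' _ ?_ h1
  filter_upwards [eventually_ge_atTop N] with n hn
  have hn0 : (0 : ℝ) < n := by exact_mod_cast (show 0 < n by omega)
  have h2 := (hN N n le_rfl hn).1
  have e1 : (n : ℝ) ^ ε = (n : ℝ) ^ s * (n : ℝ) ^ (ρ - ε) := by
    rw [← Real.rpow_add hn0]; congr 1; rw [hεdef]; ring
  have hpos : 0 < (n : ℝ) ^ s := Real.rpow_pos_of_pos hn0 s
  calc Real.exp (-ε) * c N * (1 / (N : ℝ)) ^ (ρ - ε) * (n : ℝ) ^ ε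
      ≤ Real.exp (-ε) * (Real.exp ε * c n * ((N : ℝ) / n) ^ (ρ - ε)) * (1 / (N : ℝ)) ^ (ρ - ε)
          * (n : ℝ) ^ ε := by gcongr
    _ = (n : ℝ) ^ s * c n := by
        rw [e1, Real.div_rpow hN0.le hn0.le, Real.div_rpow zero_le_one hN0.le, Real.one_rpow,
          Real.exp_neg]
        have := (Real.rpow_pos_of_pos hN0 (ρ - ε)).ne'
        have := (Real.rpow_pos_of_pos hn0 (ρ - ε)).ne'
        have := (Real.exp_pos ε).ne'
        field_simp

/-- Karamata's theorem for sums. -/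
theorem PotterBounds.tendsto_sum_div {c : ℕ → ℝ} {ρ : ℝ} (hc : ∀ n : ℕ, 1 ≤ n → 0 < c n)
    (h : PotterBounds c ρ) (hρ : -1 < ρ) :
    Tendsto (fun n : ℕ => (∑ i ∈ Finset.Icc 1 n, c i) / (n * c n)) atTop (𝓝 (1 / (ρ + 1))) := by
  -- In the upper bound, the terms below Potter's threshold form a fixed sum that is negligible
  -- against `n * c n`.
  have hnc : Tendsto (fun n : ℕ => (n : ℝ) * c n) atTop atTop := by
    simpa using h.tendsto_rpow_mul_atTop (s := 1) hc (by linarith)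
  have hmean : ∀ s : ℝ, ∀ n : ℕ, 1 ≤ n → ∀ t : Finset ℕ,
      (∑ i ∈ t, (i : ℝ) ^ s) / (n : ℝ) ^ (s + 1) = (∑ i ∈ t, ((i : ℝ) / n) ^ s) / n := by
    intro s n hn t
    have hn0 : (0 : ℝ) < n := by exact_mod_cast hn
    rw [Real.rpow_add hn0, Real.rpow_one, ← div_div, Finset.sum_div]
    congr 1
    exact Finset.sum_congr rfl fun i _ => (Real.div_rpow (by positivity) hn0.le s).symm
  have split : ∀ (N n : ℕ), 1 ≤ N → N ≤ n → ∀ f : ℕ → ℝ, ∑ i ∈ Finset.Icc 1 n, f i =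
      ∑ i ∈ Finset.Ico 1 N, f i + ∑ i ∈ Finset.Icc N n, f i := by
    intro N n hN hn f
    rw [← Finset.Ico_succ_right_eq_Icc, ← Finset.Ico_succ_right_eq_Icc,
      Finset.sum_Ico_consecutive f hN (by simp; omega)]
  have hdiv : ∀ R s : ℝ, 0 < s → Tendsto (fun n : ℕ => R / (n : ℝ) ^ s) atTop (𝓝 0) :=
    fun R s hs => ((tendsto_rpow_atTop hs).comp tendsto_natCast_atTop_atTop).const_div_atTop R
  rw [tendsto_order]
  constructor
  · intro b hb
    have hcont : Tendsto (fun ε : ℝ => Real.exp (-ε) * (1 / (ρ + ε + 1))) (𝓝[>] 0)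
        (𝓝 (1 / (ρ + 1))) := by
      have : ContinuousAt (fun ε : ℝ => Real.exp (-ε) * (1 / (ρ + ε + 1))) 0 := by
        refine ContinuousAt.mul (by fun_prop) (ContinuousAt.div (by fun_prop) (by fun_prop) ?_)
        linarith
      simpa using this.tendsto.mono_left nhdsWithin_le_nhds
    obtain ⟨ε, hεb, hε⟩ := ((hcont.eventually (lt_mem_nhds hb)).and self_mem_nhdsWithin).exists
    have hε : 0 < ε := hε
    obtain ⟨N, hN1, hN⟩ := h.rpow_bounds hc hε
    have h1 := ((tendsto_sum_rpow_div (s := ρ + ε) (by linarith)).sub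
      (hdiv (∑ i ∈ Finset.Ico 1 N, (i : ℝ) ^ (ρ + ε)) (ρ + ε + 1) (by linarith))).const_mul
      (Real.exp (-ε))
    rw [sub_zero] at h1
    filter_upwards [h1.eventually (lt_mem_nhds hεb), eventually_ge_atTop N] with n hbn hn
    refine hbn.trans_le ?_
    have hn1 : 1 ≤ n := hN1.trans hn
    have hn0 : (0 : ℝ) < n := by exact_mod_cast hn1
    have hcn := hc n hn1
    rw [← sub_div, split N n hN1 hn, add_sub_cancel_left, hmean _ n hn1, le_div_iff₀ (by positivity)]
    calc Real.exp (-ε) * ((∑ i ∈ Finset.Icc N n, ((i : ℝ) / n) ^ (ρ + ε)) / n) * (n * c n)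
        = ∑ i ∈ Finset.Icc N n, Real.exp (-ε) * c n * ((i : ℝ) / n) ^ (ρ + ε) := by
          rw [← Finset.mul_sum]; field_simp
      _ ≤ ∑ i ∈ Finset.Icc N n, c i := Finset.sum_le_sum fun i hi =>
          (hN i n (Finset.mem_Icc.1 hi).1 (Finset.mem_Icc.1 hi).2).2
      _ ≤ ∑ i ∈ Finset.Icc 1 n, c i := Finset.sum_le_sum_of_subset_of_nonneg
          (Finset.Icc_subset_Icc_left hN1) fun i hi _ => (hc i (Finset.mem_Icc.1 hi).1).le
  · intro b hb
    have hcont : Tendsto (fun ε : ℝ => Real.exp ε * (1 / (ρ - ε + 1))) (𝓝[>] 0)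
        (𝓝 (1 / (ρ + 1))) := by
      have : ContinuousAt (fun ε : ℝ => Real.exp ε * (1 / (ρ - ε + 1))) 0 := by
        refine ContinuousAt.mul (by fun_prop) (ContinuousAt.div (by fun_prop) (by fun_prop) ?_)
        linarith
      simpa using this.tendsto.mono_left nhdsWithin_le_nhds
    obtain ⟨ε, ⟨hεb, hερ⟩, hε⟩ := (((hcont.eventually (gt_mem_nhds hb)).and
      ((gt_mem_nhds (show (0 : ℝ) < ρ + 1 by linarith)).filter_mono nhdsWithin_le_nhds)).and
      self_mem_nhdsWithin).exists
    have hε : 0 < ε := hε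
    obtain ⟨N, hN1, hN⟩ := h.rpow_bounds hc hε
    have h1 := (hnc.const_div_atTop (∑ i ∈ Finset.Ico 1 N, c i)).add
      ((tendsto_sum_rpow_div (s := ρ - ε) (by linarith)).const_mul (Real.exp ε))
    rw [zero_add] at h1
    filter_upwards [h1.eventually (gt_mem_nhds hεb), eventually_ge_atTop N] with n hbn hn
    refine lt_of_le_of_lt ?_ hbn
    have hn1 : 1 ≤ n := hN1.trans hn
    have hn0 : (0 : ℝ) < n := by exact_mod_cast hn1
    have hcn := hc n hn1
    rw [split N n hN1 hn, add_div]
    gcongr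
    rw [hmean _ n hn1, div_le_iff₀ (by positivity)]
    calc ∑ i ∈ Finset.Icc N n, c i
        ≤ ∑ i ∈ Finset.Icc N n, Real.exp ε * c n * ((i : ℝ) / n) ^ (ρ - ε) :=
          Finset.sum_le_sum fun i hi =>
            (hN i n (Finset.mem_Icc.1 hi).1 (Finset.mem_Icc.1 hi).2).1
      _ ≤ ∑ i ∈ Finset.Icc 1 n, Real.exp ε * c n * ((i : ℝ) / n) ^ (ρ - ε) :=
          Finset.sum_le_sum_of_subset_of_nonneg (Finset.Icc_subset_Icc_left hN1)
            fun i _ _ => by positivity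
      _ = Real.exp ε * ((∑ i ∈ Finset.Icc 1 n, ((i : ℝ) / n) ^ (ρ - ε)) / n) * (n * c n) := by
          rw [← Finset.mul_sum]; field_simp

/-- The total length of `T n`. -/
def totalLength (a : ℕ → ℝ) (n : ℕ) : ℝ := ∑ i ∈ Finset.Icc 1 n, a i

lemma totalLength_succ (a : ℕ → ℝ) (n : ℕ) :
    totalLength a (n + 1) = totalLength a n + a (n + 1) :=
  Finset.sum_Icc_succ_top (by omega) _

lemma le_totalLength {a : ℕ → ℝ} (ha : ∀ n : ℕ, 1 ≤ n → 0 < a n) {i n : ℕ} (hi : 1 ≤ i)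
    (hin : i ≤ n) : a i ≤ totalLength a n :=
  Finset.single_le_sum (fun j hj => (ha j (Finset.mem_Icc.1 hj).1).le) (Finset.mem_Icc.2 ⟨hi, hin⟩)

lemma totalLength_pos {a : ℕ → ℝ} (ha : ∀ n : ℕ, 1 ≤ n → 0 < a n) {n : ℕ} (hn : 1 ≤ n) :
    0 < totalLength a n :=
  (ha n hn).trans_le (le_totalLength ha hn le_rfl)

lemma totalLength_mono {a : ℕ → ℝ} (ha : ∀ n : ℕ, 1 ≤ n → 0 < a n) : Monotone (totalLength a) :=
  fun _ _ h => Finset.sum_le_sum_of_subset_of_nonneg (Finset.Icc_subset_Icc_right h)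
    fun i hi _ => (ha i (Finset.mem_Icc.1 hi).1).le

/-- By Karamata, A_n / (n a_n) converges to a positive limit, so log A_n differs from log n + log
a_n by a convergent sequence. The factor n raises the index by one. -/
lemma PotterBounds.totalLength {a : ℕ → ℝ} {α : ℝ} (ha : ∀ n : ℕ, 1 ≤ n → 0 < a n) (hα : 0 < α)
    (h : PotterBounds a α) : PotterBounds (totalLength a) (α + 1) := by
  intro ε hε
  have hr := (h.tendsto_sum_div ha (by linarith)).log (by positivity)
  obtain ⟨N₁, hN₁⟩ := Metric.tendsto_atTop.1 hr (ε / 4) (by linarith)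
  obtain ⟨N₂, hN₂, hb⟩ := h (ε / 2) (by linarith)
  refine ⟨max N₁ N₂, le_max_of_le_right hN₂, fun n m hn hnm => ?_⟩
  have hn1 : 1 ≤ n := hN₂.trans ((le_max_right _ _).trans hn)
  have hn0 : (0 : ℝ) < n := by exact_mod_cast hn1
  have hm0 : (0 : ℝ) < m := by exact_mod_cast hn1.trans hnm
  have key : ∀ p : ℕ, 1 ≤ p → Real.log (LineBreaking.totalLength a p) =
      Real.log ((∑ i ∈ Finset.Icc 1 p, a i) / (p * a p)) + Real.log p + Real.log (a p) := by
    intro p hp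
    have hp0 : (0 : ℝ) < p := by exact_mod_cast hp
    have := ha p hp
    have hA := totalLength_pos ha hp
    change Real.log _ = Real.log (LineBreaking.totalLength a p / _) + _ + _
    rw [Real.log_div hA.ne' (by positivity), Real.log_mul (by positivity) (by positivity)]
    ring
  have e1 := hN₁ n ((le_max_left _ _).trans hn)
  have e2 := hN₁ m ((le_max_left _ _).trans (hn.trans hnm))
  have e3 := hb n m ((le_max_right _ _).trans hn) hnm
  have hlog : 0 ≤ Real.log ((m : ℝ) / n) :=
    Real.log_nonneg ((one_le_div hn0).2 (by exact_mod_cast hnm))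
  rw [key n hn1, key m (hn1.trans hnm)]
  rw [Real.dist_eq] at e1 e2
  have hl := Real.log_div hm0.ne' hn0.ne'
  have h0 : 0 ≤ ε * Real.log ((m : ℝ) / n) := by positivity
  rw [abs_lt] at e1 e2
  rw [abs_le] at e3 ⊢
  constructor <;> nlinarith [e1.1, e1.2, e2.1, e2.2, e3.1, e3.2]

lemma PotterBounds.pow_div {a b : ℕ → ℝ} {α β : ℝ} (ha : ∀ n : ℕ, 1 ≤ n → 0 < a n)
    (hb : ∀ n : ℕ, 1 ≤ n → 0 < b n) (h : PotterBounds a α) (h' : PotterBounds b β) (j : ℕ) :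
    PotterBounds (fun n => a n ^ j / b n) (j * α - β) := by
  intro ε hε
  have hj : (0 : ℝ) < j + 1 := by positivity
  obtain ⟨N₁, hN₁, h1⟩ := h (ε / (2 * (j + 1))) (by positivity)
  obtain ⟨N₂, hN₂, h2⟩ := h' (ε / 2) (by positivity)
  refine ⟨max N₁ N₂, le_max_of_le_right hN₂, fun n m hn hnm => ?_⟩
  have hn1 : 1 ≤ n := hN₂.trans ((le_max_right _ _).trans hn)
  have hn0 : (0 : ℝ) < n := by exact_mod_cast hn1
  have key : ∀ p : ℕ, 1 ≤ p → Real.log (a p ^ j / b p) = j * Real.log (a p) - Real.log (b p) := by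
    intro p hp
    rw [Real.log_div (pow_pos (ha p hp) j).ne' (hb p hp).ne', Real.log_pow]
  have hlog : 0 ≤ Real.log ((m : ℝ) / n) :=
    Real.log_nonneg ((one_le_div hn0).2 (by exact_mod_cast hnm))
  have e1 := h1 n m ((le_max_left _ _).trans hn) hnm
  have e2 := h2 n m ((le_max_right _ _).trans hn) hnm
  have e3 : |(j : ℝ) * (Real.log (a m) - Real.log (a n) - α * Real.log (m / n))| ≤
      ε / 2 * (1 + Real.log (m / n)) := by
    rw [abs_mul, abs_of_nonneg (by positivity : (0 : ℝ) ≤ j)]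
    calc (j : ℝ) * |Real.log (a m) - Real.log (a n) - α * Real.log (m / n)|
        ≤ (j + 1) * (ε / (2 * (j + 1)) * (1 + Real.log (m / n))) := by gcongr; linarith
      _ = ε / 2 * (1 + Real.log (m / n)) := by field_simp
  simp only [key n hn1, key m (hn1.trans hnm)]
  rw [abs_le] at *
  constructor <;> nlinarith [e2.1, e2.2, e3.1, e3.2]

/-- The sequence a_i^(k+1) / A_i has index kα - 1 > -1, so its sums are equivalent to n a_n^(k+1) /
(kα A_n). Karamata for `a` itself turns n a_n / A_n into α + 1. -/
theorem tendsto_sum_weight_mul_pow {a : ℕ → ℝ} {α : ℝ} (ha : ∀ n : ℕ, 1 ≤ n → 0 < a n)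
    (hα : 0 < α) (h : PotterBounds a α) {k : ℕ} (hk : 1 ≤ k) :
    Tendsto (fun n : ℕ => ∑ i ∈ Finset.Icc 1 n, a i / totalLength a i * (a i / a n) ^ k) atTop
      (𝓝 ((α + 1) / (α * k))) := by
  have hk0 : (0 : ℝ) < k := by exact_mod_cast hk
  have hA : ∀ n : ℕ, 1 ≤ n → 0 < totalLength a n := fun n hn => totalLength_pos ha hn
  have hc : ∀ n : ℕ, 1 ≤ n → 0 < a n ^ (k + 1) / totalLength a n := fun n hn =>
    div_pos (pow_pos (ha n hn) _) (hA n hn)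
  have h1 := (h.pow_div ha hA (h.totalLength ha hα) (k + 1)).tendsto_sum_div hc (by
    push_cast; nlinarith)
  have h2 := (h.tendsto_sum_div ha (by linarith)).inv₀ (by positivity)
  have h3 := h1.mul h2
  have e : 1 / (((k + 1 : ℕ) : ℝ) * α - (α + 1) + 1) * (1 / (α + 1))⁻¹ = (α + 1) / (α * k) := by
    push_cast
    have : ((k : ℝ) + 1) * α - (α + 1) + 1 = α * k := by ring
    rw [this, one_div, one_div, inv_inv]
    field_simp
  rw [e] at h3
  refine h3.congr' ?_
  filter_upwards [eventually_ge_atTop 1] with n hn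
  have hn0 : (0 : ℝ) < n := by exact_mod_cast hn
  have han := ha n hn
  have hAn := hA n hn
  change _ * ((totalLength a n) / _)⁻¹ = _
  have e2 : ∑ i ∈ Finset.Icc 1 n, a i / totalLength a i * (a i / a n) ^ k =
      (∑ i ∈ Finset.Icc 1 n, a i ^ (k + 1) / totalLength a i) / a n ^ k := by
    rw [Finset.sum_div]
    refine Finset.sum_congr rfl fun i _ => ?_
    rw [div_pow, pow_succ]
    ring
  rw [e2]
  field_simp
  ring

lemma PotterBounds.tendsto_atTop {a : ℕ → ℝ} {α : ℝ} (ha : ∀ n : ℕ, 1 ≤ n → 0 < a n) (hα : 0 < α)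
    (h : PotterBounds a α) : Tendsto a atTop atTop := by
  simpa using h.tendsto_rpow_mul_atTop (s := 0) ha (by linarith)

lemma PotterBounds.eventually_le_mul {a : ℕ → ℝ} {α : ℝ} (ha : ∀ n : ℕ, 1 ≤ n → 0 < a n)
    (hα : 0 < α) (h : PotterBounds a α) {M : ℝ} (hM : 1 < M) :
    ∀ᶠ n : ℕ in atTop, ∀ i : ℕ, 1 ≤ i → i ≤ n → a i ≤ M * a n := by
  have hlM := Real.log_pos hM
  -- The minimum makes the exponent α - ε nonnegative and e^ε at most `M`. Indices below `N` are
  -- covered by `a n → ∞`.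
  obtain ⟨N, hN1, hN⟩ := h.rpow_bounds ha (show 0 < min α (Real.log M) by positivity)
  set ε := min α (Real.log M) with hε
  filter_upwards [(h.tendsto_atTop ha hα).eventually_ge_atTop (LineBreaking.totalLength a N),
    eventually_ge_atTop N] with n hn hNn i hi hin
  have hn0 : (0 : ℝ) < n := by exact_mod_cast hi.trans hin
  have han := ha n (hi.trans hin)
  rcases le_total i N with hiN | hiN
  · have := (le_totalLength ha hi hiN).trans hn
    nlinarith
  · have h1 := (hN i n hiN hin).1
    have h2 : ((i : ℝ) / n) ^ (α - ε) ≤ 1 := Real.rpow_le_one (by positivity)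
      ((div_le_one hn0).2 (by exact_mod_cast hin)) (by linarith [min_le_left α (Real.log M)])
    have h3 : Real.exp ε ≤ M := by
      rw [← Real.le_log_iff_exp_le (by linarith)]
      exact min_le_right _ _
    calc a i ≤ Real.exp ε * a n * ((i : ℝ) / n) ^ (α - ε) := h1
      _ ≤ M * a n * 1 := by gcongr
      _ = M * a n := mul_one _

lemma PotterBounds.eventually_mul_le {a : ℕ → ℝ} {α : ℝ} (ha : ∀ n : ℕ, 1 ≤ n → 0 < a n)
    (hα : 0 < α) (h : PotterBounds a α) {m : ℝ} (hm0 : 0 < m) (hm : m < 1) :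
    ∃ δ : ℝ, 0 < δ ∧ ∀ᶠ n : ℕ in atTop, ∀ j : ℕ, (1 - δ) * n ≤ j → j ≤ n → m * a n ≤ a j := by
  have hl : 0 < -Real.log m := by linarith [Real.log_neg hm0 hm]
  set ε := -Real.log m / 4 with hε
  obtain ⟨N, hN1, hN⟩ := h.rpow_bounds ha (show 0 < ε by positivity)
  have hcont : Tendsto (fun δ : ℝ => Real.exp (-ε) * (1 - δ) ^ (α + ε)) (𝓝[>] 0)
      (𝓝 (Real.exp (-ε))) := by
    have : ContinuousAt (fun δ : ℝ => Real.exp (-ε) * (1 - δ) ^ (α + ε)) 0 :=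
      continuousAt_const.mul (ContinuousAt.rpow_const (by fun_prop) (Or.inl (by norm_num)))
    simpa using this.tendsto.mono_left nhdsWithin_le_nhds
  have hme : m < Real.exp (-ε) := by
    rw [← Real.log_lt_iff_lt_exp hm0]; linarith
  obtain ⟨δ, ⟨hδm, hδ2⟩, hδ⟩ := (((hcont.eventually (lt_mem_nhds hme)).and
    ((gt_mem_nhds (show (0 : ℝ) < 1 / 2 by norm_num)).filter_mono nhdsWithin_le_nhds)).and
    self_mem_nhdsWithin).exists
  refine ⟨δ, hδ, ?_⟩
  filter_upwards [eventually_ge_atTop (2 * N)] with n hn j hj hjn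
  have hn0 : (0 : ℝ) < n := by exact_mod_cast (show 0 < n by omega)
  have hNj : N ≤ j := by
    have h1 : (2 : ℝ) * N ≤ n := by exact_mod_cast hn
    have h2 : (N : ℝ) ≤ j := by nlinarith
    exact_mod_cast h2
  have han := ha n (by omega)
  refine le_trans ?_ (hN j n hNj hjn).2
  have h3 : 1 - δ ≤ (j : ℝ) / n := (le_div_iff₀ hn0).2 hj
  calc m * a n ≤ Real.exp (-ε) * (1 - δ) ^ (α + ε) * a n := by gcongr
    _ = Real.exp (-ε) * a n * (1 - δ) ^ (α + ε) := by ring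
    _ ≤ Real.exp (-ε) * a n * ((j : ℝ) / n) ^ (α + ε) := by gcongr; linarith

lemma PotterBounds.tendsto_weight_zero {a : ℕ → ℝ} {α : ℝ} (ha : ∀ n : ℕ, 1 ≤ n → 0 < a n)
    (hα : 0 < α) (h : PotterBounds a α) :
    Tendsto (fun n => a n / LineBreaking.totalLength a n) atTop (𝓝 0) := by
  have h1 := ((h.tendsto_sum_div ha (by linarith)).inv₀ (by positivity)).mul
    (tendsto_one_div_atTop_nhds_zero_nat (𝕜 := ℝ))
  rw [mul_zero] at h1
  refine h1.congr' ?_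
  filter_upwards [eventually_ge_atTop 1] with n hn
  have hn0 : (0 : ℝ) < n := by exact_mod_cast hn
  have han := ha n hn
  have hAn := totalLength_pos ha hn
  change (LineBreaking.totalLength a n / _)⁻¹ * _ = _
  field_simp

/-! ### The product formula at θ = λ / a_n: its limit and a bound uniform in λ. -/

/-- `glueGain x = ∫₀¹ (exp (x u) - 1) du`, in closed form. -/
noncomputable def glueGain (x : ℝ) : ℝ := (Real.exp x - 1 - x) / x

lemma hasSum_exp_sub_one (x : ℝ) :
    HasSum (fun k : ℕ => x ^ (k + 1) / ((k + 1).factorial : ℝ)) (Real.exp x - 1) := by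
  have h := NormedSpace.expSeries_div_hasSum_exp x
  rw [← Real.exp_eq_exp_ℝ, ← hasSum_nat_add_iff' 1] at h
  simpa using h

lemma hasSum_glueGain (x : ℝ) :
    HasSum (fun k : ℕ => x ^ (k + 1) / ((k + 2).factorial : ℝ)) (glueGain x) := by
  -- Division by zero yields 0, which is the correct value of `glueGain` at 0.
  rcases eq_or_ne x 0 with rfl | hx
  · simp [glueGain]
  have h := hasSum_exp_sub_one x
  rw [← hasSum_nat_add_iff' 1] at h
  have h2 := h.div_const x
  simp only [Finset.sum_range_one, zero_add, pow_one, Nat.factorial_one, Nat.cast_one,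
    div_one] at h2
  refine h2.congr_fun fun k => ?_
  rw [pow_succ x (k + 1)]
  field_simp

lemma abs_glueGain_le (x : ℝ) : |glueGain x| ≤ |x| * Real.exp |x| := by
  have h := (NormedSpace.expSeries_div_hasSum_exp |x|).mul_left |x|
  rw [← Real.exp_eq_exp_ℝ] at h
  refine (hasSum_glueGain x).norm_le_of_bounded h fun k => ?_
  rw [norm_div, norm_pow, Real.norm_eq_abs, Real.norm_natCast, pow_succ', mul_div_assoc]
  gcongr
  omega

lemma integral_pow_mul_one_sub (k : ℕ) :
    ∫ u in (0 : ℝ)..1, u ^ k * (1 - u) = 1 / ((k + 1) * (k + 2)) := by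
  have h : ∀ u : ℝ, u ^ k * (1 - u) = u ^ k - u ^ (k + 1) := fun u => by ring
  simp_rw [h]
  rw [intervalIntegral.integral_sub (by simp) (by simp), integral_pow, integral_pow]
  push_cast
  have h1 : (k : ℝ) + 1 ≠ 0 := by positivity
  have h2 : (k : ℝ) + 2 ≠ 0 := by positivity
  have h3 : (k : ℝ) + 1 + 1 ≠ 0 := by positivity
  simp
  field_simp
  ring

/-- Expand (e^(λu) - 1) / u in powers of u and integrate against 1 - u. The terms are grouped as a
coefficient of `glueGain` times a limit from `tendsto_sum_weight_mul_pow`. -/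
lemma hasSum_phi {α : ℝ} (hα : 0 < α) (lam : ℝ) :
    HasSum (fun k : ℕ => lam ^ (k + 1) / ((k + 2).factorial : ℝ) * ((α + 1) / (α * (k + 1 : ℕ))))
      (phi α lam) := by
  have hb : Summable fun k : ℕ => |lam| ^ (k + 1) / ((k + 1).factorial : ℝ) :=
    (hasSum_exp_sub_one |lam|).summable
  have h := intervalIntegral.hasSum_integral_of_dominated_convergence (μ := volume) (a := 0)
    (b := 1) (F := fun (k : ℕ) u => lam ^ (k + 1) / ((k + 1).factorial : ℝ) * (u ^ k * (1 - u)))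
    (f := fun u => (Real.exp (lam * u) - 1) * ((1 - u) / u))
    (fun k _ => |lam| ^ (k + 1) / ((k + 1).factorial : ℝ))
    (fun k => by fun_prop)
    (fun k => Eventually.of_forall fun u hu => by
      rw [Set.uIoc_of_le zero_le_one] at hu
      rw [norm_mul, norm_div, norm_pow, Real.norm_eq_abs, Real.norm_natCast, norm_mul, norm_pow,
        Real.norm_of_nonneg hu.1.le, Real.norm_of_nonneg (by linarith [hu.2])]
      have h1 : u ^ k ≤ 1 := pow_le_one₀ hu.1.le hu.2
      have h2 : u ^ k * (1 - u) ≤ 1 := mul_le_one₀ h1 (by linarith [hu.2]) (by linarith [hu.1])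
      exact mul_le_of_le_one_right (by positivity) h2)
    (Eventually.of_forall fun _ _ => hb) (by simp)
    (Eventually.of_forall fun u hu => by
      rw [Set.uIoc_of_le zero_le_one] at hu
      refine ((hasSum_exp_sub_one (lam * u)).mul_right ((1 - u) / u)).congr_fun fun k => ?_
      have := hu.1.ne'
      rw [mul_pow, pow_succ u k]
      field_simp)
  have h2 := h.mul_left ((α + 1) / α)
  refine h2.congr_fun fun k => ?_
  rw [intervalIntegral.integral_const_mul, integral_pow_mul_one_sub, Nat.factorial_succ (k + 1)]
  push_cast
  have h1 : (k : ℝ) + 1 + 1 = k + 2 := by ring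
  rw [h1]
  field_simp

lemma abs_log_one_add_sub_le {x : ℝ} (hx : |x| ≤ 1 / 2) : |Real.log (1 + x) - x| ≤ 2 * x ^ 2 := by
  have h := Real.abs_log_sub_add_sum_range_le (x := -x) (by rw [abs_neg]; linarith) 1
  simp only [Finset.sum_range_one, zero_add, pow_one, Nat.cast_zero, div_one, sub_neg_eq_add,
    abs_neg] at h
  have h1 : |x| ^ (1 + 1) / (1 - |x|) ≤ 2 * x ^ 2 := by
    rw [div_le_iff₀ (by linarith), one_add_one_eq_two, sq_abs]
    nlinarith [sq_nonneg x]
  calc |Real.log (1 + x) - x| = |-x + Real.log (1 + x)| := by congr 1; ring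
    _ ≤ _ := h.trans h1

/-- log (1 + x) = x + O(x²), and the sum of the squares is at most the largest |x| times the bounded
sum of the |x|. -/
lemma tendsto_prod_one_add_of_negligible {x : ℕ → ℕ → ℝ} {s : ℕ → Finset ℕ} {S C : ℝ}
    (hS : Tendsto (fun n => ∑ i ∈ s n, x n i) atTop (𝓝 S))
    (hmax : ∀ ε : ℝ, 0 < ε → ∀ᶠ n in atTop, ∀ i ∈ s n, |x n i| ≤ ε)
    (habs : ∀ᶠ n in atTop, ∑ i ∈ s n, |x n i| ≤ C) :
    Tendsto (fun n => ∏ i ∈ s n, (1 + x n i)) atTop (𝓝 (Real.exp S)) := by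
  have hC : 0 ≤ C := by
    obtain ⟨n, hn⟩ := habs.exists
    exact (Finset.sum_nonneg fun i _ => abs_nonneg _).trans hn
  have hdiff : Tendsto (fun n => ∑ i ∈ s n, (Real.log (1 + x n i) - x n i)) atTop (𝓝 0) := by
    rw [Metric.tendsto_nhds]
    intro ε hε
    filter_upwards [hmax (min (1 / 2) (ε / (4 * (C + 1)))) (by positivity), habs] with n h1 h2
    rw [dist_zero_right, Real.norm_eq_abs]
    calc |∑ i ∈ s n, (Real.log (1 + x n i) - x n i)|
        ≤ ∑ i ∈ s n, 2 * (ε / (4 * (C + 1))) * |x n i| := by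
          refine (Finset.abs_sum_le_sum_abs _ _).trans (Finset.sum_le_sum fun i hi => ?_)
          refine (abs_log_one_add_sub_le ((h1 i hi).trans (min_le_left _ _))).trans ?_
          rw [← sq_abs, pow_two, ← mul_assoc]
          gcongr
          exact (h1 i hi).trans (min_le_right _ _)
      _ ≤ 2 * (ε / (4 * (C + 1))) * C := by
          rw [← Finset.mul_sum]; gcongr
      _ < ε := by
          have : 2 * (ε / (4 * (C + 1))) * C = ε * (C / (2 * (C + 1))) := by field_simp; norm_num
          rw [this]
          refine mul_lt_of_lt_one_right hε ?_
          rw [div_lt_one (by positivity)]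
          linarith
  have h1 := (Real.continuous_exp.tendsto _).comp (hdiff.add hS)
  rw [zero_add] at h1
  refine h1.congr' ?_
  filter_upwards [hmax (1 / 2) (by norm_num)] with n hn
  simp only [Function.comp_apply]
  rw [← Finset.sum_add_distrib, Real.exp_sum]
  refine Finset.prod_congr rfl fun i hi => ?_
  rw [sub_add_cancel, Real.exp_log]
  linarith [neg_abs_le (x n i), hn i hi]

/-- The Laplace transform of the height of a uniform point of `T n`, at `θ`. -/
noncomputable def heightMgf (a : ℕ → ℝ) (n : ℕ) (θ : ℝ) : ℝ :=
  ∏ i ∈ Finset.Icc 1 n, (1 + a i / totalLength a i * glueGain (θ * a i))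

lemma abs_weight_mul_glueGain_le {a : ℕ → ℝ} (ha : ∀ n : ℕ, 1 ≤ n → 0 < a n) {n i : ℕ}
    (hi : 1 ≤ i) (hin : i ≤ n) {M : ℝ} (hM : a i ≤ M * a n) (lam : ℝ) :
    |a i / totalLength a i * glueGain (lam / a n * a i)| ≤
      |lam| * Real.exp (|lam| * M) * (a i / totalLength a i * (a i / a n)) := by
  have hai := ha i hi
  have han := ha n (hi.trans hin)
  have hA := totalLength_pos ha hi
  have hr : a i / a n ≤ M := (div_le_iff₀ han).2 hM
  have h1 := abs_glueGain_le (lam / a n * a i)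
  have h2 : |lam / a n * a i| = |lam| * (a i / a n) := by
    rw [abs_mul, abs_div, abs_of_pos hai, abs_of_pos han]; ring
  rw [h2] at h1
  rw [abs_mul, abs_of_pos (div_pos hai hA)]
  calc a i / totalLength a i * |glueGain (lam / a n * a i)|
      ≤ a i / totalLength a i * (|lam| * (a i / a n) * Real.exp (|lam| * M)) := by
        refine mul_le_mul_of_nonneg_left (h1.trans ?_) (by positivity)
        gcongr
    _ = _ := by ring

theorem tendsto_heightMgf {a : ℕ → ℝ} {α : ℝ} (ha : ∀ n : ℕ, 1 ≤ n → 0 < a n)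
    (hα : 0 < α) (h : PotterBounds a α) (lam : ℝ) :
    Tendsto (fun n : ℕ => heightMgf a n (lam / a n)) atTop (𝓝 (Real.exp (phi α lam))) := by
  have hs : ∀ k : ℕ, 1 ≤ k → _ := fun k hk => tendsto_sum_weight_mul_pow ha hα h hk
  have h2 := h.eventually_le_mul ha hα (one_lt_two)
  have hs1 := hs 1 le_rfl
  obtain ⟨C, hC⟩ : ∃ C : ℝ, ∀ᶠ n : ℕ in atTop,
      ∑ i ∈ Finset.Icc 1 n, a i / totalLength a i * (a i / a n) ^ 1 ≤ C :=
    ⟨_, hs1.eventually (ge_mem_nhds (lt_add_one _))⟩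
  simp only [pow_one] at hC
  set K := |lam| * Real.exp (|lam| * 2) with hK
  have hK0 : 0 ≤ K := by positivity
  refine tendsto_prod_one_add_of_negligible (C := K * C) ?_ ?_ ?_
  · have hsum : ∀ n : ℕ, ∑ i ∈ Finset.Icc 1 n, a i / totalLength a i * glueGain (lam / a n * a i) =
        ∑' k : ℕ, lam ^ (k + 1) / ((k + 2).factorial : ℝ) *
          ∑ i ∈ Finset.Icc 1 n, a i / totalLength a i * (a i / a n) ^ (k + 1) := by
      intro n
      refine (HasSum.tsum_eq ?_).symm
      simp_rw [Finset.mul_sum]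
      refine hasSum_sum fun i _ => ?_
      refine ((hasSum_glueGain (lam / a n * a i)).mul_left _).congr_fun fun k => ?_
      rw [mul_pow, div_pow, div_pow]
      ring
    simp_rw [hsum]
    rw [← (hasSum_phi hα lam).tsum_eq]
    -- Limit and series are exchanged by domination: eventually a_i ≤ 2 a_n for all i ≤ n, so the
    -- k-th weighted sum is at most 2^k C.
    refine tendsto_tsum_of_dominated_convergence
      (bound := fun k : ℕ => |lam| ^ (k + 1) / ((k + 2).factorial : ℝ) * (2 ^ k * C)) ?_
      (fun k => (hs (k + 1) (by omega)).const_mul _) ?_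
    · have := ((hasSum_glueGain (|lam| * 2)).summable.mul_right (C / 2))
      refine this.congr fun k => ?_
      rw [mul_pow, pow_succ (2 : ℝ)]
      ring
    · filter_upwards [h2, hC] with n hn hCn k
      rw [norm_mul, norm_div, norm_pow, Real.norm_eq_abs, Real.norm_natCast]
      have hnn : ∀ i ∈ Finset.Icc 1 n, 0 ≤ a i / totalLength a i * (a i / a n) ^ (k + 1) := by
        intro i hi
        obtain ⟨hi1, hi2⟩ := Finset.mem_Icc.1 hi
        have := ha i hi1
        have := ha n (hi1.trans hi2)
        have := totalLength_pos ha hi1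
        positivity
      rw [Real.norm_of_nonneg (Finset.sum_nonneg hnn)]
      gcongr
      calc ∑ i ∈ Finset.Icc 1 n, a i / totalLength a i * (a i / a n) ^ (k + 1)
          ≤ ∑ i ∈ Finset.Icc 1 n, 2 ^ k * (a i / totalLength a i * (a i / a n)) := by
            refine Finset.sum_le_sum fun i hi => ?_
            obtain ⟨hi1, hi2⟩ := Finset.mem_Icc.1 hi
            have h3 := ha i hi1
            have h4 := ha n (hi1.trans hi2)
            have h5 := totalLength_pos ha hi1
            have h6 : (a i / a n) ^ k ≤ 2 ^ k :=
              pow_le_pow_left₀ (by positivity) ((div_le_iff₀ h4).2 (hn i hi1 hi2)) k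
            calc a i / totalLength a i * (a i / a n) ^ (k + 1)
                = (a i / a n) ^ k * (a i / totalLength a i * (a i / a n)) := by ring
              _ ≤ _ := by gcongr
        _ ≤ 2 ^ k * C := by rw [← Finset.mul_sum]; gcongr
  · intro ε hε
    set η := ε / (2 * K + 1) with hη
    have hη0 : 0 < η := by positivity
    obtain ⟨N, hN⟩ := eventually_atTop.1
      ((h.tendsto_weight_zero ha hα).eventually (gt_mem_nhds hη0))
    have hbig := (h.tendsto_atTop ha hα).eventually_ge_atTop (totalLength a N / η)
    filter_upwards [h2, hbig] with n hn hbn i hi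
    obtain ⟨hi1, hi2⟩ := Finset.mem_Icc.1 hi
    refine (abs_weight_mul_glueGain_le ha hi1 hi2 (hn i hi1 hi2) lam).trans ?_
    have h3 := ha i hi1
    have h4 := ha n (hi1.trans hi2)
    have h5 := totalLength_pos ha hi1
    have h6 : a i / a n ≤ 2 := (div_le_iff₀ h4).2 (hn i hi1 hi2)
    have h7 : a i / totalLength a i ≤ 1 := (div_le_one h5).2 (le_totalLength ha hi1 le_rfl)
    have h8 : a i / totalLength a i * (a i / a n) ≤ 2 * η := by
      -- Late segments have a small weight a_i / A_i; early ones have a small ratio a_i / a_n, since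
      -- a_n → ∞.
      rcases le_total N i with hNi | hNi
      · calc a i / totalLength a i * (a i / a n) ≤ η * 2 := by
              gcongr
              exact (hN i hNi).le
          _ = 2 * η := by ring
      · have h9 : a i / a n ≤ η := by
          rw [div_le_iff₀ h4]
          rw [div_le_iff₀ hη0] at hbn
          linarith [le_totalLength ha hi1 hNi]
        calc a i / totalLength a i * (a i / a n) ≤ 1 * η := by gcongr
          _ ≤ 2 * η := by linarith
    calc K * (a i / totalLength a i * (a i / a n)) ≤ K * (2 * η) := by gcongr
      _ = ε * (2 * K / (2 * K + 1)) := by rw [hη]; field_simp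
      _ ≤ ε := mul_le_of_le_one_right hε.le ((div_le_one (by positivity)).2 (by linarith))
  · filter_upwards [h2, hC] with n hn hCn
    calc ∑ i ∈ Finset.Icc 1 n, |a i / totalLength a i * glueGain (lam / a n * a i)|
        ≤ ∑ i ∈ Finset.Icc 1 n, K * (a i / totalLength a i * (a i / a n)) := by
          refine Finset.sum_le_sum fun i hi => ?_
          obtain ⟨hi1, hi2⟩ := Finset.mem_Icc.1 hi
          exact abs_weight_mul_glueGain_le ha hi1 hi2 (hn i hi1 hi2) lam
      _ ≤ K * C := by rw [← Finset.mul_sum]; gcongr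

/-- The Chernoff bound for the height lets λ grow with n, so the set of admissible n must not depend
on λ. Having `M` arbitrarily close to 1 makes the constant in the upper bound sharp. -/
lemma exists_heightMgf_le {a : ℕ → ℝ} {α : ℝ} (ha : ∀ n : ℕ, 1 ≤ n → 0 < a n)
    (hα : 0 < α) (h : PotterBounds a α) {M : ℝ} (hM : 1 < M) :
    ∃ C : ℝ, 0 < C ∧ ∀ᶠ n : ℕ in atTop, ∀ lam : ℝ, 0 ≤ lam →
      heightMgf a n (lam / a n) ≤ Real.exp (C * lam * Real.exp (lam * M)) := by
  have hs1 := tendsto_sum_weight_mul_pow ha hα h le_rfl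
  simp only [pow_one] at hs1
  refine ⟨(α + 1) / (α * (1 : ℕ)) + 1, by positivity, ?_⟩
  filter_upwards [h.eventually_le_mul ha hα hM, hs1.eventually (ge_mem_nhds (lt_add_one _))]
    with n hn hCn lam hlam
  have hterm : ∀ i ∈ Finset.Icc 1 n, |a i / totalLength a i * glueGain (lam / a n * a i)| ≤
      lam * Real.exp (lam * M) * (a i / totalLength a i * (a i / a n)) := by
    intro i hi
    obtain ⟨hi1, hi2⟩ := Finset.mem_Icc.1 hi
    have := abs_weight_mul_glueGain_le ha hi1 hi2 (hn i hi1 hi2) lam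
    rwa [abs_of_nonneg hlam] at this
  have hnonneg : ∀ i ∈ Finset.Icc 1 n,
      0 ≤ 1 + a i / totalLength a i * glueGain (lam / a n * a i) := by
    intro i hi
    obtain ⟨hi1, hi2⟩ := Finset.mem_Icc.1 hi
    have h3 := ha i hi1
    have h4 := ha n (hi1.trans hi2)
    have h5 := totalLength_pos ha hi1
    have h6 : 0 ≤ glueGain (lam / a n * a i) := by
      unfold glueGain
      exact div_nonneg (by linarith [Real.add_one_le_exp (lam / a n * a i)]) (by positivity)
    positivity
  calc heightMgf a n (lam / a n)
      ≤ ∏ i ∈ Finset.Icc 1 n,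
          Real.exp (lam * Real.exp (lam * M) * (a i / totalLength a i * (a i / a n))) := by
        refine Finset.prod_le_prod hnonneg fun i hi => ?_
        have := Real.add_one_le_exp
          (lam * Real.exp (lam * M) * (a i / totalLength a i * (a i / a n)))
        linarith [hterm i hi, le_abs_self (a i / totalLength a i * glueGain (lam / a n * a i))]
    _ = Real.exp (lam * Real.exp (lam * M) *
          ∑ i ∈ Finset.Icc 1 n, a i / totalLength a i * (a i / a n)) := by
        rw [← Real.exp_sum, Finset.mul_sum]
    _ ≤ Real.exp (((α + 1) / (α * (1 : ℕ)) + 1) * lam * Real.exp (lam * M)) := by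
        refine Real.exp_le_exp.2 ?_
        calc _ ≤ lam * Real.exp (lam * M) * ((α + 1) / (α * (1 : ℕ)) + 1) := by gcongr
          _ = _ := by ring

/-! ### Heights in the tree: recursion, bounds, measurability. -/

/-- The height of the base of the segment `b j` when the gluing points are given by `g`. -/
noncomputable def baseHeight (g : ℕ → ℕ × ℝ) (j : ℕ) : ℝ :=
  if j ≤ 1 then 0 else treeDist g (j - 1) (g (j - 1)) root

lemma treeDist_root_one (g : ℕ → ℕ × ℝ) (x : ℕ × ℝ) :
    treeDist g 1 x root = if x.1 = 1 then |x.2| else 0 := by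
  simp [treeDist, root]

lemma treeDist_root_succ (g : ℕ → ℕ × ℝ) {n : ℕ} (hn : 1 ≤ n) (x : ℕ × ℝ) :
    treeDist g (n + 1) x root =
      if x.1 = n + 1 then x.2 + treeDist g n (g n) root else treeDist g n x root := by
  have h : ¬ (root.1 = n + 1) := by simp [root]; omega
  simp only [treeDist, h, if_false]

lemma baseHeight_one (g : ℕ → ℕ × ℝ) : baseHeight g 1 = 0 := by simp [baseHeight]

lemma baseHeight_succ (g : ℕ → ℕ × ℝ) {j : ℕ} (hj : 1 ≤ j) :
    baseHeight g (j + 1) = treeDist g j (g j) root := by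
  simp [baseHeight, show ¬ (j + 1 ≤ 1) by omega]

lemma treeDist_root_eq (g : ℕ → ℕ × ℝ) {n j : ℕ} (hj : 1 ≤ j) (hjn : j ≤ n) {s : ℝ} (hs : 0 ≤ s) :
    treeDist g n (j, s) root = s + baseHeight g j := by
  induction n, (hj.trans hjn) using Nat.le_induction with
  | base =>
    obtain rfl : j = 1 := by omega
    simp [treeDist_root_one, baseHeight_one, abs_of_nonneg hs]
  | succ n hn ih =>
    rw [treeDist_root_succ g hn]
    rcases eq_or_ne j (n + 1) with rfl | h
    · simp [baseHeight_succ g hn]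
    · rw [if_neg h, ih (by omega)]

lemma treeDist_root_of_mem {a : ℕ → ℝ} (g : ℕ → ℕ × ℝ) {n : ℕ} {x : ℕ × ℝ}
    (hx : x ∈ treePoints a n) : treeDist g n x root = x.2 + baseHeight g x.1 :=
  treeDist_root_eq g hx.1.1 hx.1.2 hx.2.1

lemma baseHeight_mem_Icc {a : ℕ → ℝ} (ha : ∀ n : ℕ, 1 ≤ n → 0 < a n) {g : ℕ → ℕ × ℝ}
    (hg : ∀ k : ℕ, 1 ≤ k → g k ∈ treePoints a k) {j : ℕ} (hj : 1 ≤ j) :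
    baseHeight g j ∈ Set.Icc 0 (totalLength a (j - 1)) := by
  induction j using Nat.strong_induction_on with
  | _ j ih =>
    rcases eq_or_lt_of_le hj with rfl | hj1
    · simp [baseHeight_one, totalLength]
    · obtain ⟨k, rfl⟩ : ∃ k, j = k + 1 := ⟨j - 1, by omega⟩
      have hk : 1 ≤ k := by omega
      have hgk := hg k hk
      rw [baseHeight_succ g hk, treeDist_root_of_mem g hgk, add_tsub_cancel_right]
      have h1 := ih (g k).1 (by have := hgk.1.2; omega) hgk.1.1
      refine ⟨add_nonneg hgk.2.1 h1.1, ?_⟩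
      have h2 : totalLength a (g k).1 = totalLength a ((g k).1 - 1) + a (g k).1 := by
        have := totalLength_succ a ((g k).1 - 1)
        rwa [Nat.sub_add_cancel hgk.1.1] at this
      have h3 := totalLength_mono ha hgk.1.2
      linarith [h1.2, hgk.2.2]

lemma treeDist_root_mem_Icc {a : ℕ → ℝ} (ha : ∀ n : ℕ, 1 ≤ n → 0 < a n) {g : ℕ → ℕ × ℝ}
    (hg : ∀ k : ℕ, 1 ≤ k → g k ∈ treePoints a k) {n : ℕ} {x : ℕ × ℝ} (hx : x ∈ treePoints a n) :
    treeDist g n x root ∈ Set.Icc 0 (totalLength a n) := by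
  have h1 := baseHeight_mem_Icc ha hg hx.1.1
  rw [treeDist_root_of_mem g hx]
  refine ⟨add_nonneg hx.2.1 h1.1, ?_⟩
  have h2 : totalLength a x.1 = totalLength a (x.1 - 1) + a x.1 := by
    have := totalLength_succ a (x.1 - 1)
    rwa [Nat.sub_add_cancel hx.1.1] at this
  linarith [h1.2, hx.2.2, totalLength_mono ha hx.1.2]

lemma treeDist_root_congr {g g' : ℕ → ℕ × ℝ} {n : ℕ}
    (h : ∀ k ∈ Finset.Ico 1 n, g k = g' k) (x : ℕ × ℝ) :
    treeDist g n x root = treeDist g' n x root := by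
  induction n generalizing x with
  | zero => rfl
  | succ n ih =>
    rcases Nat.eq_zero_or_pos n with rfl | hn
    · simp only [zero_add, treeDist_root_one]
    · have h' : ∀ k ∈ Finset.Ico 1 n, g k = g' k := fun k hk =>
        h k (Finset.mem_Ico.2 ⟨(Finset.mem_Ico.1 hk).1, by have := (Finset.mem_Ico.1 hk).2; omega⟩)
      rw [treeDist_root_succ g hn, treeDist_root_succ g' hn, ih h', ih h',
        h n (Finset.mem_Ico.2 ⟨hn, by omega⟩)]

lemma baseHeight_congr {g g' : ℕ → ℕ × ℝ} {n j : ℕ} (hj : j ≤ n)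
    (h : ∀ k ∈ Finset.Ico 1 n, g k = g' k) : baseHeight g j = baseHeight g' j := by
  unfold baseHeight
  split_ifs with h1
  · rfl
  · rw [h (j - 1) (Finset.mem_Ico.2 ⟨by omega, by omega⟩)]
    refine treeDist_root_congr (fun k hk => h k ?_) _
    rw [Finset.mem_Ico] at hk ⊢
    omega

lemma measurable_treeDist_root {Ω : Type*} [MeasurableSpace Ω] {Y : ℕ → Ω → ℕ × ℝ} {n : ℕ}
    (hY : ∀ k ∈ Finset.Ico 1 n, Measurable (Y k)) {Z : Ω → ℕ × ℝ} (hZ : Measurable Z) :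
    Measurable fun ω => treeDist (fun k => Y k ω) n (Z ω) root := by
  induction n generalizing Z with
  | zero => exact measurable_const
  | succ n ih =>
    have hset : ∀ j : ℕ, MeasurableSet {ω | (Z ω).1 = j} := fun j =>
      (measurable_fst.comp hZ) (measurableSet_singleton j)
    rcases Nat.eq_zero_or_pos n with rfl | hn
    · simp only [zero_add, treeDist_root_one]
      exact Measurable.ite (hset 1) (measurable_snd.comp hZ).abs measurable_const
    · have hY' : ∀ k ∈ Finset.Ico 1 n, Measurable (Y k) := fun k hk =>
        hY k (Finset.mem_Ico.2 ⟨(Finset.mem_Ico.1 hk).1, by have := (Finset.mem_Ico.1 hk).2; omega⟩)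
      simp only [treeDist_root_succ _ hn]
      exact Measurable.ite (hset (n + 1))
        ((measurable_snd.comp hZ).add (ih hY' (hY n (Finset.mem_Ico.2 ⟨hn, by omega⟩))))
        (ih hY' hZ)

lemma measurable_baseHeight (j : ℕ) : Measurable fun g : ℕ → ℕ × ℝ => baseHeight g j := by
  unfold baseHeight
  split_ifs with h
  · exact measurable_const
  · exact measurable_treeDist_root (Y := fun k (g : ℕ → ℕ × ℝ) => g k)
      (fun k _ => measurable_pi_apply k) (measurable_pi_apply (j - 1))

/-- The sequence that agrees with `v` on `{1, …, n - 1}`. -/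
def extendPast (n : ℕ) (v : Finset.Ico 1 n → ℕ × ℝ) (k : ℕ) : ℕ × ℝ :=
  if h : k ∈ Finset.Ico 1 n then v ⟨k, h⟩ else (0, 0)

lemma measurable_extendPast (n : ℕ) : Measurable (extendPast n) := by
  refine measurable_pi_iff.2 fun k => ?_
  unfold extendPast
  split_ifs with h
  · exact measurable_pi_apply _
  · exact measurable_const

/-- Independence is assumed for the finite vector of earlier gluing points, whereas heights are
functionals of a whole sequence. A functional that reads only the past factors through that vector.
-/
lemma comp_eq_comp_extendPast {Ω β : Type*} {Y : ℕ → Ω → ℕ × ℝ} {n : ℕ} {F : (ℕ → ℕ × ℝ) → β}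
    (hF : ∀ g g' : ℕ → ℕ × ℝ, (∀ k ∈ Finset.Ico 1 n, g k = g' k) → F g = F g') :
    (fun ω => F fun k => Y k ω) =
      (F ∘ extendPast n) ∘ fun ω (k : Finset.Ico 1 n) => Y k ω := by
  funext ω
  refine hF _ _ fun k hk => ?_
  simp only [extendPast, dif_pos hk]

/-! ### The exact Laplace transform of the height of a uniform point. -/

section Probability

variable {Ω : Type*} [MeasurableSpace Ω] {P : Measure Ω} {a : ℕ → ℝ} {Y : ℕ → Ω → ℕ × ℝ}

lemma IsGluingSequence.measurable (hY : IsGluingSequence P a Y) {k : ℕ} (hk : 1 ≤ k) :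
    Measurable (Y k) := (hY k hk).1

lemma measurable_comp_past (hY : IsGluingSequence P a Y) {β : Type*} [MeasurableSpace β] {n : ℕ}
    {F : (ℕ → ℕ × ℝ) → β} (hFm : Measurable F)
    (hF : ∀ g g' : ℕ → ℕ × ℝ, (∀ k ∈ Finset.Ico 1 n, g k = g' k) → F g = F g') :
    Measurable fun ω => F fun k => Y k ω := by
  rw [comp_eq_comp_extendPast hF]
  exact (hFm.comp (measurable_extendPast n)).comp (measurable_pi_iff.2 fun k =>
    hY.measurable (Finset.mem_Ico.1 k.2).1)

lemma IsUniformPoint.indepFun_past {n : ℕ} {Z : Ω → ℕ × ℝ} (hZ : IsUniformPoint P a Y n Z)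
    {β γ : Type*} [MeasurableSpace β] [MeasurableSpace γ] {f : ℕ × ℝ → γ} (hf : Measurable f)
    {F : (ℕ → ℕ × ℝ) → β} (hFm : Measurable F)
    (hF : ∀ g g' : ℕ → ℕ × ℝ, (∀ k ∈ Finset.Ico 1 n, g k = g' k) → F g = F g') :
    IndepFun (fun ω => f (Z ω)) (fun ω => F fun k => Y k ω) P := by
  rw [comp_eq_comp_extendPast hF]
  exact hZ.2.2.comp hf (hFm.comp (measurable_extendPast n))

lemma ae_uniformMeasure_mem (a : ℕ → ℝ) (n : ℕ) :
    ∀ᵐ x ∂uniformMeasure a n, x ∈ treePoints a n := by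
  unfold uniformMeasure
  refine Measure.ae_smul_measure ?_ _
  have hms : MeasurableSet (treePoints a n) := by
    have : treePoints a n = ⋃ i ∈ Finset.Icc 1 n, ({i} : Set ℕ) ×ˢ Set.Icc 0 (a i) := by
      ext x
      simp only [treePoints, Set.mem_ofPred_eq, Set.mem_iUnion, Set.mem_prod,
        Set.mem_singleton_iff, Finset.mem_Icc, exists_prop, Set.mem_Icc]
      constructor
      · rintro ⟨h1, h2⟩
        exact ⟨x.1, h1, rfl, h2⟩
      · rintro ⟨i, h1, rfl, h2⟩
        exact ⟨h1, h2⟩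
    rw [this]
    exact Finset.measurableSet_biUnion _ fun i _ =>
      (measurableSet_singleton i).prod measurableSet_Icc
  rw [ae_iff, Measure.finsetSum_apply]
  refine Finset.sum_eq_zero fun i hi => ?_
  change ∀ᵐ x ∂_, x ∈ treePoints a n
  refine (ae_map_iff (p := fun x => x ∈ treePoints a n) (by fun_prop) hms).2 ?_
  refine (ae_restrict_mem measurableSet_Icc).mono fun s hs => ?_
  exact ⟨Finset.mem_Icc.1 hi, hs⟩

lemma IsUniformPoint.ae_mem {n : ℕ} {Z : Ω → ℕ × ℝ} (hZ : IsUniformPoint P a Y n Z) :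
    ∀ᵐ ω ∂P, Z ω ∈ treePoints a n :=
  ae_of_ae_map hZ.1.aemeasurable (hZ.2.1 ▸ ae_uniformMeasure_mem a n)

lemma IsGluingSequence.ae_mem (hY : IsGluingSequence P a Y) :
    ∀ᵐ ω ∂P, ∀ k : ℕ, 1 ≤ k → Y k ω ∈ treePoints a k := by
  rw [ae_all_iff]
  intro k
  by_cases hk : 1 ≤ k
  · filter_upwards [(hY k hk).ae_mem] with ω hω _ using hω
  · exact Eventually.of_forall fun ω h => absurd h hk

lemma integral_uniformMeasure (ha : ∀ n : ℕ, 1 ≤ n → 0 < a n) {n : ℕ} {f : ℕ × ℝ → ℝ}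
    (hf : Measurable f) (hfi : ∀ i ∈ Finset.Icc 1 n, IntegrableOn (fun s => f (i, s))
      (Set.Icc 0 (a i))) :
    ∫ x, f x ∂uniformMeasure a n =
      (totalLength a n)⁻¹ * ∑ i ∈ Finset.Icc 1 n, ∫ s in Set.Icc 0 (a i), f (i, s) := by
  unfold uniformMeasure
  rw [integral_smul_measure, integral_finsetSum_measure]
  · have h0 : 0 ≤ totalLength a n :=
      Finset.sum_nonneg fun i hi => (ha i (Finset.mem_Icc.1 hi).1).le
    change (ENNReal.ofReal (totalLength a n))⁻¹.toReal • _ = _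
    rw [ENNReal.toReal_inv, ENNReal.toReal_ofReal h0, smul_eq_mul]
    congr 1
    refine Finset.sum_congr rfl fun i _ => ?_
    rw [integral_map (by fun_prop) hf.aestronglyMeasurable]
  · intro i hi
    rw [integrable_map_measure hf.aestronglyMeasurable (by fun_prop)]
    exact hfi i hi

lemma setIntegral_exp_mul {θ r : ℝ} (hr : 0 < r) :
    ∫ s in Set.Icc 0 r, Real.exp (θ * s) = r * (1 + glueGain (θ * r)) := by
  rw [integral_Icc_eq_integral_Ioc, ← intervalIntegral.integral_of_le hr.le]
  rcases eq_or_ne θ 0 with rfl | hθ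
  · simp [glueGain]
  · rw [intervalIntegral.integral_comp_mul_left (fun x => Real.exp x) hθ, integral_exp]
    unfold glueGain
    simp only [mul_zero, Real.exp_zero, smul_eq_mul]
    have := hr.ne'
    field_simp
    ring

lemma IsUniformPoint.integral_indicator_exp (ha : ∀ n : ℕ, 1 ≤ n → 0 < a n) {n j : ℕ}
    {Z : Ω → ℕ × ℝ} (hZ : IsUniformPoint P a Y n Z) (hj : j ∈ Finset.Icc 1 n) (θ : ℝ) :
    ∫ ω, (if (Z ω).1 = j then Real.exp (θ * (Z ω).2) else 0) ∂P =
      (totalLength a n)⁻¹ * (a j * (1 + glueGain (θ * a j))) := by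
  have hf : Measurable fun x : ℕ × ℝ => if x.1 = j then Real.exp (θ * x.2) else 0 :=
    Measurable.ite (measurable_fst (measurableSet_singleton j)) (by fun_prop) measurable_const
  rw [← integral_map (f := fun x : ℕ × ℝ => if x.1 = j then Real.exp (θ * x.2) else 0)
    hZ.1.aemeasurable hf.aestronglyMeasurable, hZ.2.1, integral_uniformMeasure ha hf]
  · congr 1
    rw [Finset.sum_eq_single_of_mem j hj]
    · simp only [if_true]
      exact setIntegral_exp_mul (ha j (Finset.mem_Icc.1 hj).1)
    · intro i _ hij
      simp [hij]
  · intro i _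
    by_cases hij : i = j
    · simp only [hij, if_true]
      exact (by fun_prop : Continuous fun s : ℝ => Real.exp (θ * s)).continuousOn.integrableOn_Icc
    · simp [hij]

/-- The sum telescopes: with M_j the product up to j, A_j M_j = M_{j-1} (A_{j-1} + a_j (1 + g(θ
a_j))). -/
lemma sum_mul_heightMgf (ha : ∀ n : ℕ, 1 ≤ n → 0 < a n) (θ : ℝ) (n : ℕ) :
    ∑ j ∈ Finset.Icc 1 n, a j * (1 + glueGain (θ * a j)) * heightMgf a (j - 1) θ =
      totalLength a n * heightMgf a n θ := by
  induction n with
  | zero => simp [totalLength]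
  | succ n ih =>
    rw [Finset.sum_Icc_succ_top (by omega), ih, add_tsub_cancel_right]
    have h1 : heightMgf a (n + 1) θ = heightMgf a n θ *
        (1 + a (n + 1) / totalLength a (n + 1) * glueGain (θ * a (n + 1))) :=
      Finset.prod_Icc_succ_top (by omega) _
    have h2 := totalLength_succ a n
    have h3 := (totalLength_pos ha (show 1 ≤ n + 1 by omega)).ne'
    rw [h1]
    have h4 : totalLength a n = totalLength a (n + 1) - a (n + 1) := by linarith
    rw [h4]
    field_simp
    ring

lemma measurable_pointHeight (hY : IsGluingSequence P a Y) {X : ℕ → Ω → ℕ × ℝ} {n : ℕ}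
    (hX : Measurable (X n)) : Measurable (pointHeight Y X n) :=
  measurable_treeDist_root (fun _ hk => hY.measurable (Finset.mem_Ico.1 hk).1) hX

lemma ae_pointHeight_mem_Icc (ha : ∀ n : ℕ, 1 ≤ n → 0 < a n) (hY : IsGluingSequence P a Y)
    {X : ℕ → Ω → ℕ × ℝ} {n : ℕ} (hX : IsUniformPoint P a Y n (X n)) :
    ∀ᵐ ω ∂P, pointHeight Y X n ω ∈ Set.Icc 0 (totalLength a n) := by
  filter_upwards [hY.ae_mem, hX.ae_mem] with ω h1 h2 using treeDist_root_mem_Icc ha h1 h2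

variable [IsProbabilityMeasure P]

lemma integrable_of_ae_mem_Icc {f : Ω → ℝ} (hf : Measurable f) {φ : ℝ → ℝ} (hφ : Measurable φ)
    {A C : ℝ} (hfA : ∀ᵐ ω ∂P, f ω ∈ Set.Icc 0 A) (hφC : ∀ x ∈ Set.Icc 0 A, |φ x| ≤ C) :
    Integrable (fun ω => φ (f ω)) P :=
  Integrable.of_bound (hφ.comp hf).aestronglyMeasurable C (hfA.mono fun _ hω => hφC _ hω)

lemma abs_exp_mul_le {θ A x : ℝ} (hx : x ∈ Set.Icc 0 A) :
    |Real.exp (θ * x)| ≤ Real.exp (|θ| * A) := by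
  rw [abs_of_pos (Real.exp_pos _)]
  refine Real.exp_le_exp.2 ?_
  calc θ * x ≤ |θ| * x := mul_le_mul_of_nonneg_right (le_abs_self θ) hx.1
    _ ≤ |θ| * A := mul_le_mul_of_nonneg_left hx.2 (abs_nonneg θ)

lemma integrable_exp_pointHeight (ha : ∀ n : ℕ, 1 ≤ n → 0 < a n) (hY : IsGluingSequence P a Y)
    {X : ℕ → Ω → ℕ × ℝ} {n : ℕ} (hX : IsUniformPoint P a Y n (X n)) (θ : ℝ) :
    Integrable (fun ω => Real.exp (θ * pointHeight Y X n ω)) P :=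
  integrable_of_ae_mem_Icc (φ := fun x => Real.exp (θ * x)) (measurable_pointHeight hY hX.1)
    (by fun_prop) (ae_pointHeight_mem_Icc ha hY hX) fun _ hx => abs_exp_mul_le hx

theorem integral_exp_pointHeight (ha : ∀ n : ℕ, 1 ≤ n → 0 < a n) (hY : IsGluingSequence P a Y)
    {n : ℕ} (hn : 1 ≤ n) {X : ℕ → Ω → ℕ × ℝ} (hX : IsUniformPoint P a Y n (X n)) (θ : ℝ) :
    ∫ ω, Real.exp (θ * pointHeight Y X n ω) ∂P = heightMgf a n θ := by
  induction n using Nat.strong_induction_on generalizing X with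
  | _ n ih =>
    have hbase : ∀ j ∈ Finset.Icc 1 n,
        ∫ ω, Real.exp (θ * baseHeight (fun k => Y k ω) j) ∂P = heightMgf a (j - 1) θ := by
      intro j hj
      obtain ⟨hj1, hjn⟩ := Finset.mem_Icc.1 hj
      rcases eq_or_lt_of_le hj1 with rfl | hj2
      · simp [baseHeight_one, heightMgf]
      · obtain ⟨k, rfl⟩ : ∃ k, j = k + 1 := ⟨j - 1, by omega⟩
        have hk : 1 ≤ k := by omega
        -- The base of b (k+1) is the gluing point Y k, itself uniform on T k; hence the induction
        -- over arbitrary uniform points `X`.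
        rw [add_tsub_cancel_right, ← ih k (by omega) hk (hY k hk)]
        simp only [baseHeight_succ _ hk]
        rfl
    have hdecomp : (fun ω => Real.exp (θ * pointHeight Y X n ω)) =ᵐ[P] fun ω =>
        ∑ j ∈ Finset.Icc 1 n, (if (X n ω).1 = j then Real.exp (θ * (X n ω).2) else 0) *
          Real.exp (θ * baseHeight (fun k => Y k ω) j) := by
      filter_upwards [hX.ae_mem] with ω hω
      rw [Finset.sum_eq_single_of_mem (X n ω).1 (Finset.mem_Icc.2 hω.1)]
      · rw [if_pos rfl, ← Real.exp_add, ← mul_add]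
        unfold pointHeight
        rw [treeDist_root_of_mem _ hω]
      · intro j _ hj
        rw [if_neg (Ne.symm hj), zero_mul]
    have hfm : ∀ j : ℕ, Measurable fun x : ℕ × ℝ => if x.1 = j then Real.exp (θ * x.2) else 0 :=
      fun j => Measurable.ite (measurable_fst (measurableSet_singleton j)) (by fun_prop)
        measurable_const
    have hFm : ∀ j : ℕ, Measurable fun g : ℕ → ℕ × ℝ => Real.exp (θ * baseHeight g j) :=
      fun j => Real.measurable_exp.comp ((measurable_baseHeight j).const_mul θ)
    have hF : ∀ j ∈ Finset.Icc 1 n, ∀ g g' : ℕ → ℕ × ℝ,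
        (∀ k ∈ Finset.Ico 1 n, g k = g' k) →
          Real.exp (θ * baseHeight g j) = Real.exp (θ * baseHeight g' j) := by
      intro j hj g g' h
      rw [baseHeight_congr (Finset.mem_Icc.1 hj).2 h]
    rw [integral_congr_ae hdecomp, integral_finsetSum]
    · calc ∑ j ∈ Finset.Icc 1 n, ∫ ω, (if (X n ω).1 = j then Real.exp (θ * (X n ω).2) else 0) *
            Real.exp (θ * baseHeight (fun k => Y k ω) j) ∂P
          = ∑ j ∈ Finset.Icc 1 n, (totalLength a n)⁻¹ *
              (a j * (1 + glueGain (θ * a j)) * heightMgf a (j - 1) θ) := by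
            refine Finset.sum_congr rfl fun j hj => ?_
            -- The base height of b j, j ≤ n, reads only Y 1, …, Y (j - 1), so it is independent of
            -- X n.
            rw [(hX.indepFun_past (hfm j) (hFm j) (hF j hj)).integral_fun_mul_eq_mul_integral
              ((hfm j).comp hX.1).aestronglyMeasurable
              (measurable_comp_past hY (hFm j) (hF j hj)).aestronglyMeasurable,
              hX.integral_indicator_exp ha hj, hbase j hj]
            ring
        _ = heightMgf a n θ := by
            rw [← Finset.mul_sum, sum_mul_heightMgf ha,
              inv_mul_cancel_left₀ (totalLength_pos ha hn).ne']
    · intro j hj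
      refine Integrable.of_bound (((hfm j).comp hX.1).mul
        (measurable_comp_past hY (hFm j) (hF j hj))).aestronglyMeasurable
        (Real.exp (|θ| * a j) * Real.exp (|θ| * totalLength a (j - 1))) ?_
      filter_upwards [hY.ae_mem, hX.ae_mem] with ω h1 h2
      rw [norm_mul]
      gcongr
      · split_ifs with h
        · exact abs_exp_mul_le (h ▸ h2.2)
        · simpa using (Real.exp_pos _).le
      · exact abs_exp_mul_le (baseHeight_mem_Icc ha h1 (Finset.mem_Icc.1 hj).1)

end Probability

/-! ### From convergence of Laplace transforms to convergence of laws and moments. -/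

lemma integrable_of_integrable_sq {μ : Measure ℝ} [IsProbabilityMeasure μ] {f : ℝ → ℝ}
    (hf : Continuous f) (h0 : ∀ x, 0 ≤ f x) (h : Integrable (fun x => f x ^ 2) μ) :
    Integrable f μ := by
  refine ((integrable_const (1 : ℝ)).add h).mono' hf.aestronglyMeasurable
    (Eventually.of_forall fun x => ?_)
  rw [Real.norm_of_nonneg (h0 x)]
  simp only [Pi.add_apply]
  nlinarith [sq_nonneg (f x - 1)]

lemma integrable_min {μ : Measure ℝ} [IsProbabilityMeasure μ] {f : ℝ → ℝ}
    (hf : Continuous f) (h0 : ∀ x, 0 ≤ f x) {K : ℝ} (hK : 0 ≤ K) :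
    Integrable (fun x => min (f x) K) μ := by
  refine Integrable.of_bound (hf.min continuous_const).aestronglyMeasurable K
    (Eventually.of_forall fun x => ?_)
  rw [Real.norm_of_nonneg (le_min (h0 x) hK)]
  exact min_le_right _ _

/-- Truncation error: f - min(f, K) ≤ f² / K, a quantitative form of uniform integrability. -/
lemma abs_integral_sub_integral_min_le {μ : Measure ℝ} [IsProbabilityMeasure μ] {f : ℝ → ℝ}
    (hf : Continuous f) (h0 : ∀ x, 0 ≤ f x) (h : Integrable (fun x => f x ^ 2) μ) {C K : ℝ}
    (hC : ∫ x, f x ^ 2 ∂μ ≤ C) (hK : 0 < K) :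
    |∫ x, f x ∂μ - ∫ x, min (f x) K ∂μ| ≤ C / K := by
  have hfi := integrable_of_integrable_sq hf h0 h
  have hmi := integrable_min (μ := μ) hf h0 hK.le
  rw [← integral_sub hfi hmi, abs_of_nonneg (integral_nonneg fun x => sub_nonneg.2 (min_le_left _ _))]
  calc ∫ x, (f x - min (f x) K) ∂μ ≤ ∫ x, f x ^ 2 / K ∂μ := by
        refine integral_mono (hfi.sub hmi) (h.div_const K) fun x => ?_
        rw [le_div_iff₀ hK]
        rcases le_total (f x) K with hle | hle
        · simp only [min_eq_left hle, sub_self, zero_mul]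
          positivity
        · simp only [min_eq_right hle]
          nlinarith [h0 x]
    _ ≤ C / K := by rw [integral_div]; gcongr

lemma tendsto_integral_min {ι : Type*} {l : Filter ι} {μs : ι → ProbabilityMeasure ℝ}
    {μ : ProbabilityMeasure ℝ} (h : Tendsto μs l (𝓝 μ)) {f : ℝ → ℝ} (hf : Continuous f)
    (h0 : ∀ x, 0 ≤ f x) {K : ℝ} (hK : 0 ≤ K) :
    Tendsto (fun i => ∫ x, min (f x) K ∂(μs i : Measure ℝ)) l
      (𝓝 (∫ x, min (f x) K ∂(μ : Measure ℝ))) :=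
  ProbabilityMeasure.tendsto_iff_forall_integral_tendsto.1 h
    (BoundedContinuousFunction.ofNormedAddCommGroup (fun x => min (f x) K)
      (hf.min continuous_const) K fun x => by
        rw [Real.norm_of_nonneg (le_min (h0 x) hK)]; exact min_le_right _ _)

/-- Truncations are bounded and continuous, so the bound passes to the limit for each level `K`;
Fatou then removes the truncation. The filter is arbitrary so that ultrafilters are allowed. -/
lemma integrable_of_tendsto_of_integral_le {ι : Type*} {l : Filter ι} [NeBot l]
    {μs : ι → ProbabilityMeasure ℝ} {μ : ProbabilityMeasure ℝ} (h : Tendsto μs l (𝓝 μ))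
    {f : ℝ → ℝ} (hf : Continuous f) (h0 : ∀ x, 0 ≤ f x) {C : ℝ}
    (hint : ∀ᶠ i in l, Integrable f (μs i : Measure ℝ))
    (hC : ∀ᶠ i in l, ∫ x, f x ∂(μs i : Measure ℝ) ≤ C) :
    Integrable f (μ : Measure ℝ) ∧ ∫ x, f x ∂(μ : Measure ℝ) ≤ C := by
  have hC0 : 0 ≤ C := by
    obtain ⟨i, hi⟩ := hC.exists
    exact (integral_nonneg h0).trans hi
  have hK : ∀ K : ℕ, ∫ x, min (f x) K ∂(μ : Measure ℝ) ≤ C := by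
    intro K
    refine le_of_tendsto (tendsto_integral_min h hf h0 (Nat.cast_nonneg K)) ?_
    filter_upwards [hint, hC] with i h1 h2
    exact (integral_mono (integrable_min hf h0 (Nat.cast_nonneg K)) h1
      fun x => min_le_left _ _).trans h2
  have hlin : ∫⁻ x, ENNReal.ofReal (f x) ∂(μ : Measure ℝ) ≤ ENNReal.ofReal C := by
    have hlim : ∀ x, liminf (fun K : ℕ => ENNReal.ofReal (min (f x) K)) atTop =
        ENNReal.ofReal (f x) := by
      intro x
      refine Tendsto.liminf_eq (tendsto_const_nhds.congr' ?_)
      obtain ⟨N, hN⟩ := exists_nat_ge (f x)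
      filter_upwards [eventually_ge_atTop N] with K hKN
      rw [min_eq_left (hN.trans (by exact_mod_cast hKN))]
    calc ∫⁻ x, ENNReal.ofReal (f x) ∂(μ : Measure ℝ)
        = ∫⁻ x, liminf (fun K : ℕ => ENNReal.ofReal (min (f x) K)) atTop ∂(μ : Measure ℝ) := by
          simp_rw [hlim]
      _ ≤ liminf (fun K : ℕ => ∫⁻ x, ENNReal.ofReal (min (f x) K) ∂(μ : Measure ℝ)) atTop :=
          lintegral_liminf_le fun K =>
            ENNReal.measurable_ofReal.comp (hf.min continuous_const).measurable
      _ ≤ ENNReal.ofReal C := by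
          refine liminf_le_of_frequently_le' (Frequently.of_forall fun K => ?_)
          rw [← ofReal_integral_eq_lintegral_ofReal
            (integrable_min hf h0 (Nat.cast_nonneg K))
            (Eventually.of_forall fun x => le_min (h0 x) (Nat.cast_nonneg K))]
          exact ENNReal.ofReal_le_ofReal (hK K)
  have hi : Integrable f (μ : Measure ℝ) := by
    refine ⟨hf.aestronglyMeasurable, ?_⟩
    rw [hasFiniteIntegral_iff_ofReal (Eventually.of_forall h0)]
    exact hlin.trans_lt ENNReal.ofReal_lt_top
  refine ⟨hi, ?_⟩
  rw [integral_eq_lintegral_of_nonneg_ae (Eventually.of_forall h0) hf.aestronglyMeasurable]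
  exact ENNReal.toReal_le_of_le_ofReal hC0 hlin

/-- Weak convergence together with a bound on second moments gives convergence of the integrals
of an unbounded continuous function. -/
theorem tendsto_integral_of_sq_bounded {ι : Type*} {l : Filter ι} [NeBot l]
    {μs : ι → ProbabilityMeasure ℝ} {μ : ProbabilityMeasure ℝ} (h : Tendsto μs l (𝓝 μ))
    {f : ℝ → ℝ} (hf : Continuous f) (h0 : ∀ x, 0 ≤ f x) {C : ℝ}
    (hint : ∀ᶠ i in l, Integrable (fun x => f x ^ 2) (μs i : Measure ℝ))
    (hC : ∀ᶠ i in l, ∫ x, f x ^ 2 ∂(μs i : Measure ℝ) ≤ C) :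
    Integrable f (μ : Measure ℝ) ∧
      Tendsto (fun i => ∫ x, f x ∂(μs i : Measure ℝ)) l (𝓝 (∫ x, f x ∂(μ : Measure ℝ))) := by
  obtain ⟨hμi, hμC⟩ := integrable_of_tendsto_of_integral_le h (hf.pow 2)
    (fun x => sq_nonneg (f x)) hint hC
  have hC0 : 0 ≤ C := (integral_nonneg fun x => sq_nonneg (f x)).trans hμC
  refine ⟨integrable_of_integrable_sq hf h0 hμi, ?_⟩
  rw [Metric.tendsto_nhds]
  intro ε hε
  set K := 4 * (C + 1) / ε with hKdef
  have hK : 0 < K := by positivity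
  have hCK : C / K < ε / 3 := by
    rw [hKdef, div_div_eq_mul_div, div_lt_div_iff₀ (by positivity) (by norm_num)]
    nlinarith
  have h1 := abs_integral_sub_integral_min_le hf h0 hμi hμC hK
  filter_upwards [hint, hC, (Metric.tendsto_nhds.1 (tendsto_integral_min h hf h0 hK.le)) (ε / 3)
    (by positivity)] with i hi hCi hd
  have h2 := abs_integral_sub_integral_min_le hf h0 hi hCi hK
  rw [Real.dist_eq] at hd ⊢
  rw [abs_lt] at *
  rw [abs_le] at h1 h2
  constructor <;> linarith [h1.1, h1.2, h2.1, h2.2, hd.1, hd.2]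

/-- A Laplace transform finite on ℝ determines its analytic extension to ℂ, which determines the
measure. -/
theorem eq_of_isXiLaw {α : ℝ} {ν ν' : ProbabilityMeasure ℝ} (h : IsXiLaw α ν)
    (h' : IsXiLaw α ν') : ν = ν' := by
  have hmgf : mgf id (ν : Measure ℝ) = mgf id (ν' : Measure ℝ) := by
    funext t
    simp only [mgf, id]
    rw [(h t).2, (h' t).2]
  have huniv : integrableExpSet id (ν : Measure ℝ) = Set.univ :=
    Set.eq_univ_of_forall fun t => (h t).1
  have heq := eqOn_complexMGF_of_mgf hmgf
  rw [huniv] at heq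
  have hm : (ν : Measure ℝ) = ν' :=
    Measure.ext_of_complexMGF_id_eq (funext fun z => heq (by simp))
  exact Subtype.ext hm

/-- The square of exp(λx) is exp(2λx), so convergence of the transform at 2λ supplies the second
moment bound needed at λ. -/
lemma isXiLaw_of_tendsto {α : ℝ} {μs : ℕ → ProbabilityMeasure ℝ} {l : Filter ℕ}
    [NeBot l] (hl : l ≤ atTop)
    (hint : ∀ n lam, Integrable (fun x => Real.exp (lam * x)) (μs n : Measure ℝ))
    (hlim : ∀ lam, Tendsto (fun n => ∫ x, Real.exp (lam * x) ∂(μs n : Measure ℝ)) atTop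
      (𝓝 (Real.exp (phi α lam))))
    {ν : ProbabilityMeasure ℝ} (h : Tendsto μs l (𝓝 ν)) : IsXiLaw α ν := by
  intro lam
  have hsq : ∀ x : ℝ, Real.exp (lam * x) ^ 2 = Real.exp (2 * lam * x) := fun x => by
    rw [← Real.exp_nat_mul]; congr 1; push_cast; ring
  have h1 := tendsto_integral_of_sq_bounded h (f := fun x => Real.exp (lam * x)) (by fun_prop)
    (fun x => (Real.exp_pos _).le) (C := Real.exp (phi α (2 * lam)) + 1)
    (by simp_rw [hsq]; exact Eventually.of_forall fun n => hint n _)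
    (by
      simp_rw [hsq]
      exact hl ((hlim (2 * lam)).eventually (ge_mem_nhds (lt_add_one _))))
  exact ⟨h1.1, tendsto_nhds_unique h1.2 ((hlim lam).mono_left hl)⟩

lemma isTightMeasureSet_of_integral_exp_le {S : Set (ProbabilityMeasure ℝ)} {C : ℝ}
    (hint : ∀ μ ∈ S, ∀ lam : ℝ, Integrable (fun x => Real.exp (lam * x)) (μ : Measure ℝ))
    (hC : ∀ μ ∈ S, ∫ x, Real.exp (1 * x) ∂(μ : Measure ℝ) +
      ∫ x, Real.exp (-1 * x) ∂(μ : Measure ℝ) ≤ C) :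
    IsTightMeasureSet {x : Measure ℝ | ∃ μ ∈ S, (μ : Measure ℝ) = x} := by
  rw [isTightMeasureSet_iff_exists_isCompact_measure_compl_le]
  intro ε hε
  have hlim : Tendsto (fun r : ℝ => ENNReal.ofReal (C / Real.exp r)) atTop (𝓝 0) := by
    have := ENNReal.tendsto_ofReal (Real.tendsto_exp_atTop.const_div_atTop C)
    rwa [ENNReal.ofReal_zero] at this
  obtain ⟨r, hr⟩ := (hlim.eventually (gt_mem_nhds hε)).exists
  refine ⟨Set.Icc (-r) r, isCompact_Icc, ?_⟩
  rintro _ ⟨μ, hμ, rfl⟩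
  have h1 := mul_meas_ge_le_integral_of_nonneg (μ := (μ : Measure ℝ))
    (f := fun x => Real.exp (1 * x) + Real.exp (-1 * x))
    (Eventually.of_forall fun x => by positivity) ((hint μ hμ 1).add (hint μ hμ (-1)))
    (Real.exp r)
  rw [integral_add (hint μ hμ 1) (hint μ hμ (-1))] at h1
  have h2 : (Set.Icc (-r) r)ᶜ ⊆ {x | Real.exp r ≤ Real.exp (1 * x) + Real.exp (-1 * x)} := by
    intro x hx
    rw [Set.mem_compl_iff, Set.mem_Icc, not_and_or, not_le, not_le] at hx
    simp only [Set.mem_ofPred_eq]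
    rcases hx with hx | hx
    · have := Real.exp_le_exp.2 (show r ≤ -1 * x by linarith)
      linarith [Real.exp_pos (1 * x)]
    · have := Real.exp_le_exp.2 (show r ≤ 1 * x by linarith)
      linarith [Real.exp_pos (-1 * x)]
  refine (measure_mono h2).trans (le_trans ?_ hr.le)
  rw [← ofReal_measureReal]
  refine ENNReal.ofReal_le_ofReal ?_
  rw [le_div_iff₀ (Real.exp_pos r)]
  linarith [hC μ hμ]

/-- Compactness by Prokhorov: each cluster point is the limit along an ultrafilter and so has
transform exp φ. Uniqueness leaves a single cluster point, which is then the limit. Existence of the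
law is a by-product. -/
theorem exists_isXiLaw_tendsto {α : ℝ} {μs : ℕ → ProbabilityMeasure ℝ}
    (hint : ∀ n lam, Integrable (fun x => Real.exp (lam * x)) (μs n : Measure ℝ))
    (hlim : ∀ lam, Tendsto (fun n => ∫ x, Real.exp (lam * x) ∂(μs n : Measure ℝ)) atTop
      (𝓝 (Real.exp (phi α lam)))) :
    ∃ ν : ProbabilityMeasure ℝ, IsXiLaw α ν ∧ Tendsto μs atTop (𝓝 ν) := by
  obtain ⟨C, hC⟩ := ((hlim 1).add (hlim (-1))).bddAbove_range
  have hcomp : IsCompact (closure (Set.range μs)) := by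
    refine isCompact_closure_of_isTightMeasureSet (isTightMeasureSet_of_integral_exp_le (C := C) ?_ ?_)
    · rintro _ ⟨n, rfl⟩ lam
      exact hint n lam
    · rintro _ ⟨n, rfl⟩
      exact hC ⟨n, rfl⟩
  have hmem : ∀ n, μs n ∈ closure (Set.range μs) := fun n => subset_closure ⟨n, rfl⟩
  have hclus : ∀ ν, MapClusterPt ν atTop μs → IsXiLaw α ν := by
    intro ν hν
    obtain ⟨U, hU, hUt⟩ := mapClusterPt_iff_ultrafilter.1 hν
    exact isXiLaw_of_tendsto hU hint hlim hUt
  obtain ⟨ν, _, hν⟩ := hcomp.exists_mapClusterPt (f := atTop) (u := μs)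
    (tendsto_principal.2 (Eventually.of_forall hmem))
  exact ⟨ν, hclus ν hν, hcomp.tendsto_nhds_of_unique_mapClusterPt (Eventually.of_forall hmem)
    fun ν' _ hν' => eq_of_isXiLaw (hclus ν' hν') (hclus ν hν)⟩

lemma abs_rpow_le_exp_add_exp {p : ℝ} (hp : 0 ≤ p) (x : ℝ) :
    |x| ^ p ≤ p ^ p * (Real.exp (1 * x) + Real.exp (-1 * x)) := by
  have h := rpow_abs_le_mul_max_exp x hp one_ne_zero
  rw [abs_one, div_one] at h
  refine h.trans (mul_le_mul_of_nonneg_left ?_ (Real.rpow_nonneg hp p))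
  exact max_le (by linarith [Real.exp_pos (-1 * x)]) (by linarith [Real.exp_pos (1 * x)])

theorem tendsto_integral_rpow {α : ℝ} {μs : ℕ → ProbabilityMeasure ℝ}
    (hint : ∀ n lam, Integrable (fun x => Real.exp (lam * x)) (μs n : Measure ℝ))
    (hlim : ∀ lam, Tendsto (fun n => ∫ x, Real.exp (lam * x) ∂(μs n : Measure ℝ)) atTop
      (𝓝 (Real.exp (phi α lam))))
    (hpos : ∀ n, (μs n : Measure ℝ) (Set.Iio 0) = 0) {ν : ProbabilityMeasure ℝ}
    (h : Tendsto μs atTop (𝓝 ν)) {p : ℝ} (hp : 0 < p) :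
    Integrable (fun x : ℝ => x ^ p) (ν : Measure ℝ) ∧
      Tendsto (fun n => ∫ x, x ^ p ∂(μs n : Measure ℝ)) atTop
        (𝓝 (∫ x, x ^ p ∂(ν : Measure ℝ))) := by
  -- The argument runs with |x|^p, nonnegative on all of ℝ. It agrees with x^p almost everywhere
  -- because all the laws, and by the portmanteau theorem their limit, give no mass to the negative
  -- half-line.
  have hcont : Continuous fun x : ℝ => |x| ^ p :=
    continuous_abs.rpow_const fun _ => Or.inr hp.le
  have hsq : ∀ x : ℝ, (|x| ^ p) ^ 2 = |x| ^ (2 * p) := fun x => by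
    rw [← Real.rpow_natCast, ← Real.rpow_mul (abs_nonneg x)]; congr 1; push_cast; ring
  have hdom : ∀ n, Integrable (fun x => (2 * p) ^ (2 * p) *
      (Real.exp (1 * x) + Real.exp (-1 * x))) (μs n : Measure ℝ) := fun n =>
    ((hint n 1).add (hint n (-1))).const_mul _
  have hi : ∀ n, Integrable (fun x : ℝ => (|x| ^ p) ^ 2) (μs n : Measure ℝ) := by
    intro n
    refine (hdom n).mono' (hcont.pow 2).aestronglyMeasurable (Eventually.of_forall fun x => ?_)
    rw [Real.norm_of_nonneg (sq_nonneg _), hsq]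
    exact abs_rpow_le_exp_add_exp (by positivity) x
  obtain ⟨C, hC⟩ := (((hlim 1).add (hlim (-1))).const_mul ((2 * p) ^ (2 * p))).bddAbove_range
  have hb : ∀ n, ∫ x, (|x| ^ p) ^ 2 ∂(μs n : Measure ℝ) ≤ C := by
    intro n
    refine le_trans ?_ (hC ⟨n, rfl⟩)
    simp only
    rw [← integral_add (hint n 1) (hint n (-1)), ← integral_const_mul]
    refine integral_mono (hi n) (hdom n) fun x => ?_
    simp only [hsq]
    exact abs_rpow_le_exp_add_exp (by positivity) x
  have hmain := tendsto_integral_of_sq_bounded h hcont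
    (fun x => Real.rpow_nonneg (abs_nonneg x) p) (Eventually.of_forall hi) (Eventually.of_forall hb)
  have hνpos : (ν : Measure ℝ) (Set.Iio 0) = 0 := by
    have := ProbabilityMeasure.le_liminf_measure_open_of_tendsto h (isOpen_Iio (a := (0 : ℝ)))
    simpa [hpos] using this
  have habs : ∀ μ : ProbabilityMeasure ℝ, (μ : Measure ℝ) (Set.Iio 0) = 0 →
      (fun x : ℝ => |x| ^ p) =ᵐ[(μ : Measure ℝ)] fun x => x ^ p := by
    intro μ hμ
    have : ∀ᵐ x ∂(μ : Measure ℝ), x ∉ Set.Iio (0 : ℝ) := measure_eq_zero_iff_ae_notMem.1 hμ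
    filter_upwards [this] with x hx
    rw [abs_of_nonneg (not_lt.1 hx)]
  refine ⟨hmain.1.congr (habs ν hνpos), ?_⟩
  rw [← integral_congr_ae (habs ν hνpos)]
  exact hmain.2.congr fun n => integral_congr_ae (habs (μs n) (hpos n))

/-! ### Convergence of D_n / a_n. -/

section Probability

variable {Ω : Type*} [MeasurableSpace Ω] {P : Measure Ω} {a : ℕ → ℝ} {α : ℝ} {Y X : ℕ → Ω → ℕ × ℝ}

lemma measurable_pointHeight_div (hY : IsGluingSequence P a Y)
    (hX : ∀ n : ℕ, 1 ≤ n → IsUniformPoint P a Y n (X n)) (n : ℕ) :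
    Measurable fun ω => pointHeight Y X n ω / a n := by
  rcases Nat.eq_zero_or_pos n with rfl | hn
  · simp only [pointHeight, treeDist, zero_div]
    exact measurable_const
  · exact (measurable_pointHeight hY (hX n hn).1).div_const _

lemma ae_pointHeight_div_mem_Icc (ha : ∀ n : ℕ, 1 ≤ n → 0 < a n) (hY : IsGluingSequence P a Y)
    (hX : ∀ n : ℕ, 1 ≤ n → IsUniformPoint P a Y n (X n)) (n : ℕ) :
    ∀ᵐ ω ∂P, pointHeight Y X n ω / a n ∈ Set.Icc 0 (totalLength a n / a n) := by
  rcases Nat.eq_zero_or_pos n with rfl | hn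
  · simp [pointHeight, treeDist, totalLength]
  · filter_upwards [ae_pointHeight_mem_Icc ha hY (hX n hn)] with ω hω
    have := ha n hn
    exact ⟨div_nonneg hω.1 this.le, div_le_div_of_nonneg_right hω.2 this.le⟩

variable [IsProbabilityMeasure P]

/-- The law of `D n / a n`. -/
noncomputable def scaledLaw (hY : IsGluingSequence P a Y)
    (hX : ∀ n : ℕ, 1 ≤ n → IsUniformPoint P a Y n (X n)) (n : ℕ) : ProbabilityMeasure ℝ :=
  ⟨P.map fun ω => pointHeight Y X n ω / a n,
    Measure.isProbabilityMeasure_map (measurable_pointHeight_div hY hX n).aemeasurable⟩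

lemma integral_scaledLaw (hY : IsGluingSequence P a Y)
    (hX : ∀ n : ℕ, 1 ≤ n → IsUniformPoint P a Y n (X n)) (n : ℕ) {f : ℝ → ℝ} (hf : Measurable f) :
    ∫ x, f x ∂(scaledLaw hY hX n : Measure ℝ) = ∫ ω, f (pointHeight Y X n ω / a n) ∂P :=
  integral_map (measurable_pointHeight_div hY hX n).aemeasurable hf.aestronglyMeasurable

lemma integrable_exp_pointHeight_div (ha : ∀ n : ℕ, 1 ≤ n → 0 < a n) (hY : IsGluingSequence P a Y)
    (hX : ∀ n : ℕ, 1 ≤ n → IsUniformPoint P a Y n (X n)) (n : ℕ) (lam : ℝ) :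
    Integrable (fun ω => Real.exp (lam * (pointHeight Y X n ω / a n))) P :=
  integrable_of_ae_mem_Icc (φ := fun x => Real.exp (lam * x)) (measurable_pointHeight_div hY hX n)
    (by fun_prop) (ae_pointHeight_div_mem_Icc ha hY hX n) fun _ hx => abs_exp_mul_le hx

lemma integrable_rpow_pointHeight_div (ha : ∀ n : ℕ, 1 ≤ n → 0 < a n)
    (hY : IsGluingSequence P a Y) (hX : ∀ n : ℕ, 1 ≤ n → IsUniformPoint P a Y n (X n)) (n : ℕ)
    {p : ℝ} (hp : 0 < p) : Integrable (fun ω => (pointHeight Y X n ω / a n) ^ p) P :=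
  integrable_of_ae_mem_Icc (φ := fun x => x ^ p) (measurable_pointHeight_div hY hX n)
    (by fun_prop) (ae_pointHeight_div_mem_Icc ha hY hX n) fun x hx => by
      rw [abs_of_nonneg (Real.rpow_nonneg hx.1 p)]
      exact Real.rpow_le_rpow hx.1 hx.2 hp.le

lemma integrable_exp_scaledLaw (ha : ∀ n : ℕ, 1 ≤ n → 0 < a n) (hY : IsGluingSequence P a Y)
    (hX : ∀ n : ℕ, 1 ≤ n → IsUniformPoint P a Y n (X n)) (n : ℕ) (lam : ℝ) :
    Integrable (fun x => Real.exp (lam * x)) (scaledLaw hY hX n : Measure ℝ) :=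
  (integrable_map_measure (by fun_prop) (measurable_pointHeight_div hY hX n).aemeasurable).2
    (integrable_exp_pointHeight_div ha hY hX n lam)

lemma tendsto_integral_exp_pointHeight_div (ha : ∀ n : ℕ, 1 ≤ n → 0 < a n) (hα : 0 < α)
    (h : PotterBounds a α) (hY : IsGluingSequence P a Y)
    (hX : ∀ n : ℕ, 1 ≤ n → IsUniformPoint P a Y n (X n)) (lam : ℝ) :
    Tendsto (fun n => ∫ ω, Real.exp (lam * (pointHeight Y X n ω / a n)) ∂P) atTop
      (𝓝 (Real.exp (phi α lam))) := by
  refine (tendsto_heightMgf ha hα h lam).congr' ?_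
  filter_upwards [eventually_ge_atTop 1] with n hn
  rw [← integral_exp_pointHeight ha hY hn (hX n hn)]
  congr 1
  funext ω
  congr 1
  ring

lemma tendsto_integral_exp_scaledLaw (ha : ∀ n : ℕ, 1 ≤ n → 0 < a n) (hα : 0 < α)
    (h : PotterBounds a α) (hY : IsGluingSequence P a Y)
    (hX : ∀ n : ℕ, 1 ≤ n → IsUniformPoint P a Y n (X n)) (lam : ℝ) :
    Tendsto (fun n => ∫ x, Real.exp (lam * x) ∂(scaledLaw hY hX n : Measure ℝ)) atTop
      (𝓝 (Real.exp (phi α lam))) :=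
  (tendsto_integral_exp_pointHeight_div ha hα h hY hX lam).congr fun n =>
    (integral_scaledLaw hY hX n (f := fun x => Real.exp (lam * x)) (by fun_prop)).symm

lemma scaledLaw_Iio_zero (ha : ∀ n : ℕ, 1 ≤ n → 0 < a n) (hY : IsGluingSequence P a Y)
    (hX : ∀ n : ℕ, 1 ≤ n → IsUniformPoint P a Y n (X n)) (n : ℕ) :
    (scaledLaw hY hX n : Measure ℝ) (Set.Iio 0) = 0 := by
  change P.map _ _ = 0
  rw [Measure.map_apply (measurable_pointHeight_div hY hX n) measurableSet_Iio,
    measure_eq_zero_iff_ae_notMem]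
  filter_upwards [ae_pointHeight_div_mem_Icc ha hY hX n] with ω hω
  exact not_lt.2 hω.1

theorem tendsto_scaledLaw (ha : ∀ n : ℕ, 1 ≤ n → 0 < a n) (hα : 0 < α) (h : PotterBounds a α)
    (hY : IsGluingSequence P a Y) (hX : ∀ n : ℕ, 1 ≤ n → IsUniformPoint P a Y n (X n))
    {ν : ProbabilityMeasure ℝ} (hν : IsXiLaw α ν) : Tendsto (scaledLaw hY hX) atTop (𝓝 ν) := by
  obtain ⟨ν', hν', ht⟩ := exists_isXiLaw_tendsto (integrable_exp_scaledLaw ha hY hX)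
    (tendsto_integral_exp_scaledLaw ha hα h hY hX)
  rwa [eq_of_isXiLaw hν hν']

theorem existsUnique_isXiLaw (ha : ∀ n : ℕ, 1 ≤ n → 0 < a n) (hα : 0 < α) (h : PotterBounds a α)
    (hY : IsGluingSequence P a Y) : ∃! ν : ProbabilityMeasure ℝ, IsXiLaw α ν := by
  -- The gluing points themselves serve as the uniform points X n.
  obtain ⟨ν, hν, _⟩ := exists_isXiLaw_tendsto (integrable_exp_scaledLaw ha hY hY)
    (tendsto_integral_exp_scaledLaw ha hα h hY hY)
  exact ⟨ν, hν, fun ν' hν' => eq_of_isXiLaw hν' hν⟩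

theorem tendstoInDistribution_pointHeight_div (ha : ∀ n : ℕ, 1 ≤ n → 0 < a n) (hα : 0 < α)
    (h : PotterBounds a α) (hY : IsGluingSequence P a Y)
    (hX : ∀ n : ℕ, 1 ≤ n → IsUniformPoint P a Y n (X n)) {ν : ProbabilityMeasure ℝ}
    (hν : IsXiLaw α ν) :
    TendstoInDistribution (fun n ω => pointHeight Y X n ω / a n) atTop (id : ℝ → ℝ) (fun _ => P)
      (ν : Measure ℝ) where
  forall_aemeasurable n := (measurable_pointHeight_div hY hX n).aemeasurable
  tendsto := by
    have hmap : (⟨(ν : Measure ℝ).map id, Measure.isProbabilityMeasure_map aemeasurable_id⟩ :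
        ProbabilityMeasure ℝ) = ν := Subtype.ext Measure.map_id
    rw [hmap]
    exact tendsto_scaledLaw ha hα h hY hX hν

theorem tendsto_integral_rpow_pointHeight_div (ha : ∀ n : ℕ, 1 ≤ n → 0 < a n) (hα : 0 < α)
    (h : PotterBounds a α) (hY : IsGluingSequence P a Y)
    (hX : ∀ n : ℕ, 1 ≤ n → IsUniformPoint P a Y n (X n)) {ν : ProbabilityMeasure ℝ}
    (hν : IsXiLaw α ν) {p : ℝ} (hp : 0 < p) :
    Integrable (fun x : ℝ => x ^ p) (ν : Measure ℝ) ∧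
      Tendsto (fun n : ℕ => ∫ ω, (pointHeight Y X n ω / a n) ^ p ∂P) atTop
        (𝓝 (∫ x : ℝ, x ^ p ∂(ν : Measure ℝ))) := by
  have h1 := tendsto_integral_rpow (integrable_exp_scaledLaw ha hY hX)
    (tendsto_integral_exp_scaledLaw ha hα h hY hX) (scaledLaw_Iio_zero ha hY hX)
    (tendsto_scaledLaw ha hα h hY hX hν) hp
  exact ⟨h1.1, h1.2.congr fun n => integral_scaledLaw hY hX n (f := fun x => x ^ p) (by fun_prop)⟩

end Probability

/-! ### Upper bound for the height of the tree. -/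

lemma tendsto_log_natCast : Tendsto (fun n : ℕ => Real.log n) atTop atTop :=
  Real.tendsto_log_atTop.comp tendsto_natCast_atTop_atTop

lemma tendsto_log_log_natCast : Tendsto (fun n : ℕ => Real.log (Real.log n)) atTop atTop :=
  Real.tendsto_log_atTop.comp tendsto_log_natCast

lemma eventually_log_mul_rpow_le {s c : ℝ} (hs : s < 1) (hc : 0 < c) :
    ∀ᶠ x : ℝ in atTop, Real.log x * x ^ s ≤ c * x := by
  have h := (isLittleO_log_rpow_atTop (show 0 < 1 - s by linarith)).bound hc
  filter_upwards [h, eventually_gt_atTop 0] with x hx hx0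
  have h1 : Real.log x ≤ c * x ^ (1 - s) := by
    rw [Real.norm_of_nonneg (Real.rpow_nonneg hx0.le _)] at hx
    exact (Real.le_norm_self _).trans hx
  calc Real.log x * x ^ s ≤ c * x ^ (1 - s) * x ^ s := by gcongr
    _ = c * x := by rw [mul_assoc, ← Real.rpow_add hx0, sub_add_cancel, Real.rpow_one]

lemma eventually_const_mul_log_log_le (c : ℝ) :
    ∀ᶠ n : ℕ in atTop, c * Real.log (Real.log n) ≤ Real.log n := by
  have h := Real.isLittleO_log_id_atTop.bound (show 0 < 1 / (|c| + 1) by positivity)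
  filter_upwards [tendsto_log_natCast.eventually h, tendsto_log_natCast.eventually_gt_atTop 0,
    tendsto_log_log_natCast.eventually_gt_atTop 0] with n hn h0 h1
  rw [Real.norm_of_nonneg h1.le, id, Real.norm_of_nonneg h0.le, div_mul_eq_mul_div, one_mul,
    le_div_iff₀ (by positivity)] at hn
  nlinarith [le_abs_self c]

/-- log x / x decreases on [e, ∞), and log 16 > e. -/
lemma log_div_log_log_mono {m n : ℕ} (hm : 16 ≤ m) (hmn : m ≤ n) :
    Real.log m / Real.log (Real.log m) ≤ Real.log n / Real.log (Real.log n) := by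
  have he : Real.exp 1 ≤ Real.log 16 := by
    have h1 := Real.exp_one_lt_d9
    have h2 := Real.log_two_gt_d9
    have h3 : Real.log 16 = 4 * Real.log 2 := by
      rw [show (16 : ℝ) = 2 ^ 4 by norm_num, Real.log_pow]; norm_num
    linarith
  have hm' : (16 : ℝ) ≤ m := by exact_mod_cast hm
  have hmn' : (m : ℝ) ≤ n := by exact_mod_cast hmn
  have h1 : Real.exp 1 ≤ Real.log m := he.trans (Real.log_le_log (by norm_num) hm')
  have h2 : Real.log m ≤ Real.log n := Real.log_le_log (by linarith) hmn'
  have hpos : ∀ x : ℝ, Real.exp 1 ≤ x → 0 < Real.log x := fun x hx =>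
    Real.log_pos ((Real.one_lt_exp_iff.2 one_pos).trans_le hx)
  have h3 := Real.log_div_self_antitoneOn h1 (h1.trans h2) h2
  have h4 := hpos _ h1
  have h5 := hpos _ (h1.trans h2)
  have h6 : 0 < Real.log (m : ℝ) := (Real.exp_pos 1).trans_le h1
  have h7 : 0 < Real.log (n : ℝ) := h6.trans_le h2
  simp only at h3
  rw [div_le_div_iff₀ h7 h6] at h3
  rw [div_le_div_iff₀ h4 h5]
  linarith

lemma ae_eventually_notMem_of_le {Ω : Type*} [MeasurableSpace Ω] {P : Measure Ω}
    [IsProbabilityMeasure P] {s : ℕ → Set Ω} {u : ℕ → ℝ} (hu : Summable u)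
    (h : ∀ᶠ n in atTop, P.real (s n) ≤ u n) : ∀ᵐ ω ∂P, ∀ᶠ n in atTop, ω ∉ s n := by
  have hs : Summable fun n => P.real (s n) := by
    refine Summable.of_norm_bounded_eventually_nat hu ?_
    filter_upwards [h] with n hn
    rwa [Real.norm_of_nonneg measureReal_nonneg]
  refine ae_eventually_notMem ?_
  have e : ∀ n, ENNReal.ofReal (P.real (s n)) = P (s n) := fun n => ofReal_measureReal
  simpa only [e] using hs.tsum_ofReal_ne_top

section Height

variable {Ω : Type*} {a : ℕ → ℝ} {Y : ℕ → Ω → ℕ × ℝ} {ω : Ω}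

lemma treeHeight_le {n : ℕ} (ha : ∀ n : ℕ, 1 ≤ n → 0 < a n) (hn : 1 ≤ n) {B : ℝ}
    (hB : ∀ j : ℕ, 1 ≤ j → j ≤ n → a j + baseHeight (fun k => Y k ω) j ≤ B) :
    treeHeight a Y n ω ≤ B := by
  refine csSup_le ⟨_, root, ⟨⟨le_rfl, hn⟩, le_rfl, (ha 1 le_rfl).le⟩, rfl⟩ ?_
  rintro _ ⟨x, hx, rfl⟩
  simp only
  rw [treeDist_root_of_mem _ hx]
  linarith [hB x.1 hx.1.1 hx.1.2, hx.2.2]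

lemma baseHeight_le_treeHeight (ha : ∀ n : ℕ, 1 ≤ n → 0 < a n)
    (hY : ∀ k : ℕ, 1 ≤ k → Y k ω ∈ treePoints a k) {n j : ℕ} (hj : 1 ≤ j) (hjn : j ≤ n) :
    baseHeight (fun k => Y k ω) j ≤ treeHeight a Y n ω := by
  have hx : (j, (0 : ℝ)) ∈ treePoints a n := ⟨⟨hj, hjn⟩, le_rfl, (ha j hj).le⟩
  have h1 := treeDist_root_of_mem (fun k => Y k ω) hx
  rw [zero_add] at h1
  rw [← h1]
  refine le_csSup ⟨totalLength a n, ?_⟩ ⟨_, hx, rfl⟩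
  rintro _ ⟨x, hx', rfl⟩
  exact (treeDist_root_mem_Icc ha hY hx').2

end Height

section Upper

variable {Ω : Type*} [MeasurableSpace Ω] {P : Measure Ω} [IsProbabilityMeasure P] {a : ℕ → ℝ}
  {α : ℝ} {Y : ℕ → Ω → ℕ × ℝ}

lemma measureReal_pointHeight_ge_le (ha : ∀ n : ℕ, 1 ≤ n → 0 < a n) (hY : IsGluingSequence P a Y)
    {n : ℕ} (hn : 1 ≤ n) {lam : ℝ} (hlam : 0 ≤ lam) (t : ℝ) :
    P.real {ω | t * a n ≤ pointHeight Y Y n ω} ≤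
      Real.exp (-lam * t) * heightMgf a n (lam / a n) := by
  have han := ha n hn
  have h := measure_ge_le_exp_mul_mgf (μ := P) (X := pointHeight Y Y n) (t * a n)
    (t := lam / a n) (by positivity) (integrable_exp_pointHeight ha hY (hY n hn) _)
  rw [mgf, integral_exp_pointHeight ha hY hn (hY n hn)] at h
  have e : -(lam / a n) * (t * a n) = -lam * t := by field_simp
  rwa [e] at h

lemma ae_eventually_pointHeight_lt (ha : ∀ n : ℕ, 1 ≤ n → 0 < a n) (hα : 0 < α)
    (h : PotterBounds a α) (hY : IsGluingSequence P a Y) {ε : ℝ} (hε : 0 < ε) :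
    ∀ᵐ ω ∂P, ∀ᶠ n : ℕ in atTop,
      pointHeight Y Y n ω < (1 + ε) * (Real.log n / Real.log (Real.log n)) * a n := by
  -- Chernoff with λ = κ log log n. The main term of the exponent is -κ (1 + ε) log n = -(1 + ε/2)
  -- log n. The Laplace transform costs at most C λ e^(λM) with κM = (κ + 1)/2 < 1, hence o(log n),
  -- of which ε/4 · log n is allowed.
  set κ := (1 + ε / 2) / (1 + ε) with hκ
  have hκ0 : 0 < κ := by positivity
  have hκ1 : κ < 1 := (div_lt_one (by positivity)).2 (by linarith)
  have hM : 1 < (1 + 1 / κ) / 2 := by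
    have : 1 < 1 / κ := (one_lt_div hκ0).2 hκ1
    linarith
  have hκM : κ * ((1 + 1 / κ) / 2) = (κ + 1) / 2 := by field_simp
  obtain ⟨C, hC0, hC⟩ := exists_heightMgf_le ha hα h hM
  have hsum : Summable fun n : ℕ => (n : ℝ) ^ (-(1 + ε / 4)) :=
    Real.summable_nat_rpow.2 (by linarith)
  have hbound : ∀ᶠ n : ℕ in atTop, P.real {ω | (1 + ε) * (Real.log n / Real.log (Real.log n)) * a n
      ≤ pointHeight Y Y n ω} ≤ (n : ℝ) ^ (-(1 + ε / 4)) := by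
    filter_upwards [hC, eventually_ge_atTop 1, tendsto_log_natCast.eventually_gt_atTop 0,
      tendsto_log_log_natCast.eventually_gt_atTop 0, tendsto_log_natCast.eventually
      (eventually_log_mul_rpow_le (s := (κ + 1) / 2) (c := ε / (4 * (C * κ))) (by linarith)
        (by positivity))] with n hCn hn hL hLL hsmall
    have hn0 : (0 : ℝ) < n := by exact_mod_cast hn
    set x := Real.log (n : ℝ) with hx
    have hlam : 0 ≤ κ * Real.log x := by positivity
    refine (measureReal_pointHeight_ge_le ha hY hn hlam _).trans ?_
    calc Real.exp (-(κ * Real.log x) * ((1 + ε) * (x / Real.log x))) *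
          heightMgf a n (κ * Real.log x / a n)
        ≤ Real.exp (-(1 + ε / 2) * x) * Real.exp (ε / 4 * x) := by
          have e1 : -(κ * Real.log x) * ((1 + ε) * (x / Real.log x)) = -(1 + ε / 2) * x := by
            rw [hκ]; field_simp
          rw [e1]
          gcongr
          refine (hCn _ hlam).trans (Real.exp_le_exp.2 ?_)
          have e2 : Real.exp (κ * Real.log x * ((1 + 1 / κ) / 2)) = x ^ ((κ + 1) / 2) := by
            rw [Real.rpow_def_of_pos hL, ← hκM]; congr 1; ring
          rw [e2]
          calc C * (κ * Real.log x) * x ^ ((κ + 1) / 2)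
              = C * κ * (Real.log x * x ^ ((κ + 1) / 2)) := by ring
            _ ≤ C * κ * (ε / (4 * (C * κ)) * x) := by gcongr
            _ = ε / 4 * x := by field_simp
      _ = (n : ℝ) ^ (-(1 + ε / 4)) := by
          rw [← Real.exp_add, Real.rpow_def_of_pos hn0]
          congr 1
          ring
  filter_upwards [ae_eventually_notMem_of_le hsum hbound] with ω hω
  filter_upwards [hω] with n hn
  exact not_le.1 hn

theorem ae_eventually_treeHeight_le (ha : ∀ n : ℕ, 1 ≤ n → 0 < a n) (hα : 0 < α)
    (h : PotterBounds a α) (hY : IsGluingSequence P a Y) {r : ℝ} (hr : 1 < r) :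
    ∀ᵐ ω ∂P, ∀ᶠ n : ℕ in atTop, treeHeight a Y n ω * Real.log (Real.log n) /
      (a n * Real.log n) ≤ r := by
  -- One factor 1 + ε comes from Borel–Cantelli, the other from a_k ≤ (1 + ε) a_n; the last ε
  -- absorbs the length of the final segment.
  obtain ⟨ε, hε, hεr⟩ : ∃ ε : ℝ, 0 < ε ∧ (1 + ε) * (1 + ε) + ε ≤ r := by
    refine ⟨min 1 ((r - 1) / 4), lt_min one_pos (by linarith), ?_⟩
    have h1 := min_le_left 1 ((r - 1) / 4)
    have h2 := min_le_right 1 ((r - 1) / 4)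
    have h3 : 0 < min 1 ((r - 1) / 4) := lt_min one_pos (by linarith)
    nlinarith
  filter_upwards [ae_eventually_pointHeight_lt ha hα h hY hε, hY.ae_mem] with ω hω hgood
  obtain ⟨N, hN⟩ := eventually_atTop.1 hω
  set N₀ := max N 16 with hN₀
  set f : ℕ → ℝ := fun n => Real.log n / Real.log (Real.log n) with hf
  filter_upwards [h.eventually_le_mul ha hα (show 1 < 1 + ε by linarith),
    (h.tendsto_atTop ha hα).eventually_ge_atTop (totalLength a N₀), eventually_ge_atTop N₀,
    tendsto_log_natCast.eventually_gt_atTop 0, tendsto_log_log_natCast.eventually_gt_atTop 0,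
    eventually_const_mul_log_log_le ((1 + ε) / ε), eventually_const_mul_log_log_le 1]
    with n hmax hbig hnN hL hLL hf1 hf0
  have hn1 : 1 ≤ n := by omega
  have han := ha n hn1
  have hfn1 : 1 ≤ f n := (one_le_div hLL).2 (by linarith)
  have hfn2 : (1 + ε) / ε ≤ f n := (le_div_iff₀ hLL).2 hf1
  have hfn3 : 1 + ε ≤ ε * f n := by rw [div_le_iff₀ hε] at hfn2; linarith
  have hbase : ∀ j : ℕ, 1 ≤ j → j ≤ n →
      baseHeight (fun k => Y k ω) j ≤ (1 + ε) * (1 + ε) * f n * a n := by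
    intro j hj hjn
    rcases le_or_gt j N₀ with hjN | hjN
    · have h1 := (baseHeight_mem_Icc ha hgood hj).2
      have h2 := totalLength_mono ha (show j - 1 ≤ N₀ by omega)
      have h3 : a n * 1 ≤ a n * ((1 + ε) * (1 + ε) * f n) := by
        gcongr
        nlinarith
      linarith
    · obtain ⟨k, rfl⟩ : ∃ k, j = k + 1 := ⟨j - 1, by omega⟩
      have hk : 1 ≤ k := by omega
      rw [baseHeight_succ _ hk]
      have h1 := hN k (by omega)
      have h2 : f k ≤ f n := log_div_log_log_mono (by omega) (by omega)
      have h3 := hmax k hk (by omega)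
      refine h1.le.trans ?_
      have hak := ha k hk
      calc (1 + ε) * f k * a k ≤ (1 + ε) * f n * ((1 + ε) * a n) := by gcongr
        _ = _ := by ring
  have hH : treeHeight a Y n ω ≤ r * f n * a n := by
    refine treeHeight_le ha hn1 fun j hj hjn => ?_
    have h1 := hmax j hj hjn
    have h2 := hbase j hj hjn
    have h3 : (1 + ε) * a n ≤ ε * f n * a n := by gcongr
    have h4 : ((1 + ε) * (1 + ε) + ε) * (f n * a n) ≤ r * (f n * a n) := by gcongr
    linarith
  rw [div_le_iff₀ (by positivity)]
  calc treeHeight a Y n ω * Real.log (Real.log n)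
      ≤ r * f n * a n * Real.log (Real.log n) := by gcongr
    _ = r * (a n * Real.log n) := by rw [hf]; field_simp

end Upper

/-! ### Lower bound for the height: chains of segments glued near the top. -/

/-- The point `x` lies on a segment `b (j + 1)`, `j ∈ S`, in its upper part of relative
length `δ`. -/
def InTop (a : ℕ → ℝ) (δ : ℝ) (S : Finset ℕ) (x : ℕ × ℝ) : Prop :=
  ∃ j ∈ S, x.1 = j + 1 ∧ (1 - δ) * a (j + 1) ≤ x.2

open Classical in
/-- The indices `k ∈ B` whose gluing point `g k` is in the upper part of a segment from `S`. -/
noncomputable def hitSet (a : ℕ → ℝ) (δ : ℝ) (B S : Finset ℕ) (g : ℕ → ℕ × ℝ) : Finset ℕ :=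
  B.filter fun k => InTop a δ S (g k)

/-- The indices of the `i`-th of the consecutive blocks of length `m` starting at `s`. -/
def block (s m i : ℕ) : Finset ℕ := Finset.Ico (s + i * m) (s + (i + 1) * m)

/-- The indices in the `i`-th block that end a chain of segments, one from each of the blocks up
to this one, each glued on the upper part of the preceding one. -/
noncomputable def chainSet (a : ℕ → ℝ) (δ : ℝ) (s m : ℕ) (g : ℕ → ℕ × ℝ) : ℕ → Finset ℕ
  | 0 => block s m 0
  | i + 1 => hitSet a δ (block s m (i + 1)) (chainSet a δ s m g i) g

lemma hitSet_subset (a : ℕ → ℝ) (δ : ℝ) (B S : Finset ℕ) (g : ℕ → ℕ × ℝ) :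
    hitSet a δ B S g ⊆ B := by
  classical
  exact Finset.filter_subset _ _

lemma mem_hitSet {a : ℕ → ℝ} {δ : ℝ} {B S : Finset ℕ} {g : ℕ → ℕ × ℝ} {k : ℕ} :
    k ∈ hitSet a δ B S g ↔ k ∈ B ∧ InTop a δ S (g k) := by
  classical
  unfold hitSet
  exact Finset.mem_filter

lemma chainSet_subset_block (a : ℕ → ℝ) (δ : ℝ) (s m : ℕ) (g : ℕ → ℕ × ℝ) (i : ℕ) :
    chainSet a δ s m g i ⊆ block s m i := by
  cases i with
  | zero => exact subset_rfl
  | succ i => exact hitSet_subset _ _ _ _ _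

lemma measurableSet_inTop (a : ℕ → ℝ) (δ : ℝ) (S : Finset ℕ) :
    MeasurableSet {x | InTop a δ S x} := by
  have : {x | InTop a δ S x} =
      ⋃ j ∈ S, ({j + 1} : Set ℕ) ×ˢ Set.Ici ((1 - δ) * a (j + 1)) := by
    ext x
    simp only [InTop, Set.mem_ofPred_eq, Set.mem_iUnion, Set.mem_prod, Set.mem_singleton_iff,
      Set.mem_Ici, exists_prop]
  rw [this]
  exact Finset.measurableSet_biUnion _ fun j _ => (measurableSet_singleton _).prod measurableSet_Ici

lemma measurableSet_hitSet_eq (a : ℕ → ℝ) (δ : ℝ) (B S T : Finset ℕ) :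
    MeasurableSet {g | hitSet a δ B S g = T} := by
  have : {g | hitSet a δ B S g = T} =
      ⋂ k : ℕ, {g : ℕ → ℕ × ℝ | (k ∈ B ∧ InTop a δ S (g k)) ↔ k ∈ T} := by
    ext g
    simp only [Set.mem_iInter, Set.mem_ofPred_eq, Finset.ext_iff, mem_hitSet]
  rw [this]
  refine MeasurableSet.iInter fun k => ?_
  have hm : MeasurableSet {g : ℕ → ℕ × ℝ | InTop a δ S (g k)} :=
    (measurable_pi_apply (X := fun _ => ℕ × ℝ) k) (measurableSet_inTop a δ S)
  by_cases hT : k ∈ T <;> by_cases hB : k ∈ B <;> simp only [hT, hB, true_and, false_and, iff_true,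
    iff_false]
  · exact hm
  · exact MeasurableSet.const _
  · exact hm.compl
  · exact MeasurableSet.const _

lemma measurableSet_chainSet_eq (a : ℕ → ℝ) (δ : ℝ) (s m i : ℕ) (T : Finset ℕ) :
    MeasurableSet {g | chainSet a δ s m g i = T} := by
  induction i generalizing T with
  | zero =>
    simp only [chainSet]
    exact MeasurableSet.const _
  | succ i ih =>
    -- There are countably many finite sets of indices, so one may split over the value of the
    -- previous chain set.
    have : {g | chainSet a δ s m g (i + 1) = T} = ⋃ S : Finset ℕ,
        {g | chainSet a δ s m g i = S} ∩ {g | hitSet a δ (block s m (i + 1)) S g = T} := by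
      ext g
      simp [chainSet]
    rw [this]
    exact MeasurableSet.iUnion fun S => (ih S).inter (measurableSet_hitSet_eq a δ _ S T)

/-- The chains up to block i read no gluing point beyond that block, so the gluing points of the
next block are fresh. -/
lemma chainSet_congr {a : ℕ → ℝ} {δ : ℝ} {s m i : ℕ} (hs : 1 ≤ s) {g g' : ℕ → ℕ × ℝ}
    (h : ∀ k ∈ Finset.Ico 1 (s + (i + 1) * m), g k = g' k) :
    chainSet a δ s m g i = chainSet a δ s m g' i := by
  induction i with
  | zero => rfl
  | succ i ih =>
    have hle : s + (i + 1) * m ≤ s + (i + 1 + 1) * m := by gcongr; omega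
    simp only [chainSet]
    rw [ih fun k hk => h k (Finset.mem_Ico.2 ⟨(Finset.mem_Ico.1 hk).1,
      (Finset.mem_Ico.1 hk).2.trans_le hle⟩)]
    ext k
    simp only [mem_hitSet]
    refine and_congr_right fun hk => ?_
    rw [h k (Finset.mem_Ico.2 ⟨?_, (Finset.mem_Ico.1 hk).2⟩)]
    have := (Finset.mem_Ico.1 hk).1
    omega

/-- Each link climbs at least (1 - δ)c along the preceding segment. An index k in a chain stands for
the segment b (k+1), whose gluing point is g k; hence the shifts by one. -/
lemma le_baseHeight_of_mem_chainSet {a : ℕ → ℝ} {δ c : ℝ} {s m : ℕ} (hs : 1 ≤ s) (hδ : δ ≤ 1)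
    {g : ℕ → ℕ × ℝ} (hg : ∀ k : ℕ, 1 ≤ k → g k ∈ treePoints a k) {i : ℕ}
    (hca : ∀ j ∈ Finset.Ico s (s + i * m), c ≤ a (j + 1)) {k : ℕ}
    (hk : k ∈ chainSet a δ s m g i) (h0 : ∀ j, 1 ≤ j → 0 ≤ baseHeight g j) :
    i * ((1 - δ) * c) ≤ baseHeight g (k + 1) := by
  induction i generalizing k with
  | zero => simpa using h0 (k + 1) (by omega)
  | succ i ih =>
    obtain ⟨hkB, j, hj, hj1, hj2⟩ := mem_hitSet.1 hk
    have hjB := Finset.mem_Ico.1 (chainSet_subset_block _ _ _ _ _ _ hj)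
    have hkB' := Finset.mem_Ico.1 hkB
    have hk1 : 1 ≤ k := hs.trans (by omega)
    have h1 := ih (fun l hl => hca l (Finset.mem_Ico.2 ⟨(Finset.mem_Ico.1 hl).1,
      (Finset.mem_Ico.1 hl).2.trans_le (by gcongr; omega)⟩)) hj
    rw [baseHeight_succ g hk1, treeDist_root_of_mem g (hg k hk1), hj1]
    have h2 := hca j (Finset.mem_Ico.2 ⟨by omega, hjB.2⟩)
    have h3 : (1 - δ) * c ≤ (1 - δ) * a (j + 1) :=
      mul_le_mul_of_nonneg_left h2 (by linarith)
    push_cast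
    linarith

open Classical in
/-- The weight `exp (-1)` of the points in the upper parts of the segments from `S`. -/
noncomputable def topWeight (a : ℕ → ℝ) (δ : ℝ) (S : Finset ℕ) (x : ℕ × ℝ) : ℝ :=
  if InTop a δ S x then Real.exp (-1) else 1

lemma measurable_topWeight (a : ℕ → ℝ) (δ : ℝ) (S : Finset ℕ) : Measurable (topWeight a δ S) := by
  classical
  unfold topWeight
  exact Measurable.ite (measurableSet_inTop a δ S) measurable_const measurable_const

lemma topWeight_mem_Icc (a : ℕ → ℝ) (δ : ℝ) (S : Finset ℕ) (x : ℕ × ℝ) :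
    topWeight a δ S x ∈ Set.Icc 0 1 := by
  unfold topWeight
  split_ifs
  · exact ⟨(Real.exp_pos _).le, Real.exp_le_one_iff.2 (by norm_num)⟩
  · exact ⟨zero_le_one, le_rfl⟩

/-- The weights turn the number of hits into a product over gluing points, as required for a
lower-tail exponential bound. -/
lemma prod_topWeight (a : ℕ → ℝ) (δ : ℝ) (B S : Finset ℕ) (g : ℕ → ℕ × ℝ) :
    ∏ k ∈ B, topWeight a δ S (g k) = Real.exp (-((hitSet a δ B S g).card : ℝ)) := by
  classical
  unfold topWeight hitSet
  rw [Finset.prod_ite, Finset.prod_const, Finset.prod_const_one, mul_one, ← Real.exp_nat_mul]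
  congr 1
  rw [mul_neg_one]

section Lower

variable {Ω : Type*} [MeasurableSpace Ω] {P : Measure Ω} {a : ℕ → ℝ} {α : ℝ} {Y : ℕ → Ω → ℕ × ℝ}

lemma setIntegral_topWeight_le {δ : ℝ} (hδ0 : 0 ≤ δ) (hδ1 : δ ≤ 1) {S : Finset ℕ} {i : ℕ}
    (hi : 0 < a i) :
    ∫ s in Set.Icc 0 (a i), topWeight a δ S (i, s) ≤
      a i - if i ∈ S.image (· + 1) then 3 / 5 * (δ * a i) else 0 := by
  have hI : IntegrableOn (fun _ : ℝ => (1 : ℝ)) (Set.Icc 0 (a i)) := by simp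
  have hvol : ∫ _ in Set.Icc 0 (a i), (1 : ℝ) = a i := by
    simp [hi.le]
  split_ifs with h
  · obtain ⟨j, hj, rfl⟩ := Finset.mem_image.1 h
    set c := (1 - δ) * a (j + 1) with hc
    have hc0 : 0 ≤ c := mul_nonneg (by linarith) hi.le
    have hind : IntegrableOn (fun s : ℝ => (Set.Ici c).indicator (fun _ => (3 / 5 : ℝ)) s)
        (Set.Icc 0 (a (j + 1))) := by
      refine Integrable.indicator ?_ measurableSet_Ici
      simp
    -- 3/5 is a rational lower bound for 1 - 1/e.
    have h35 : Real.exp (-1) ≤ 1 - 3 / 5 := by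
      rw [Real.exp_neg, inv_le_comm₀ (Real.exp_pos 1) (by norm_num)]
      linarith [Real.exp_one_gt_d9]
    calc ∫ s in Set.Icc 0 (a (j + 1)), topWeight a δ S (j + 1, s)
        ≤ ∫ s in Set.Icc 0 (a (j + 1)), (1 - (Set.Ici c).indicator (fun _ => (3 / 5 : ℝ)) s) := by
          refine integral_mono_of_nonneg
            (Eventually.of_forall fun s => (topWeight_mem_Icc a δ S _).1) (hI.sub hind)
            (Eventually.of_forall fun s => ?_)
          by_cases hs : c ≤ s
          · have h1 : InTop a δ S (j + 1, s) := ⟨j, hj, rfl, hs⟩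
            simp only [topWeight, h1, if_true]
            rw [Set.indicator_of_mem (show s ∈ Set.Ici c from hs)]
            exact h35
          · simp only
            rw [Set.indicator_of_notMem (show s ∉ Set.Ici c from hs), sub_zero]
            exact (topWeight_mem_Icc a δ S _).2
      _ = a (j + 1) - 3 / 5 * (δ * a (j + 1)) := by
          rw [integral_sub hI hind, hvol, setIntegral_indicator measurableSet_Ici]
          have hset : Set.Icc 0 (a (j + 1)) ∩ Set.Ici c = Set.Icc c (a (j + 1)) := by
            ext x
            simp only [Set.mem_inter_iff, Set.mem_Icc, Set.mem_Ici]
            constructor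
            · rintro ⟨⟨_, h2⟩, h3⟩
              exact ⟨h3, h2⟩
            · rintro ⟨h2, h3⟩
              exact ⟨⟨hc0.trans h2, h3⟩, h2⟩
          have hca : 0 ≤ a (j + 1) - c := by rw [hc]; nlinarith
          rw [hset, setIntegral_const, Real.volume_real_Icc, max_eq_left hca, smul_eq_mul, hc]
          ring
  · rw [sub_zero]
    calc ∫ s in Set.Icc 0 (a i), topWeight a δ S (i, s) ≤ ∫ _ in Set.Icc 0 (a i), (1 : ℝ) :=
          integral_mono_of_nonneg (Eventually.of_forall fun s => (topWeight_mem_Icc a δ S _).1) hI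
            (Eventually.of_forall fun s => (topWeight_mem_Icc a δ S _).2)
      _ = a i := hvol

/-- `q` bounds from below the probability of hitting the top of one given segment of `S`. The tops
together lower the mean weight to at most 1 - (3/5) q |S|, and 1 - x ≤ e^(-x). -/
lemma integral_topWeight_le (ha : ∀ n : ℕ, 1 ≤ n → 0 < a n) {k : ℕ} {Z : Ω → ℕ × ℝ}
    (hZ : IsUniformPoint P a Y k Z) (hk : 1 ≤ k) {δ q : ℝ} (hδ0 : 0 ≤ δ) (hδ1 : δ ≤ 1)
    {S : Finset ℕ} (hSk : ∀ j ∈ S, j < k)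
    (hq : ∀ j ∈ S, q * totalLength a k ≤ δ * a (j + 1)) :
    ∫ ω, topWeight a δ S (Z ω) ∂P ≤ Real.exp (-(3 / 5 * (q * S.card))) := by
  have hA := totalLength_pos ha hk
  have hw := measurable_topWeight a δ S
  have hsub : S.image (· + 1) ⊆ Finset.Icc 1 k := by
    intro i hi
    obtain ⟨j, hj, rfl⟩ := Finset.mem_image.1 hi
    have := hSk j hj
    exact Finset.mem_Icc.2 ⟨by omega, by omega⟩
  rw [← integral_map (f := topWeight a δ S) hZ.1.aemeasurable hw.aestronglyMeasurable, hZ.2.1,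
    integral_uniformMeasure ha hw]
  · have h1 : ∑ i ∈ Finset.Icc 1 k, ∫ s in Set.Icc 0 (a i), topWeight a δ S (i, s) ≤
        totalLength a k - 3 / 5 * (q * totalLength a k * S.card) := by
      calc _ ≤ ∑ i ∈ Finset.Icc 1 k,
            (a i - if i ∈ S.image (· + 1) then 3 / 5 * (δ * a i) else 0) :=
            Finset.sum_le_sum fun i hi =>
              setIntegral_topWeight_le hδ0 hδ1 (ha i (Finset.mem_Icc.1 hi).1)
        _ = totalLength a k - ∑ i ∈ S.image (· + 1), 3 / 5 * (δ * a i) := by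
            rw [Finset.sum_sub_distrib, Finset.sum_ite_mem, Finset.inter_eq_right.2 hsub]
            rfl
        _ ≤ totalLength a k - 3 / 5 * (q * totalLength a k * S.card) := by
            have h2 : q * totalLength a k * S.card ≤ ∑ j ∈ S, δ * a (j + 1) := by
              rw [mul_comm, ← nsmul_eq_mul]
              exact Finset.card_nsmul_le_sum _ _ _ hq
            rw [Finset.sum_image (fun x _ y _ h => by simpa using h), ← Finset.mul_sum]
            linarith
    calc (totalLength a k)⁻¹ * ∑ i ∈ Finset.Icc 1 k, ∫ s in Set.Icc 0 (a i), topWeight a δ S (i, s)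
        ≤ (totalLength a k)⁻¹ * (totalLength a k - 3 / 5 * (q * totalLength a k * S.card)) := by
          gcongr
      _ = -(3 / 5 * (q * S.card)) + 1 := by field_simp; ring
      _ ≤ _ := Real.add_one_le_exp _
  · intro i _
    refine Measure.integrableOn_of_bounded (M := 1) (by simp)
      (hw.comp measurable_prodMk_left).aestronglyMeasurable (Eventually.of_forall fun s => ?_)
    rw [Real.norm_of_nonneg (topWeight_mem_Icc a δ S _).1]
    exact (topWeight_mem_Icc a δ S _).2

/-- The last gluing point is independent of all earlier ones, so the factors are peeled off one at a
time. -/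
lemma integral_mul_prod_topWeight_le (hY : IsGluingSequence P a Y) {F : (ℕ → ℕ × ℝ) → ℝ}
    (hFm : Measurable F) (hF0 : ∀ g, 0 ≤ F g) {u v : ℕ} (hu : 1 ≤ u) (huv : u ≤ v)
    (hF : ∀ g g' : ℕ → ℕ × ℝ, (∀ k ∈ Finset.Ico 1 u, g k = g' k) → F g = F g')
    {δ β : ℝ} {S : Finset ℕ}
    (hβ : ∀ k ∈ Finset.Ico u v, ∫ ω, topWeight a δ S (Y k ω) ∂P ≤ β) :
    ∫ ω, F (fun k => Y k ω) * ∏ k ∈ Finset.Ico u v, topWeight a δ S (Y k ω) ∂P ≤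
      (∫ ω, F (fun k => Y k ω) ∂P) * β ^ (v - u) := by
  induction v, huv using Nat.le_induction with
  | base => simp
  | succ v huv ih =>
    have h1 := ih fun k hk => hβ k (Finset.mem_Ico.2 ⟨(Finset.mem_Ico.1 hk).1, by
      have := (Finset.mem_Ico.1 hk).2; omega⟩)
    have hGm : Measurable fun g : ℕ → ℕ × ℝ =>
        F g * ∏ k ∈ Finset.Ico u v, topWeight a δ S (g k) :=
      hFm.mul (Finset.measurable_prod _ fun k _ =>
        (measurable_topWeight a δ S).comp (measurable_pi_apply k))
    have hG : ∀ g g' : ℕ → ℕ × ℝ, (∀ k ∈ Finset.Ico 1 v, g k = g' k) →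
        F g * ∏ k ∈ Finset.Ico u v, topWeight a δ S (g k) =
          F g' * ∏ k ∈ Finset.Ico u v, topWeight a δ S (g' k) := by
      intro g g' h
      rw [hF g g' fun k hk => h k (Finset.Ico_subset_Ico_right huv hk)]
      congr 1
      exact Finset.prod_congr rfl fun k hk => by rw [h k (Finset.Ico_subset_Ico_left hu hk)]
    have hv : 1 ≤ v := hu.trans huv
    have hind := ((hY v hv).indepFun_past (measurable_topWeight a δ S) hGm hG).symm
    have h2 : ∀ ω, F (fun k => Y k ω) * ∏ k ∈ Finset.Ico u (v + 1), topWeight a δ S (Y k ω) =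
        (F (fun k => Y k ω) * ∏ k ∈ Finset.Ico u v, topWeight a δ S (Y k ω)) *
          topWeight a δ S (Y v ω) := fun ω => by
      rw [Finset.prod_Ico_succ_top huv, mul_assoc]
    simp_rw [h2]
    rw [hind.integral_fun_mul_eq_mul_integral
      (measurable_comp_past hY hGm hG).aestronglyMeasurable
      ((measurable_topWeight a δ S).comp (hY.measurable hv)).aestronglyMeasurable,
      Nat.succ_sub huv, pow_succ, ← mul_assoc]
    have h3 := hβ v (Finset.mem_Ico.2 ⟨huv, by omega⟩)
    have h4 : 0 ≤ ∫ ω, topWeight a δ S (Y v ω) ∂P :=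
      integral_nonneg fun ω => (topWeight_mem_Icc a δ S _).1
    have h5 : 0 ≤ ∫ ω, F (fun k => Y k ω) ∂P := integral_nonneg fun ω => hF0 _
    have h6 : 0 ≤ ∫ ω, F (fun k => Y k ω) * ∏ k ∈ Finset.Ico u v, topWeight a δ S (Y k ω) ∂P :=
      integral_nonneg fun ω => mul_nonneg (hF0 _)
        (Finset.prod_nonneg fun k _ => (topWeight_mem_Icc a δ S _).1)
    exact mul_le_mul h1 h3 h4 (h6.trans h1)

end Lower

section Lower

variable {Ω : Type*} [MeasurableSpace Ω] {P : Measure Ω} [IsProbabilityMeasure P] {a : ℕ → ℝ}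
  {α : ℝ} {Y : ℕ → Ω → ℕ × ℝ}

/-- Freezing the previous chain set at a deterministic `S` makes the hits in the next block
independent of that event; Markov's inequality for exp(-number of hits) concludes. -/
lemma measureReal_chainSet_eq_and_hitSet_lt_le (ha : ∀ n : ℕ, 1 ≤ n → 0 < a n)
    (hY : IsGluingSequence P a Y) {s m i : ℕ} (hs : 1 ≤ s) {δ q : ℝ} (hδ0 : 0 ≤ δ) (hδ1 : δ ≤ 1)
    (hq : ∀ j k : ℕ, s ≤ j → j < k → k < s + (i + 2) * m → q * totalLength a k ≤ δ * a (j + 1))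
    {S : Finset ℕ} (hS : S ⊆ block s m i) (x : ℝ) :
    P.real {ω | chainSet a δ s m (fun k => Y k ω) i = S ∧
        ((hitSet a δ (block s m (i + 1)) S fun k => Y k ω).card : ℝ) < x} ≤
      Real.exp (x - 3 / 5 * (q * S.card) * m) *
        ∫ ω, (if chainSet a δ s m (fun k => Y k ω) i = S then (1 : ℝ) else 0) ∂P := by
  set F : (ℕ → ℕ × ℝ) → ℝ := fun g => if chainSet a δ s m g i = S then 1 else 0 with hFdef
  have hFm : Measurable F :=
    Measurable.ite (measurableSet_chainSet_eq a δ s m i S) measurable_const measurable_const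
  have hF0 : ∀ g, 0 ≤ F g := fun g => by simp only [hFdef]; split_ifs <;> norm_num
  have hF1 : ∀ g, F g ≤ 1 := fun g => by simp only [hFdef]; split_ifs <;> norm_num
  have hF : ∀ g g' : ℕ → ℕ × ℝ, (∀ k ∈ Finset.Ico 1 (s + (i + 1) * m), g k = g' k) →
      F g = F g' := by
    intro g g' h
    simp only [hFdef, chainSet_congr hs h]
  have hblock : block s m (i + 1) = Finset.Ico (s + (i + 1) * m) (s + (i + 2) * m) := rfl
  have huv : s + (i + 1) * m ≤ s + (i + 2) * m := by gcongr; omega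
  have hlen : s + (i + 2) * m - (s + (i + 1) * m) = m := by
    rw [show s + (i + 2) * m = s + (i + 1) * m + m by ring]; omega
  have hβ : ∀ k ∈ Finset.Ico (s + (i + 1) * m) (s + (i + 2) * m),
      ∫ ω, topWeight a δ S (Y k ω) ∂P ≤ Real.exp (-(3 / 5 * (q * S.card))) := by
    intro k hk
    obtain ⟨hk1, hk2⟩ := Finset.mem_Ico.1 hk
    have hk0 : 1 ≤ k := hs.trans (by omega)
    refine integral_topWeight_le ha (hY k hk0) hk0 hδ0 hδ1 (fun j hj => ?_) fun j hj => ?_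
    · exact (Finset.mem_Ico.1 (hS hj)).2.trans_le hk1
    · have := Finset.mem_Ico.1 (hS hj)
      exact hq j k (by omega) (this.2.trans_le hk1) hk2
  have h1 := integral_mul_prod_topWeight_le hY hFm hF0 (by omega) huv hF hβ
  rw [hlen, ← Real.exp_nat_mul] at h1
  set f : Ω → ℝ := fun ω => F (fun k => Y k ω) *
    ∏ k ∈ Finset.Ico (s + (i + 1) * m) (s + (i + 2) * m), topWeight a δ S (Y k ω) with hfdef
  have hprod01 : ∀ ω, (∏ k ∈ Finset.Ico (s + (i + 1) * m) (s + (i + 2) * m),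
      topWeight a δ S (Y k ω)) ∈ Set.Icc (0 : ℝ) 1 := fun ω =>
    ⟨Finset.prod_nonneg fun k _ => (topWeight_mem_Icc a δ S _).1,
      Finset.prod_le_one (fun k _ => (topWeight_mem_Icc a δ S _).1)
        fun k _ => (topWeight_mem_Icc a δ S _).2⟩
  have hf0 : ∀ ω, 0 ≤ f ω := fun ω => mul_nonneg (hF0 _) (hprod01 ω).1
  have hfm : Measurable f := (measurable_comp_past hY hFm hF).mul
    (Finset.measurable_prod _ fun k hk => (measurable_topWeight a δ S).comp
      (hY.measurable (hs.trans (by have := (Finset.mem_Ico.1 hk).1; omega))))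
  have hfi : Integrable f P := by
    refine Integrable.of_bound hfm.aestronglyMeasurable 1 (Eventually.of_forall fun ω => ?_)
    rw [Real.norm_of_nonneg (hf0 ω)]
    exact mul_le_one₀ (hF1 _) (hprod01 ω).1 (hprod01 ω).2
  have h2 := mul_meas_ge_le_integral_of_nonneg (Eventually.of_forall hf0) hfi (Real.exp (-x))
  have hsub : {ω | chainSet a δ s m (fun k => Y k ω) i = S ∧
        ((hitSet a δ (block s m (i + 1)) S fun k => Y k ω).card : ℝ) < x} ⊆
      {ω | Real.exp (-x) ≤ f ω} := by
    rintro ω ⟨hω1, hω2⟩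
    simp only [Set.mem_ofPred_eq, hfdef, hFdef, hω1, if_true, one_mul]
    rw [← hblock, prod_topWeight a δ _ S fun k => Y k ω]
    exact Real.exp_le_exp.2 (by linarith)
  have h3 := measureReal_mono (μ := P) hsub
  have h4 : P.real {ω | Real.exp (-x) ≤ f ω} ≤ Real.exp x * ∫ ω, f ω ∂P := by
    have h5 := mul_le_mul_of_nonneg_left h2 (Real.exp_pos x).le
    rwa [← mul_assoc, ← Real.exp_add, add_neg_cancel, Real.exp_zero, one_mul] at h5
  calc _ ≤ Real.exp x * ∫ ω, f ω ∂P := h3.trans h4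
    _ ≤ Real.exp x * ((∫ ω, F (fun k => Y k ω) ∂P) *
          Real.exp (m * -(3 / 5 * (q * S.card)))) := by gcongr
    _ = _ := by
        rw [mul_comm (∫ ω, F (fun k => Y k ω) ∂P), ← mul_assoc, ← Real.exp_add]
        congr 2
        ring

/-- With |S| ≥ t the expected number of hits is bounded below by t q m = 2x. Asking for only x of
them leaves the exponent x - (3/5)(2x) = -x/5. The events for different `S` are disjoint, so the sum
over `S` costs nothing. -/
lemma measureReal_chainSet_step_le (ha : ∀ n : ℕ, 1 ≤ n → 0 < a n)
    (hY : IsGluingSequence P a Y) {s m i : ℕ} (hs : 1 ≤ s) {δ q : ℝ} (hδ0 : 0 ≤ δ) (hδ1 : δ ≤ 1)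
    (hq0 : 0 ≤ q)
    (hq : ∀ j k : ℕ, s ≤ j → j < k → k < s + (i + 2) * m → q * totalLength a k ≤ δ * a (j + 1))
    (t : ℝ) :
    P.real {ω | t ≤ ((chainSet a δ s m (fun k => Y k ω) i).card : ℝ) ∧
        ((chainSet a δ s m (fun k => Y k ω) (i + 1)).card : ℝ) < t * (q * m / 2)} ≤
      Real.exp (-(t * (q * m / 2) / 5)) := by
  set x := t * (q * m / 2) with hx
  set 𝒮 := (block s m i).powerset.filter fun S => t ≤ (S.card : ℝ) with h𝒮
  have hsub : {ω | t ≤ ((chainSet a δ s m (fun k => Y k ω) i).card : ℝ) ∧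
        ((chainSet a δ s m (fun k => Y k ω) (i + 1)).card : ℝ) < x} ⊆
      ⋃ S ∈ 𝒮, {ω | chainSet a δ s m (fun k => Y k ω) i = S ∧
        ((hitSet a δ (block s m (i + 1)) S fun k => Y k ω).card : ℝ) < x} := by
    rintro ω ⟨h1, h2⟩
    refine Set.mem_iUnion₂.2 ⟨chainSet a δ s m (fun k => Y k ω) i, ?_, rfl, h2⟩
    exact Finset.mem_filter.2 ⟨Finset.mem_powerset.2 (chainSet_subset_block _ _ _ _ _ _), h1⟩
  have hint : ∀ S : Finset ℕ, Integrable (fun ω =>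
      if chainSet a δ s m (fun k => Y k ω) i = S then (1 : ℝ) else 0) P := by
    intro S
    refine Integrable.of_bound (measurable_comp_past hY (n := s + (i + 1) * m)
      (F := fun g => if chainSet a δ s m g i = S then (1 : ℝ) else 0)
      (Measurable.ite (measurableSet_chainSet_eq a δ s m i S) measurable_const measurable_const)
      fun g g' h => by rw [chainSet_congr hs h]).aestronglyMeasurable 1
      (Eventually.of_forall fun ω => ?_)
    split_ifs <;> simp
  have hone : ∑ S ∈ 𝒮, ∫ ω, (if chainSet a δ s m (fun k => Y k ω) i = S then (1 : ℝ) else 0) ∂P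
      ≤ 1 := by
    rw [← integral_finsetSum _ fun S _ => hint S]
    calc _ ≤ ∫ _, (1 : ℝ) ∂P := by
          refine integral_mono (integrable_finsetSum _ fun S _ => hint S) (integrable_const _)
            fun ω => ?_
          simp only [Finset.sum_ite_eq]
          split_ifs <;> norm_num
      _ = 1 := by simp
  calc _ ≤ ∑ S ∈ 𝒮, P.real {ω | chainSet a δ s m (fun k => Y k ω) i = S ∧
          ((hitSet a δ (block s m (i + 1)) S fun k => Y k ω).card : ℝ) < x} :=
        (measureReal_mono hsub (measure_ne_top P _)).trans (measureReal_biUnion_finset_le _ _)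
    _ ≤ ∑ S ∈ 𝒮, Real.exp (-(x / 5)) *
          ∫ ω, (if chainSet a δ s m (fun k => Y k ω) i = S then (1 : ℝ) else 0) ∂P := by
        refine Finset.sum_le_sum fun S hS => ?_
        obtain ⟨hS1, hS2⟩ := Finset.mem_filter.1 hS
        refine (measureReal_chainSet_eq_and_hitSet_lt_le ha hY hs hδ0 hδ1 hq
          (Finset.mem_powerset.1 hS1) x).trans ?_
        refine mul_le_mul_of_nonneg_right (Real.exp_le_exp.2 ?_)
          (integral_nonneg fun ω => by simp only [Pi.zero_apply]; split_ifs <;> norm_num)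
        have h3 : t * (q * m) ≤ S.card * (q * m) := by gcongr
        rw [hx]
        linarith
    _ ≤ Real.exp (-(x / 5)) := by
        rw [← Finset.mul_sum]
        exact mul_le_of_le_one_right (Real.exp_pos _).le hone

/-- A union bound over the blocks. The thresholds decrease because q m / 2 ≤ 1, so the last one
gives the worst failure probability. -/
lemma measureReal_chainSet_lt_le (ha : ∀ n : ℕ, 1 ≤ n → 0 < a n)
    (hY : IsGluingSequence P a Y) {s m i : ℕ} (hs : 1 ≤ s) {δ q : ℝ} (hδ0 : 0 ≤ δ) (hδ1 : δ ≤ 1)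
    (hq0 : 0 ≤ q) (hqm : q * m / 2 ≤ 1)
    (hq : ∀ j k : ℕ, s ≤ j → j < k → k < s + (i + 1) * m → q * totalLength a k ≤ δ * a (j + 1)) :
    P.real {ω | ((chainSet a δ s m (fun k => Y k ω) i).card : ℝ) < m * (q * m / 2) ^ i} ≤
      i * Real.exp (-(m * (q * m / 2) ^ i / 5)) := by
  induction i with
  | zero => simp [chainSet, block]
  | succ i ih =>
    have h1 := ih fun j k hj hjk hk => hq j k hj hjk (hk.trans_le (by gcongr; omega))
    have h2 := measureReal_chainSet_step_le ha hY hs hδ0 hδ1 hq0 hq (m * (q * m / 2) ^ i)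
    have hρ0 : 0 ≤ q * m / 2 := by positivity
    have hsub : {ω | ((chainSet a δ s m (fun k => Y k ω) (i + 1)).card : ℝ) <
          m * (q * m / 2) ^ (i + 1)} ⊆
        {ω | ((chainSet a δ s m (fun k => Y k ω) i).card : ℝ) < m * (q * m / 2) ^ i} ∪
        {ω | m * (q * m / 2) ^ i ≤ ((chainSet a δ s m (fun k => Y k ω) i).card : ℝ) ∧
          ((chainSet a δ s m (fun k => Y k ω) (i + 1)).card : ℝ) <
            m * (q * m / 2) ^ i * (q * m / 2)} := by
      intro ω hω
      rcases lt_or_ge ((chainSet a δ s m (fun k => Y k ω) i).card : ℝ) (m * (q * m / 2) ^ i)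
        with h | h
      · exact Or.inl h
      · refine Or.inr ⟨h, ?_⟩
        rw [mul_assoc, ← pow_succ]
        exact hω
    have h3 : (m : ℝ) * (q * m / 2) ^ (i + 1) ≤ m * (q * m / 2) ^ i := by
      gcongr 1
      exact pow_le_pow_of_le_one hρ0 hqm (by omega)
    calc _ ≤ i * Real.exp (-(m * (q * m / 2) ^ i / 5)) +
          Real.exp (-(m * (q * m / 2) ^ i * (q * m / 2) / 5)) :=
          (measureReal_mono hsub).trans ((measureReal_union_le _ _).trans (add_le_add h1 h2))
      _ ≤ i * Real.exp (-(m * (q * m / 2) ^ (i + 1) / 5)) +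
          Real.exp (-(m * (q * m / 2) ^ (i + 1) / 5)) := by
          refine add_le_add (mul_le_mul_of_nonneg_left (Real.exp_le_exp.2 (by linarith))
            (Nat.cast_nonneg i)) (le_of_eq ?_)
          rw [pow_succ, mul_assoc]
      _ = _ := by push_cast; ring

end Lower

/-- The right side is at least n (κ/(L+1))^(L+1). Its logarithm is x - (L+1)(log(L+1) + log(1/κ)).
Since L + 1 ≤ (1 - η/2) x / log x and log(L+1) ≤ log x, the loss is at most (1 - η/2)(1 + η/4) x,
leaving at least (η/4) x. -/
lemma rpow_le_mul_pow {x y κ η f : ℝ} {n L m : ℕ} {δ : ℝ} (hn : (0 : ℝ) < n) (hx : x = Real.log n)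
    (hy : y = Real.log x) (hx0 : 0 < x) (hy1 : 1 ≤ y) (hf : f = x / y) (hη0 : 0 < η)
    (hδ0 : 0 < δ) (hδ1 : δ ≤ 1) (hκ : κ = δ ^ 2 / 16) (hL : (L : ℝ) + 1 ≤ (1 - η / 2) * f)
    (hK : Real.log (1 / κ) ≤ η / 4 * y) (hm : δ * n / (2 * (L + 1)) ≤ m) :
    (n : ℝ) ^ (η / 4) ≤ m * (δ / (4 * n) * m / 2) ^ L := by
  have hκ0 : 0 < κ := by rw [hκ]; positivity
  have hL0 : (0 : ℝ) < L + 1 := by positivity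
  have hfx : f * y = x := by rw [hf]; field_simp
  have hf0 : 0 < f := by rw [hf]; positivity
  have hη1 : 0 ≤ 1 - η / 2 := by
    by_contra hcon
    nlinarith
  have hLx : (L : ℝ) + 1 ≤ x := by nlinarith
  have hlogL : Real.log (L + 1) ≤ y := by rw [hy]; exact Real.log_le_log hL0 hLx
  have hlogK : 0 ≤ Real.log (1 / κ) := by
    refine Real.log_nonneg ((one_le_div hκ0).2 ?_)
    rw [hκ]
    nlinarith
  have hρ : κ / (L + 1) ≤ δ / (4 * n) * m / 2 := by
    calc κ / (L + 1) = δ / (4 * n) * (δ * n / (2 * (L + 1))) / 2 := by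
          rw [hκ]; field_simp; norm_num
      _ ≤ _ := by gcongr
  have hm2 : n * (κ / (L + 1)) ≤ m := by
    refine le_trans ?_ hm
    rw [mul_div_assoc', div_le_div_iff₀ hL0 (by positivity), hκ]
    have h1 : δ ^ 2 / 16 ≤ δ / 2 := by nlinarith
    have h2 : 0 ≤ (n : ℝ) * (L + 1) := by positivity
    nlinarith
  have hlog : Real.log (κ / (L + 1)) = -(Real.log (L + 1) + Real.log (1 / κ)) := by
    rw [Real.log_div hκ0.ne' hL0.ne', one_div, Real.log_inv]; ring
  have hr0 : 0 < κ / (L + 1) := by positivity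
  have hprod : ((L : ℝ) + 1) * (Real.log (L + 1) + Real.log (1 / κ)) ≤ (1 - η / 4) * x := by
    calc ((L : ℝ) + 1) * (Real.log (L + 1) + Real.log (1 / κ))
        ≤ (L + 1) * (y + η / 4 * y) := by gcongr
      _ ≤ (1 - η / 2) * f * (y + η / 4 * y) := by
          refine mul_le_mul_of_nonneg_right hL ?_
          positivity
      _ = (1 - η / 2) * (1 + η / 4) * x := by rw [← hfx]; ring
      _ ≤ (1 - η / 4) * x := by
          refine mul_le_mul_of_nonneg_right ?_ hx0.le
          nlinarith
  calc (n : ℝ) ^ (η / 4) = Real.exp (x * (η / 4)) := by rw [Real.rpow_def_of_pos hn, ← hx]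
    _ ≤ Real.exp (x + ((L + 1 : ℕ) : ℝ) * Real.log (κ / (L + 1))) := by
        refine Real.exp_le_exp.2 ?_
        rw [hlog]
        push_cast
        linarith
    _ = n * (κ / (L + 1)) ^ (L + 1) := by
        rw [Real.exp_add, hx, Real.exp_log hn, Real.exp_nat_mul, Real.exp_log hr0]
    _ = n * (κ / (L + 1)) * (κ / (L + 1)) ^ L := by rw [pow_succ]; ring
    _ ≤ m * (δ / (4 * n) * m / 2) ^ L := by gcongr

theorem eventually_exists_chain_parameters {a : ℕ → ℝ} {α : ℝ} (ha : ∀ n : ℕ, 1 ≤ n → 0 < a n)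
    (hα : 0 < α) (h : PotterBounds a α) {r : ℝ} (hr0 : 0 < r) (hr1 : r < 1) :
    ∀ᶠ n : ℕ in atTop, ∃ (s m L : ℕ) (δ q c : ℝ), 1 ≤ s ∧ s + (L + 1) * m = n ∧ 0 ≤ δ ∧ δ ≤ 1 ∧
      0 ≤ q ∧ q * m / 2 ≤ 1 ∧
      (∀ j k : ℕ, s ≤ j → j < k → k < n → q * totalLength a k ≤ δ * a (j + 1)) ∧
      (∀ j : ℕ, s ≤ j → j < n → c ≤ a (j + 1)) ∧
      r * (Real.log n / Real.log (Real.log n)) * a n ≤ L * ((1 - δ) * c) ∧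
      0 < m * (q * m / 2) ^ L ∧
      L * Real.exp (-(m * (q * m / 2) ^ L / 5)) ≤ (n : ℝ) ^ (-2 : ℝ) := by
  -- Four factors 1 - η are lost: in the choice of `L`, in its rounding, in 1 - δ, and in comparing
  -- late segments with a_n. Their product is at least 1 - 4η = r.
  set η := (1 - r) / 4 with hη
  have hη0 : 0 < η := by rw [hη]; linarith
  have hη4 : η < 1 / 4 := by rw [hη]; linarith
  obtain ⟨δ₁, hδ₁, hmin⟩ := h.eventually_mul_le ha hα (show 0 < 1 - η by linarith)
    (show 1 - η < 1 by linarith)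
  set δ := min δ₁ η with hδ
  have hδ0 : 0 < δ := lt_min hδ₁ hη0
  have hδη : δ ≤ η := min_le_right _ _
  have hδδ : δ ≤ δ₁ := min_le_left _ _
  have hlogn : ∀ᶠ n : ℕ in atTop, 2 / δ * Real.log n ≤ n := by
    have hb := (Real.isLittleO_log_id_atTop.bound (show 0 < δ / 2 by positivity))
    filter_upwards [tendsto_natCast_atTop_atTop.eventually hb] with n hn
    rw [id, Real.norm_natCast] at hn
    have := (Real.le_norm_self _).trans hn
    calc 2 / δ * Real.log n ≤ 2 / δ * (δ / 2 * n) := by gcongr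
      _ = n := by field_simp
  -- A fifth of the final threshold is then at least 3 log n, so L ≤ n failures of probability at
  -- most n^(-3) total at most n^(-2).
  have hrpow : ∀ᶠ n : ℕ in atTop, 15 * Real.log n ≤ (n : ℝ) ^ (η / 4) := by
    have hb := (isLittleO_log_rpow_atTop (show 0 < η / 4 by positivity)).bound
      (show (0 : ℝ) < 1 / 15 by norm_num)
    filter_upwards [tendsto_natCast_atTop_atTop.eventually hb] with n hn
    rw [Real.norm_of_nonneg (Real.rpow_nonneg (Nat.cast_nonneg n) _)] at hn
    linarith [(Real.le_norm_self _).trans hn]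
  filter_upwards [hmin, h.eventually_le_mul ha hα one_lt_two, hlogn, hrpow,
    eventually_ge_atTop 4, tendsto_log_natCast.eventually_ge_atTop 1,
    tendsto_log_log_natCast.eventually_ge_atTop 1,
    tendsto_log_log_natCast.eventually_ge_atTop (Real.log (1 / (δ ^ 2 / 16)) / (η / 4)),
    eventually_const_mul_log_log_le (2 / η)] with n hmin hmax hlogn hrpow hn4 hx1 hy1 hyK hfη
  set x := Real.log (n : ℝ) with hx
  set y := Real.log x with hy
  set f := x / y with hf
  have hn4' : (4 : ℝ) ≤ n := by exact_mod_cast hn4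
  have hn0 : (0 : ℝ) < n := by linarith
  have han := ha n (by omega)
  have hy0 : 0 < y := by linarith
  have hx0 : 0 < x := by linarith
  have hf2 : 2 / η ≤ f := (le_div_iff₀ hy0).2 hfη
  have hf2' : 2 ≤ η * f := by rw [div_le_iff₀ hη0] at hf2; linarith
  have hf0 : 0 < f := by positivity
  have hfx : f ≤ x := div_le_self hx0.le hy1
  set L := ⌊(1 - η) * f⌋₊ with hL
  have hL1 : (L : ℝ) ≤ (1 - η) * f := Nat.floor_le (mul_nonneg (by linarith) hf0.le)
  have hL2 : (1 - η) * f < L + 1 := Nat.lt_floor_add_one _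
  have hL3 : (L : ℝ) + 1 ≤ (1 - η / 2) * f := by linarith
  have hLx : (L : ℝ) + 1 ≤ x :=
    hL3.trans ((mul_le_of_le_one_left hf0.le (by linarith)).trans hfx)
  have hLpos : (0 : ℝ) < L + 1 := by positivity
  -- The L + 1 blocks of this length fit in the last δn indices, where segments are nearly as long
  -- as a_n.
  set m := ⌊δ * n / (L + 1)⌋₊ with hm
  have hm1 : (m : ℝ) ≤ δ * n / (L + 1) := Nat.floor_le (by positivity)
  have hm2 : δ * n / (L + 1) < m + 1 := Nat.lt_floor_add_one _
  have hδn : 2 * x ≤ δ * n := by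
    rw [div_mul_eq_mul_div, div_le_iff₀ hδ0] at hlogn
    linarith
  have hge2 : 2 ≤ δ * n / (L + 1) := by
    rw [le_div_iff₀ hLpos]
    linarith
  have hm3 : δ * n / (2 * (L + 1)) ≤ m := by
    have : δ * n / (2 * (L + 1)) = δ * n / (L + 1) / 2 := by rw [div_div, mul_comm 2]
    linarith
  have hLm : ((L : ℝ) + 1) * m ≤ δ * n := by
    rw [le_div_iff₀ hLpos] at hm1
    linarith
  have hδn1 : δ * n ≤ n := mul_le_of_le_one_left hn0.le (by linarith)
  have hLmn : (L + 1) * m ≤ n := by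
    have h1 : ((L : ℝ) + 1) * m ≤ n := hLm.trans hδn1
    exact_mod_cast h1
  have hs_cast : ((n - (L + 1) * m : ℕ) : ℝ) = n - (L + 1) * m := by
    rw [Nat.cast_sub hLmn]; push_cast; ring
  have hs1 : (1 - δ) * n ≤ ((n - (L + 1) * m : ℕ) : ℝ) := by rw [hs_cast]; linarith
  have hwin : ∀ j : ℕ, n - (L + 1) * m ≤ j → j < n → (1 - η) * a n ≤ a (j + 1) := by
    intro j hj hjn
    refine hmin (j + 1) ?_ (by omega)
    have h1 : ((n - (L + 1) * m : ℕ) : ℝ) ≤ j := by exact_mod_cast hj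
    have h2 : (1 - δ₁) * n ≤ (1 - δ) * n := mul_le_mul_of_nonneg_right (by linarith) hn0.le
    push_cast
    linarith
  have hmn : (m : ℝ) ≤ n := by
    have h1 : (0 : ℝ) ≤ L * m := by positivity
    linarith
  have hkey : (n : ℝ) ^ (η / 4) ≤ m * (δ / (4 * n) * m / 2) ^ L := by
    refine rpow_le_mul_pow hn0 hx hy hx0 hy1 hf hη0 hδ0 (by linarith) rfl hL3 ?_ hm3
    rw [div_le_iff₀ (by positivity)] at hyK
    linarith
  have hnη : 0 < (n : ℝ) ^ (η / 4) := Real.rpow_pos_of_pos hn0 _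
  -- q = δ/(4n) works because A_k ≤ 2n a_n and a_{j+1} ≥ a_n / 2 for the indices concerned.
  refine ⟨n - (L + 1) * m, m, L, δ, δ / (4 * n), (1 - η) * a n, ?_, by omega, hδ0.le, by linarith,
    by positivity, ?_, ?_, hwin, ?_, hnη.trans_le hkey, ?_⟩
  · have h1 : (3 / 4 : ℝ) * 4 ≤ (1 - δ) * n :=
      mul_le_mul (by linarith) hn4' (by norm_num) (by linarith)
    have h2 : (1 : ℝ) ≤ ((n - (L + 1) * m : ℕ) : ℝ) := by linarith
    exact_mod_cast h2
  · have h1 : δ / (4 * n) * m / 2 = δ * m / (8 * n) := by field_simp; ring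
    rw [h1, div_le_one (by positivity)]
    have h2 : δ * m ≤ m := mul_le_of_le_one_left (Nat.cast_nonneg m) (by linarith)
    linarith
  · intro j k hj hjk hk
    have h1 : totalLength a k ≤ n * (2 * a n) := by
      calc totalLength a k ≤ totalLength a n := totalLength_mono ha hk.le
        _ ≤ ∑ i ∈ Finset.Icc 1 n, 2 * a n := Finset.sum_le_sum fun i hi =>
            hmax i (Finset.mem_Icc.1 hi).1 (Finset.mem_Icc.1 hi).2
        _ = n * (2 * a n) := by simp
    calc δ / (4 * n) * totalLength a k ≤ δ / (4 * n) * (n * (2 * a n)) := by gcongr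
      _ = δ * (1 / 2 * a n) := by field_simp; norm_num
      _ ≤ δ * a (j + 1) := by
          refine mul_le_mul_of_nonneg_left ?_ hδ0.le
          exact (mul_le_mul_of_nonneg_right (by linarith) han.le).trans
            (hwin j hj (hjk.trans hk))
  · have h0 : (3 / 4 : ℝ) * 2 ≤ (1 - η) * (η * f) :=
      mul_le_mul (by linarith) hf2' (by norm_num) (by linarith)
    have h1 : (1 - η) * ((1 - η) * f) ≤ L := by linarith
    have h2 : r ≤ (1 - η) * (1 - η) * ((1 - η) * (1 - η)) := by
      have e : r = 1 - 4 * η := by rw [hη]; ring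
      have h3 : 1 - 2 * η ≤ (1 - η) * (1 - η) := by linarith [sq_nonneg η]
      have h4 : 1 - 4 * η ≤ (1 - 2 * η) * (1 - 2 * η) := by linarith [sq_nonneg η]
      rw [e]
      exact h4.trans (mul_le_mul h3 h3 (by linarith) (mul_self_nonneg _))
    calc r * f * a n ≤ (1 - η) * (1 - η) * ((1 - η) * (1 - η)) * f * a n := by gcongr
      _ = ((1 - η) * ((1 - η) * f)) * ((1 - η) * ((1 - η) * a n)) := by ring
      _ ≤ L * ((1 - δ) * ((1 - η) * a n)) := by
          have h5 : 0 ≤ (1 - η) * a n := mul_nonneg (by linarith) han.le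
          have h6 : 0 ≤ 1 - η := by linarith
          gcongr
  · have h1 : (L : ℝ) ≤ n := by
      have := Real.log_le_sub_one_of_pos hn0
      linarith
    calc (L : ℝ) * Real.exp (-(m * (δ / (4 * n) * m / 2) ^ L / 5))
        ≤ n * Real.exp (-(3 * x)) := by
          gcongr
          linarith
      _ = (n : ℝ) ^ (-2 : ℝ) := by
          rw [Real.rpow_def_of_pos hn0, ← hx]
          nth_rw 1 [← Real.exp_log hn0]
          rw [← Real.exp_add, ← hx]
          congr 1
          ring

section Lower

variable {Ω : Type*} [MeasurableSpace Ω] {P : Measure Ω} [IsProbabilityMeasure P] {a : ℕ → ℝ}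
  {α : ℝ} {Y : ℕ → Ω → ℕ × ℝ}

theorem ae_eventually_le_treeHeight (ha : ∀ n : ℕ, 1 ≤ n → 0 < a n) (hα : 0 < α)
    (h : PotterBounds a α) (hY : IsGluingSequence P a Y) {r : ℝ} (hr0 : 0 < r) (hr1 : r < 1) :
    ∀ᵐ ω ∂P, ∀ᶠ n : ℕ in atTop, r ≤ treeHeight a Y n ω * Real.log (Real.log n) /
      (a n * Real.log n) := by
  have hsum : Summable fun n : ℕ => (n : ℝ) ^ (-2 : ℝ) := Real.summable_nat_rpow.2 (by norm_num)
  -- The bad event is restricted to outcomes with every gluing point in its tree, so that a nonempty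
  -- last chain set forces the height at each such outcome.
  have hbound : ∀ᶠ n : ℕ in atTop, P.real {ω | (∀ k : ℕ, 1 ≤ k → Y k ω ∈ treePoints a k) ∧
      treeHeight a Y n ω < r * (Real.log n / Real.log (Real.log n)) * a n} ≤
        (n : ℝ) ^ (-2 : ℝ) := by
    filter_upwards [eventually_exists_chain_parameters ha hα h hr0 hr1] with n hn
    obtain ⟨s, m, L, δ, q, c, hs, hsn, hδ0, hδ1, hq0, hqm, hq, hc, hH, hpos, hle⟩ := hn
    refine le_trans (measureReal_mono ?_) ((measureReal_chainSet_lt_le ha hY (i := L) hs hδ0 hδ1 hq0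
      hqm (by rw [hsn]; exact hq)).trans hle)
    rintro ω ⟨hgood, hω⟩
    by_contra hcon
    have hcard : (0 : ℝ) < (chainSet a δ s m (fun k => Y k ω) L).card :=
      hpos.trans_le (not_lt.1 hcon)
    obtain ⟨k, hk⟩ := Finset.card_pos.1 (by exact_mod_cast hcard)
    have hkB := Finset.mem_Ico.1 (chainSet_subset_block _ _ _ _ _ _ hk)
    rw [hsn] at hkB
    have h1 := le_baseHeight_of_mem_chainSet hs hδ1 hgood (c := c) (fun j hj => ?_) hk
      fun j hj => (baseHeight_mem_Icc ha hgood hj).1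
    · have h2 := baseHeight_le_treeHeight ha hgood (n := n) (j := k + 1) (by omega) (by omega)
      linarith
    · obtain ⟨hj1, hj2⟩ := Finset.mem_Ico.1 hj
      refine hc j hj1 (hj2.trans_le ?_)
      rw [← hsn]
      gcongr
      omega
  filter_upwards [ae_eventually_notMem_of_le hsum hbound, hY.ae_mem] with ω hω hgood
  filter_upwards [hω, eventually_ge_atTop 1, tendsto_log_natCast.eventually_gt_atTop 0,
    tendsto_log_log_natCast.eventually_gt_atTop 0] with n hn hn1 hL hLL
  have han := ha n hn1
  have h1 : r * (Real.log n / Real.log (Real.log n)) * a n ≤ treeHeight a Y n ω := by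
    by_contra hcon
    exact hn ⟨hgood, not_le.1 hcon⟩
  rw [le_div_iff₀ (by positivity)]
  calc r * (a n * Real.log n)
      = r * (Real.log n / Real.log (Real.log n)) * a n * Real.log (Real.log n) := by field_simp
    _ ≤ _ := by gcongr

theorem ae_tendsto_treeHeight (ha : ∀ n : ℕ, 1 ≤ n → 0 < a n) (hα : 0 < α)
    (h : PotterBounds a α) (hY : IsGluingSequence P a Y) :
    ∀ᵐ ω ∂P, Tendsto (fun n : ℕ => treeHeight a Y n ω * Real.log (Real.log n) /
      (a n * Real.log n)) atTop (𝓝 1) := by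
  have hε : ∀ k : ℕ, 1 / ((k : ℝ) + 2) < 1 ∧ 0 < 1 / ((k : ℝ) + 2) := fun k => by
    refine ⟨?_, by positivity⟩
    rw [div_lt_one (by positivity)]
    linarith [(Nat.cast_nonneg k : (0 : ℝ) ≤ k)]
  have h1 : ∀ᵐ ω ∂P, ∀ k : ℕ, ∀ᶠ n : ℕ in atTop, treeHeight a Y n ω * Real.log (Real.log n) /
      (a n * Real.log n) ≤ 1 + 1 / ((k : ℝ) + 2) :=
    ae_all_iff.2 fun k => ae_eventually_treeHeight_le ha hα h hY (by linarith [(hε k).2])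
  have h2 : ∀ᵐ ω ∂P, ∀ k : ℕ, ∀ᶠ n : ℕ in atTop, 1 - 1 / ((k : ℝ) + 2) ≤
      treeHeight a Y n ω * Real.log (Real.log n) / (a n * Real.log n) :=
    ae_all_iff.2 fun k => ae_eventually_le_treeHeight ha hα h hY (by linarith [(hε k).1])
      (by linarith [(hε k).2])
  filter_upwards [h1, h2] with ω hω1 hω2
  rw [Metric.tendsto_nhds]
  intro ε hε0
  obtain ⟨k, hk⟩ := exists_nat_one_div_lt hε0
  have hk2 : 1 / ((k : ℝ) + 2) < ε :=
    lt_of_le_of_lt (one_div_le_one_div_of_le (by positivity) (by linarith)) hk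
  filter_upwards [hω1 k, hω2 k] with n hn1 hn2
  rw [Real.dist_eq, abs_lt]
  constructor <;> linarith

end Lower

end LineBreaking

theorem mainTheorem1 {Ω : Type*} [MeasurableSpace Ω] (P : Measure Ω) [IsProbabilityMeasure P]
    (a : ℕ → ℝ) (α : ℝ) (ha : ∀ n : ℕ, 1 ≤ n → 0 < a n) (hα : 0 < α)
    (hreg : LineBreaking.IsRegularlyVarying a α)
    (Y : ℕ → Ω → ℕ × ℝ) (hY : LineBreaking.IsGluingSequence P a Y) :
    (∃! ν : ProbabilityMeasure ℝ, LineBreaking.IsXiLaw α ν) ∧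
    (∀ ν : ProbabilityMeasure ℝ, LineBreaking.IsXiLaw α ν →
      ∀ X : ℕ → Ω → ℕ × ℝ, (∀ n : ℕ, 1 ≤ n → LineBreaking.IsUniformPoint P a Y n (X n)) →
        TendstoInDistribution (fun n ω => LineBreaking.pointHeight Y X n ω / a n) atTop
          (id : ℝ → ℝ) (fun _ => P) (ν : Measure ℝ) ∧
        (∀ lam : ℝ,
          (∀ n : ℕ, 1 ≤ n → Integrable
            (fun ω => Real.exp (lam * (LineBreaking.pointHeight Y X n ω / a n))) P) ∧
          Tendsto
            (fun n : ℕ => ∫ ω, Real.exp (lam * (LineBreaking.pointHeight Y X n ω / a n)) ∂P)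
            atTop (𝓝 (∫ x, Real.exp (lam * x) ∂(ν : Measure ℝ)))) ∧
        (∀ p : ℝ, 0 < p →
          (∀ n : ℕ, 1 ≤ n → Integrable
            (fun ω => (LineBreaking.pointHeight Y X n ω / a n) ^ p) P) ∧
          Integrable (fun x : ℝ => x ^ p) (ν : Measure ℝ) ∧
          Tendsto (fun n : ℕ => ∫ ω, (LineBreaking.pointHeight Y X n ω / a n) ^ p ∂P)
            atTop (𝓝 (∫ x : ℝ, x ^ p ∂(ν : Measure ℝ))))) ∧
    (∀ᵐ ω ∂P, Tendsto
      (fun n : ℕ => LineBreaking.treeHeight a Y n ω * Real.log (Real.log n) /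
        (a n * Real.log n)) atTop (𝓝 1)) := by
  have h := hreg.potterBounds ha
  refine ⟨LineBreaking.existsUnique_isXiLaw ha hα h hY, fun ν hν X hX => ⟨?_, ?_, ?_⟩,
    LineBreaking.ae_tendsto_treeHeight ha hα h hY⟩
  · exact LineBreaking.tendstoInDistribution_pointHeight_div ha hα h hY hX hν
  · intro lam
    refine ⟨fun n _ => LineBreaking.integrable_exp_pointHeight_div ha hY hX n lam, ?_⟩
    rw [(hν lam).2]
    exact LineBreaking.tendsto_integral_exp_pointHeight_div ha hα h hY hX lam
  · intro p hp
    exact ⟨fun n _ => LineBreaking.integrable_rpow_pointHeight_div ha hY hX n hp,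
      LineBreaking.tendsto_integral_rpow_pointHeight_div ha hα h hY hX hν hp⟩
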